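/- Let $\Omega\subset\mathbb R^n$ be a bounded convex domain (open convex set), $P\in\partial\Omega$, $0<\alpha<1$, $\mathfrak d=\operatorname{diam}\Omega$. For $Q\in\Omega$ put $r=|Q-P|$, $\mathbf e=(Q-P)/r$, $T=P+t\mathbf e$, let $d=d(\mathbf e)$ be the length of the part within $\Omega$ of the ray from $P$ in the direction $\mathbf e$, and let $C_n^{(\alpha)}=(n-1)!/\Gamma(n-\alpha)$. The Kipriyanov fractional derivative is $$(\mathfrak D^\alpha f)(Q)=\frac{\alpha}{\Gamma(1-\alpha)}\int_0^r\frac{f(Q)-f(T)}{(r-t)^{\alpha+1}}\Big(\frac tr\Big)^{n-1}dt+C_n^{(\alpha)}f(Q)\,r^{-\alpha},$$ and the right-side directional fractional derivative $\mathfrak D^\alpha_{d-}f$ is the limit in $L_2(\Omega)$, as $\varepsilon\downarrow0$, of $$\frac{f(Q)(d-r)^{-\alpha}}{\Gamma(1-\alpha)}+\frac{\alpha}{\Gamma(1-\alpha)}(\psi_\varepsilon^-f)(Q),\qquad (\psi^-_\varepsilon f)(Q)=\begin{cases}\displaystyle\int_{r+\varepsilon}^d\frac{f(Q)-f(T)}{(t-r)^{\alpha+1}}dt,&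 r\le d-\varepsilon,\\[2mm] \dfrac{f(Q)}{\alpha}\Big(\dfrac1{\varepsilon^{\alpha}}-\dfrac1{(d-r)^{\alpha}}\Big),& r>d-\varepsilon.\end{cases}$$ Let $a^{ij}\in C^1(\overline\Omega)$ be real, $\sum_{i,j} a^{ij}(Q)\xi_i\xi_j\ge a_0|\xi|^2$ for $Q\in\Omega$, $\xi\in\mathbb R^n$, with $a_0>0$. Let $\rho>0$ on $\Omega$ and $|\rho(Q)-\rho(Q')|\le M|Q-Q'|^\lambda$ for $Q,Q'\in\overline\Omega$, where $\alpha<\lambda\le1$. Suppose that $\mu>0$, where $$\mu=\tfrac12\mathfrak d^{-\alpha}\Big(\tfrac1{\Gamma(1-\alpha)}+C_n^{(\alpha)}\Big)-\frac{\alpha M\mathfrak d^{\lambda-\alpha}}{2\Gamma(1-\alpha)(\lambda-\alpha)\inf_\Omega\rho}\quad(\text{if }\inf_\Omega\rho>0),$$ or, if $\rho$ is non-increasing along every ray from $P$, $\mu=\tfrac12\mathfrak d^{-\alpha}\big(\tfrac1{\Gamma(1-\alpha)}+C_n^{(\alpha)}\big)$. In the complex Hilbert space $L_2(\Omega)$ consider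 $$Lu=-\sum_{i,j}D_j(a^{ij}D_iu)+\rho\,\mathfrak D^\alpha u,\qquad L^+u=-\sum_{i,j}D_i(a^{ij}D_ju)+\mathfrak D^\alpha_{d-}(\rho u),\qquad D(L)=D(L^+)=H^2(\Omega)\cap H^1_0(\Omega).$$ **Theorem 4.2.** The operators $L$ and $L^+$ are well defined on $H^2(\Omega)\cap H_0^1(\Omega)$, with values in $L_2(\Omega)$, and are closable. Their closures $\tilde L$, $\tilde L^+$ are strictly accretive: there is $\delta>0$ with $\operatorname{Re}(\tilde Lu,u)\ge\delta\|u\|^2$ for all $u\in D(\tilde L)$, and likewise for $\tilde L^+$. Their numerical ranges $\{(Tu,u):u\in D(T),\ \|u\|=1\}$, $T=\tilde L,\tilde L^+$, both lie in the sector $$\{\zeta\in\mathbb C:|\arg(\zeta-\gamma)|\le\theta\},\qquad \theta=\arctan\frac{a_1+\eta}{a_0}<\frac\pi2,\qquad\gamma=\mu\inf_\Omega\rho-C,$$ (vertex included), where $a_1$ is any upper bound of $\big(\sum_{i,j}|a^{ij}(Q)|^2\big)^{1/2}$ on $\Omega$, $\eta>0$ is arbitrary, and $C$ is a constant that depends only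 on $\Omega,\alpha,a_0,a_1,\eta$ and an upper bound of $\rho$ on $\Omega$ (not on $P$ and not otherwise on $a^{ij}$, $\rho$, $\lambda$, $M$). -/

import Mathlib

open MeasureTheory Filter Topology
open scoped ContDiff ENNReal InnerProductSpace

noncomputable section

namespace Kipriyanov

/-- Euclidean `n`-space. -/
abbrev Space (n : ℕ) := EuclideanSpace ℝ (Fin n)

/-- The complex Hilbert space `L₂(Ω)`. -/
abbrev L2 {n : ℕ} (Ω : Set (Space n)) := Lp ℂ 2 (volume.restrict Ω)

variable {n : ℕ}

/-! ### Sobolev spaces -/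

/-- The classical partial derivative in the `i`-th coordinate. -/
def pderiv {F : Type*} [NormedAddCommGroup F] [NormedSpace ℝ F] (i : Fin n)
    (φ : Space n → F) (x : Space n) : F :=
  fderiv ℝ φ x (EuclideanSpace.single i 1)

/-- Smooth functions with compact support contained in `Ω`. -/
structure IsTest {F : Type*} [NormedAddCommGroup F] [NormedSpace ℝ F] (Ω : Set (Space n))
    (φ : Space n → F) : Prop where
  smooth : ContDiff ℝ ∞ φ
  compact : HasCompactSupport φ
  subset : tsupport φ ⊆ Ω

/-- `g` is the weak derivative of `f` in `Ω` with respect to the `i`-th coordinate. -/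
structure IsWeakDeriv (Ω : Set (Space n)) (i : Fin n) (f g : Space n → ℂ) : Prop where
  left : LocallyIntegrableOn f Ω
  right : LocallyIntegrableOn g Ω
  eq : ∀ φ : Space n → ℝ, IsTest Ω φ →
    ∫ x in Ω, pderiv i φ x • f x = - ∫ x in Ω, φ x • g x

theorem integrableOn_smul_of_compact {Ω : Set (Space n)} {f : Space n → ℂ}
    (hf : LocallyIntegrableOn f Ω) {ψ : Space n → ℝ} (hc : Continuous ψ)
    (hs : HasCompactSupport ψ) (hsub : tsupport ψ ⊆ Ω) :
    IntegrableOn (fun x => ψ x • f x) Ω := by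
  have h1 : IntegrableOn f (tsupport ψ) := hf.integrableOn_compact_subset hsub hs
  have h2 : IntegrableOn (fun x => ψ x • f x) (tsupport ψ) :=
    h1.continuousOn_smul hc.continuousOn hs
  have h3 : Integrable (fun x => ψ x • f x) volume := by
    rw [← integrableOn_iff_integrable_of_support_subset (s := tsupport ψ)]
    · exact h2
    · intro x hx
      apply subset_tsupport
      intro h0
      exact hx (by simp [h0])
  exact h3.integrableOn

theorem IsTest.integrableOn {Ω : Set (Space n)} {f : Space n → ℂ}
    (hf : LocallyIntegrableOn f Ω) {φ : Space n → ℝ} (hφ : IsTest Ω φ) :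
    IntegrableOn (fun x => φ x • f x) Ω :=
  integrableOn_smul_of_compact hf hφ.smooth.continuous hφ.compact hφ.subset

theorem IsTest.integrableOn_pderiv {Ω : Set (Space n)} {f : Space n → ℂ}
    (hf : LocallyIntegrableOn f Ω) {φ : Space n → ℝ} (hφ : IsTest Ω φ) (i : Fin n) :
    IntegrableOn (fun x => pderiv i φ x • f x) Ω := by
  have hc : Continuous (fderiv ℝ φ) := hφ.smooth.continuous_fderiv (by simp)
  have hsub : tsupport (pderiv i φ) ⊆ tsupport φ := by
    refine closure_minimal ?_ (isClosed_tsupport φ)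
    intro x hx
    apply support_fderiv_subset ℝ
    intro h0
    exact hx (by simp [pderiv, h0])
  refine integrableOn_smul_of_compact hf ?_ ?_ (hsub.trans hφ.subset)
  · exact hc.clm_apply continuous_const
  · exact hφ.compact.of_isClosed_subset (isClosed_tsupport _) hsub

theorem IsWeakDeriv.congr {Ω : Set (Space n)} {i : Fin n} {f g f' g' : Space n → ℂ}
    (h : IsWeakDeriv Ω i f g) (hf : f =ᵐ[volume.restrict Ω] f')
    (hg : g =ᵐ[volume.restrict Ω] g') : IsWeakDeriv Ω i f' g' := by
  have key : ∀ {u v : Space n → ℂ}, u =ᵐ[volume.restrict Ω] v → LocallyIntegrableOn u Ω →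
      LocallyIntegrableOn v Ω := by
    intro u v huv hu x hx
    obtain ⟨s, hs, hi⟩ := hu x hx
    refine ⟨s ∩ Ω, inter_mem hs self_mem_nhdsWithin, ?_⟩
    exact (hi.mono_set Set.inter_subset_left).congr_fun_ae
      (ae_mono (Measure.restrict_mono Set.inter_subset_right le_rfl) huv)
  refine ⟨key hf h.left, key hg h.right, fun φ hφ => ?_⟩
  have e1 : ∫ x in Ω, pderiv i φ x • f' x = ∫ x in Ω, pderiv i φ x • f x :=
    integral_congr_ae (by filter_upwards [hf] with x hx; rw [hx])
  have e2 : ∫ x in Ω, φ x • g' x = ∫ x in Ω, φ x • g x :=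
    integral_congr_ae (by filter_upwards [hg] with x hx; rw [hx])
  rw [e1, e2, h.eq φ hφ]

theorem IsWeakDeriv.add {Ω : Set (Space n)} {i : Fin n} {f g f' g' : Space n → ℂ}
    (h : IsWeakDeriv Ω i f g) (h' : IsWeakDeriv Ω i f' g') :
    IsWeakDeriv Ω i (f + f') (g + g') := by
  refine ⟨h.left.add h'.left, h.right.add h'.right, fun φ hφ => ?_⟩
  simp only [Pi.add_apply, smul_add]
  rw [integral_add (hφ.integrableOn_pderiv h.left i) (hφ.integrableOn_pderiv h'.left i),
    integral_add (hφ.integrableOn h.right) (hφ.integrableOn h'.right), h.eq φ hφ, h'.eq φ hφ,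
    neg_add]

theorem IsWeakDeriv.smul {Ω : Set (Space n)} {i : Fin n} {f g : Space n → ℂ}
    (h : IsWeakDeriv Ω i f g) (c : ℂ) : IsWeakDeriv Ω i (c • f) (c • g) := by
  have key : ∀ {u : Space n → ℂ}, LocallyIntegrableOn u Ω → LocallyIntegrableOn (c • u) Ω := by
    intro u hu x hx
    obtain ⟨s, hs, hi⟩ := hu x hx
    exact ⟨s, hs, hi.smul c⟩
  refine ⟨key h.left, key h.right, fun φ hφ => ?_⟩
  simp only [Pi.smul_apply, smul_comm _ c]
  rw [integral_smul, integral_smul, h.eq φ hφ, smul_neg]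

theorem isWeakDeriv_zero (Ω : Set (Space n)) (i : Fin n) :
    IsWeakDeriv Ω i (0 : Space n → ℂ) 0 :=
  ⟨locallyIntegrableOn_zero, locallyIntegrableOn_zero, fun φ _ => by simp⟩

theorem IsWeakDeriv.eq_zero {Ω : Set (Space n)} (hΩ : IsOpen Ω) {i : Fin n}
    {f g : Space n → ℂ} (h : IsWeakDeriv Ω i f g) (hf : f =ᵐ[volume.restrict Ω] 0) :
    g =ᵐ[volume.restrict Ω] 0 := by
  have h' := h.congr hf (ae_eq_refl g)
  have := hΩ.ae_eq_zero_of_integral_contDiff_smul_eq_zero h.right (fun φ h1 h2 h3 => by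
    have h4 := h'.eq φ ⟨h1, h2, h3⟩
    simp only [Pi.zero_apply, smul_zero, integral_zero] at h4
    rw [← setIntegral_eq_integral_of_forall_compl_eq_zero (s := Ω)]
    · simpa using h4.symm
    · intro x hx
      rw [image_eq_zero_of_notMem_tsupport (fun hx' => hx (h3 hx')), zero_smul])
  exact (ae_restrict_iff' hΩ.measurableSet).2 this

/-- `H²(Ω)`: the elements of `L₂(Ω)` whose weak derivatives of first and second order
exist and lie in `L₂(Ω)`. -/
def H2 (Ω : Set (Space n)) : Submodule ℂ (L2 Ω) where
  carrier := {u | ∃ (g : Fin n → L2 Ω) (h : Fin n → Fin n → L2 Ω),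
    (∀ i, IsWeakDeriv Ω i u (g i)) ∧ ∀ i j, IsWeakDeriv Ω j (g i) (h i j)}
  zero_mem' := by
    refine ⟨0, 0, fun i => ?_, fun i j => ?_⟩
    · exact (isWeakDeriv_zero Ω i).congr (Lp.coeFn_zero _ _ _).symm (Lp.coeFn_zero _ _ _).symm
    · exact (isWeakDeriv_zero Ω j).congr (Lp.coeFn_zero _ _ _).symm (Lp.coeFn_zero _ _ _).symm
  add_mem' := by
    rintro u v ⟨g, h, hg, hh⟩ ⟨g', h', hg', hh'⟩
    refine ⟨g + g', h + h', fun i => ?_, fun i j => ?_⟩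
    · exact ((hg i).add (hg' i)).congr (Lp.coeFn_add _ _).symm (Lp.coeFn_add _ _).symm
    · exact ((hh i j).add (hh' i j)).congr (Lp.coeFn_add _ _).symm (Lp.coeFn_add _ _).symm
  smul_mem' := by
    rintro c u ⟨g, h, hg, hh⟩
    refine ⟨c • g, c • h, fun i => ?_, fun i j => ?_⟩
    · exact ((hg i).smul c).congr (Lp.coeFn_smul _ _).symm (Lp.coeFn_smul _ _).symm
    · exact ((hh i j).smul c).congr (Lp.coeFn_smul _ _).symm (Lp.coeFn_smul _ _).symm

/-- `φ k → u` in `L₂(Ω)`. -/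
def TendstoL2 (Ω : Set (Space n)) (φ : ℕ → Space n → ℂ) (u : Space n → ℂ) : Prop :=
  Tendsto (fun k => eLpNorm (φ k - u) 2 (volume.restrict Ω)) atTop (𝓝 0)

theorem IsTest.aesm {Ω : Set (Space n)} {φ : Space n → ℂ} (h : IsTest Ω φ)
    (μ : Measure (Space n)) : AEStronglyMeasurable φ μ :=
  h.smooth.continuous.aestronglyMeasurable

theorem IsTest.pderiv_aesm {Ω : Set (Space n)} {φ : Space n → ℂ} (h : IsTest Ω φ) (i : Fin n)
    (μ : Measure (Space n)) : AEStronglyMeasurable (pderiv i φ) μ :=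
  ((h.smooth.continuous_fderiv (by simp)).clm_apply continuous_const).aestronglyMeasurable

theorem TendstoL2.congr {Ω : Set (Space n)} {φ : ℕ → Space n → ℂ} {u v : Space n → ℂ}
    (h : TendstoL2 Ω φ u) (huv : u =ᵐ[volume.restrict Ω] v) : TendstoL2 Ω φ v := by
  refine Tendsto.congr (fun k => eLpNorm_congr_ae ?_) h
  filter_upwards [huv] with x hx
  simp [hx]

theorem TendstoL2.add {Ω : Set (Space n)} {φ ψ : ℕ → Space n → ℂ} {u v : Space n → ℂ}
    (h : TendstoL2 Ω φ u) (h' : TendstoL2 Ω ψ v)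
    (hm : ∀ k, AEStronglyMeasurable (φ k - u) (volume.restrict Ω))
    (hm' : ∀ k, AEStronglyMeasurable (ψ k - v) (volume.restrict Ω)) :
    TendstoL2 Ω (φ + ψ) (u + v) := by
  have h0 := Tendsto.add h h'
  rw [add_zero] at h0
  refine tendsto_of_tendsto_of_tendsto_of_le_of_le tendsto_const_nhds h0
    (fun _ => bot_le) (fun k => ?_)
  have : (φ + ψ) k - (u + v) = (φ k - u) + (ψ k - v) := by
    simp only [Pi.add_apply]; abel
  change eLpNorm ((φ + ψ) k - (u + v)) 2 _ ≤ _
  rw [this]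
  exact eLpNorm_add_le (hm k) (hm' k) (by norm_num)

theorem TendstoL2.smul {Ω : Set (Space n)} {φ : ℕ → Space n → ℂ} {u : Space n → ℂ}
    (h : TendstoL2 Ω φ u) (c : ℂ) : TendstoL2 Ω (c • φ) (c • u) := by
  have h0 := ENNReal.Tendsto.const_mul (a := ‖c‖ₑ) h (Or.inr enorm_ne_top)
  rw [mul_zero] at h0
  refine h0.congr (fun k => ?_)
  rw [← eLpNorm_const_smul, smul_sub]
  rfl

/-- `H¹₀(Ω)`: the closure of the test functions in `H¹(Ω)`. -/
def H10 (Ω : Set (Space n)) : Submodule ℂ (L2 Ω) where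
  carrier := {u | ∃ (g : Fin n → L2 Ω) (φ : ℕ → Space n → ℂ),
    (∀ i, IsWeakDeriv Ω i u (g i)) ∧ (∀ k, IsTest Ω (φ k)) ∧ TendstoL2 Ω φ u ∧
      ∀ i, TendstoL2 Ω (fun k => pderiv i (φ k)) (g i)}
  zero_mem' := by
    have hp : ∀ i : Fin n, pderiv i (0 : Space n → ℂ) = 0 := by
      intro i; ext x; simp [pderiv]
    have ht : TendstoL2 Ω (fun _ => (0 : Space n → ℂ)) 0 := by
      simp [TendstoL2]
    refine ⟨0, fun _ => 0, fun i => ?_, fun k => ?_, ?_, fun i => ?_⟩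
    · exact (isWeakDeriv_zero Ω i).congr (Lp.coeFn_zero _ _ _).symm (Lp.coeFn_zero _ _ _).symm
    · exact ⟨contDiff_const, HasCompactSupport.zero, by simp⟩
    · exact ht.congr (Lp.coeFn_zero _ _ _).symm
    · simp only [hp]
      exact ht.congr (Lp.coeFn_zero _ _ _).symm
  add_mem' := by
    rintro u v ⟨g, φ, hg, hφ, hu, hd⟩ ⟨g', ψ, hg', hψ, hv, hd'⟩
    refine ⟨g + g', φ + ψ, fun i => ?_, fun k => ?_, ?_, fun i => ?_⟩
    · exact ((hg i).add (hg' i)).congr (Lp.coeFn_add _ _).symm (Lp.coeFn_add _ _).symm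
    · exact ⟨(hφ k).smooth.add (hψ k).smooth, (hφ k).compact.add (hψ k).compact,
        (tsupport_add _ _).trans (Set.union_subset (hφ k).subset (hψ k).subset)⟩
    · exact (hu.add hv (fun k => ((hφ k).aesm _).sub (Lp.aestronglyMeasurable _))
        (fun k => ((hψ k).aesm _).sub (Lp.aestronglyMeasurable _))).congr
        (Lp.coeFn_add _ _).symm
    · have hp : (fun k => pderiv i ((φ + ψ) k)) =
          (fun k => pderiv i (φ k)) + fun k => pderiv i (ψ k) := by
        ext k x
        simp only [pderiv, Pi.add_apply]
        rw [fderiv_add ((hφ k).smooth.differentiable (by simp) x)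
          ((hψ k).smooth.differentiable (by simp) x)]
        rfl
      rw [hp]
      exact ((hd i).add (hd' i)
        (fun k => ((hφ k).pderiv_aesm i _).sub (Lp.aestronglyMeasurable _))
        (fun k => ((hψ k).pderiv_aesm i _).sub (Lp.aestronglyMeasurable _))).congr
        (Lp.coeFn_add _ _).symm
  smul_mem' := by
    rintro c u ⟨g, φ, hg, hφ, hu, hd⟩
    refine ⟨c • g, c • φ, fun i => ?_, fun k => ?_, ?_, fun i => ?_⟩
    · exact ((hg i).smul c).congr (Lp.coeFn_smul _ _).symm (Lp.coeFn_smul _ _).symm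
    · have hs : tsupport (c • φ k) ⊆ tsupport (φ k) :=
        closure_mono (Function.support_const_smul_subset c (φ k))
      exact ⟨(hφ k).smooth.const_smul c,
        (hφ k).compact.of_isClosed_subset (isClosed_tsupport _) hs, hs.trans (hφ k).subset⟩
    · exact (hu.smul c).congr (Lp.coeFn_smul _ _).symm
    · have hp : (fun k => pderiv i ((c • φ) k)) = c • fun k => pderiv i (φ k) := by
        ext k x
        simp only [pderiv, Pi.smul_apply]
        rw [fderiv_const_smul ((hφ k).smooth.differentiable (by simp) x)]
        rfl
      rw [hp]
      exact ((hd i).smul c).congr (Lp.coeFn_smul _ _).symm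

/-! ### Directional fractional derivatives

Throughout, `r = dist P Q`, `e = (Q - P) / r`, and `T = P + t e`. -/

/-- The point `T = P + t e` of the ray from `P` through `Q`. -/
def ray (P Q : Space n) (t : ℝ) : Space n := P + (t / dist P Q) • (Q - P)

/-- The length `d(e)` of the part within `Ω` of the ray from `P` through `Q`. -/
def rayLength (Ω : Set (Space n)) (P Q : Space n) : ℝ := sSup {t : ℝ | ray P Q t ∈ Ω}

/-- The constant `C_n^{(α)} = (n - 1)! / Γ(n - α)`. -/
def kipConst (n : ℕ) (α : ℝ) : ℝ := (Nat.factorial (n - 1) : ℝ) / Real.Gamma (n - α)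

/-- The integrand `(f(Q) - f(T)) (r - t)^{-α-1} (t / r)^{n-1}`. -/
def kipIntegrand (α : ℝ) (P : Space n) (f : Space n → ℂ) (Q : Space n) (t : ℝ) : ℂ :=
  ((t / dist P Q) ^ (n - 1) / (dist P Q - t) ^ (α + 1)) • (f Q - f (ray P Q t))

/-- The Kipriyanov fractional derivative `(𝔇^α f)(Q)` with respect to the point `P`. -/
def kip (α : ℝ) (P : Space n) (f : Space n → ℂ) (Q : Space n) : ℂ :=
  (α / Real.Gamma (1 - α)) • (∫ t in (0)..(dist P Q), kipIntegrand α P f Q t) +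
    (kipConst n α * dist P Q ^ (-α)) • f Q

/-- `v = ρ 𝔇^α f` almost everywhere in `Ω`, where the integral that defines `𝔇^α f` converges
absolutely almost everywhere in `Ω`. -/
structure IsKip (Ω : Set (Space n)) (α : ℝ) (P : Space n) (ρ : Space n → ℝ)
    (f v : Space n → ℂ) : Prop where
  integrable : ∀ᵐ Q ∂volume.restrict Ω,
    IntervalIntegrable (kipIntegrand α P f Q) volume 0 (dist P Q)
  eq : v =ᵐ[volume.restrict Ω] fun Q => ρ Q • kip α P f Q

/-- The integrand `(f(Q) - f(T)) (t - r)^{-α-1}`. -/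
def rightIntegrand (α : ℝ) (P : Space n) (f : Space n → ℂ) (Q : Space n) (t : ℝ) : ℂ :=
  (1 / (t - dist P Q) ^ (α + 1)) • (f Q - f (ray P Q t))

/-- The truncated integral `(ψ_ε^- f)(Q)`. -/
def rightPsi (Ω : Set (Space n)) (α : ℝ) (P : Space n) (ε : ℝ) (f : Space n → ℂ)
    (Q : Space n) : ℂ :=
  if dist P Q ≤ rayLength Ω P Q - ε then
    ∫ t in (dist P Q + ε)..(rayLength Ω P Q), rightIntegrand α P f Q t
  else
    (1 / α * (1 / ε ^ α - 1 / (rayLength Ω P Q - dist P Q) ^ α)) • f Q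

/-- The truncated right-side directional fractional derivative `(𝔇^α_{d-,ε} f)(Q)`. -/
def rightTrunc (Ω : Set (Space n)) (α : ℝ) (P : Space n) (ε : ℝ) (f : Space n → ℂ)
    (Q : Space n) : ℂ :=
  (1 / Real.Gamma (1 - α) * (rayLength Ω P Q - dist P Q) ^ (-α)) • f Q +
    (α / Real.Gamma (1 - α)) • rightPsi Ω α P ε f Q

/-- `v = 𝔇^α_{d-} f`: the truncated derivatives are well-defined elements of `L₂(Ω)` and converge
to `v` in `L₂(Ω)` as `ε ↓ 0`. -/
structure IsRightDeriv (Ω : Set (Space n)) (α : ℝ) (P : Space n) (f v : Space n → ℂ) :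
    Prop where
  integrable : ∀ ε : ℝ, 0 < ε → ∀ᵐ Q ∂volume.restrict Ω, dist P Q ≤ rayLength Ω P Q - ε →
    IntervalIntegrable (rightIntegrand α P f Q) volume (dist P Q + ε) (rayLength Ω P Q)
  memLp : ∀ ε : ℝ, 0 < ε → MemLp (rightTrunc Ω α P ε f) 2 (volume.restrict Ω)
  target : MemLp v 2 (volume.restrict Ω)
  tendsto : Tendsto (fun ε => eLpNorm (rightTrunc Ω α P ε f - v) 2 (volume.restrict Ω))
    (𝓝[>] 0) (𝓝 0)

/-- Changing a function on a null set changes it on almost no ray from `P`. -/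
theorem ae_ray_eq (P : Space n) {f g : Space n → ℂ} (h : f =ᵐ[volume] g) :
    ∀ᵐ Q : Space n, f Q = g Q ∧ ∀ᵐ t : ℝ, f (ray P Q t) = g (ray P Q t) := by
  set N := toMeasurable volume {x | f x ≠ g x} with hN
  have hN0 : volume N = 0 := by rw [hN, measure_toMeasurable]; exact h
  have hNm : MeasurableSet N := measurableSet_toMeasurable _ _
  have hsub : ∀ x, x ∉ N → f x = g x := fun x hx => by
    by_contra hne
    exact hx (subset_toMeasurable _ _ hne)
  have hs : ∀ᵐ s : ℝ, ∀ᵐ Q : Space n, P + s • (Q - P) ∉ N := by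
    have h0 : ∀ᵐ s : ℝ, s ≠ 0 := by simp [ae_iff]
    filter_upwards [h0] with s hs
    have q1 := Measure.quasiMeasurePreserving_smul (volume : Measure (Space n)) hs
    have q2 := (measurePreserving_sub_right (volume : Measure (Space n)) P).quasiMeasurePreserving
    have q3 := (measurePreserving_add_left (volume : Measure (Space n)) P).quasiMeasurePreserving
    have q := q3.comp (q1.comp q2)
    have hN' : ∀ᵐ x : Space n, x ∉ N := by simpa [ae_iff] using hN0
    exact q.ae hN'
  have hm : MeasurableSet {x : ℝ × Space n | P + x.1 • (x.2 - P) ∉ N} := by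
    have : Measurable fun x : ℝ × Space n => P + x.1 • (x.2 - P) := by fun_prop
    exact this hNm.compl
  have hQ : ∀ᵐ Q : Space n, ∀ᵐ s : ℝ, P + s • (Q - P) ∉ N := (Measure.ae_ae_comm hm).1 hs
  filter_upwards [h, hQ] with Q h1 h2
  refine ⟨h1, ?_⟩
  by_cases hr : dist P Q = 0
  · have : Q = P := (dist_eq_zero.1 hr).symm
    subst this
    exact Eventually.of_forall fun t => by simpa [ray] using h1
  · have q := Measure.quasiMeasurePreserving_smul (volume : Measure ℝ) (inv_ne_zero hr)
    filter_upwards [q.ae h2] with t ht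
    apply hsub
    simpa [ray, div_eq_inv_mul] using ht

theorem IsKip.congr {Ω : Set (Space n)} {α : ℝ} {P : Space n} {ρ : Space n → ℝ}
    {f f' v v' : Space n → ℂ} (h : IsKip Ω α P ρ f v) (hf : f =ᵐ[volume] f')
    (hv : v =ᵐ[volume.restrict Ω] v') : IsKip Ω α P ρ f' v' := by
  have hr := ae_restrict_of_ae (s := Ω) (ae_ray_eq P hf)
  have hi : ∀ᵐ Q ∂volume.restrict Ω, f Q = f' Q ∧
      ∀ᵐ t : ℝ, kipIntegrand α P f Q t = kipIntegrand α P f' Q t := by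
    filter_upwards [hr] with Q hQ
    refine ⟨hQ.1, ?_⟩
    filter_upwards [hQ.2] with t ht
    simp only [kipIntegrand, hQ.1, ht]
  refine ⟨?_, ?_⟩
  · filter_upwards [hi, h.integrable] with Q h1 h2
    exact h2.congr_ae (ae_restrict_of_ae h1.2)
  · filter_upwards [hi, h.eq, hv] with Q h1 h2 h3
    rw [← h3, h2, kip, kip, h1.1,
      intervalIntegral.integral_congr_ae (h1.2.mono fun t ht _ => ht)]

theorem IsKip.zero (Ω : Set (Space n)) (α : ℝ) (P : Space n) (ρ : Space n → ℝ) :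
    IsKip Ω α P ρ 0 0 := by
  have h0 : ∀ Q, kipIntegrand α P (0 : Space n → ℂ) Q = 0 := fun Q => by
    ext t; simp [kipIntegrand]
  refine ⟨Eventually.of_forall fun Q => ?_, Eventually.of_forall fun Q => ?_⟩
  · rw [h0]; exact intervalIntegrable_const (c := (0 : ℂ))
  · simp [kip, h0]

theorem IsKip.add {Ω : Set (Space n)} {α : ℝ} {P : Space n} {ρ : Space n → ℝ}
    {f f' v v' : Space n → ℂ} (h : IsKip Ω α P ρ f v) (h' : IsKip Ω α P ρ f' v') :
    IsKip Ω α P ρ (f + f') (v + v') := by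
  have h0 : ∀ Q, kipIntegrand α P (f + f') Q =
      kipIntegrand α P f Q + kipIntegrand α P f' Q := fun Q => by
    ext t
    simp only [kipIntegrand, Pi.add_apply, ← smul_add]
    congr 1; ring
  refine ⟨?_, ?_⟩
  · filter_upwards [h.integrable, h'.integrable] with Q h1 h2
    rw [h0]; exact h1.add h2
  · filter_upwards [h.integrable, h'.integrable, h.eq, h'.eq] with Q h1 h2 h3 h4
    simp only [Pi.add_apply, h3, h4, kip, h0]
    rw [intervalIntegral.integral_add h1 h2]
    simp only [smul_add]
    abel

theorem IsKip.smul {Ω : Set (Space n)} {α : ℝ} {P : Space n} {ρ : Space n → ℝ}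
    {f v : Space n → ℂ} (h : IsKip Ω α P ρ f v) (c : ℂ) :
    IsKip Ω α P ρ (c • f) (c • v) := by
  have h0 : ∀ Q, kipIntegrand α P (c • f) Q = c • kipIntegrand α P f Q := fun Q => by
    ext t
    simp only [kipIntegrand, Pi.smul_apply, ← smul_sub, smul_comm c]
  refine ⟨?_, ?_⟩
  · filter_upwards [h.integrable] with Q h1
    rw [h0]; exact h1.smul c
  · filter_upwards [h.eq] with Q h3
    simp only [Pi.smul_apply, h3, kip, h0, intervalIntegral.integral_smul, smul_add,
      smul_comm c]

theorem rightTrunc_congr {Ω : Set (Space n)} {α : ℝ} {P : Space n} {f f' : Space n → ℂ}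
    (hf : f =ᵐ[volume] f') (ε : ℝ) :
    rightTrunc Ω α P ε f =ᵐ[volume.restrict Ω] rightTrunc Ω α P ε f' := by
  filter_upwards [ae_restrict_of_ae (s := Ω) (ae_ray_eq P hf)] with Q hQ
  have : ∫ t in (dist P Q + ε)..(rayLength Ω P Q), rightIntegrand α P f Q t =
      ∫ t in (dist P Q + ε)..(rayLength Ω P Q), rightIntegrand α P f' Q t :=
    intervalIntegral.integral_congr_ae (hQ.2.mono fun t ht _ => by
      simp only [rightIntegrand, hQ.1, ht])
  simp only [rightTrunc, rightPsi, hQ.1, this]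

theorem IsRightDeriv.congr {Ω : Set (Space n)} {α : ℝ} {P : Space n}
    {f f' v v' : Space n → ℂ} (h : IsRightDeriv Ω α P f v) (hf : f =ᵐ[volume] f')
    (hv : v =ᵐ[volume.restrict Ω] v') : IsRightDeriv Ω α P f' v' := by
  refine ⟨fun ε hε => ?_, fun ε hε => ?_, ?_, ?_⟩
  · filter_upwards [ae_restrict_of_ae (s := Ω) (ae_ray_eq P hf), h.integrable ε hε]
      with Q hQ h1 h2
    refine (h1 h2).congr_ae (ae_restrict_of_ae (hQ.2.mono fun t ht => ?_))
    simp only [rightIntegrand, hQ.1, ht]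
  · exact (memLp_congr_ae (rightTrunc_congr hf ε)).1 (h.memLp ε hε)
  · exact (memLp_congr_ae hv).1 h.target
  · exact h.tendsto.congr fun ε => eLpNorm_congr_ae ((rightTrunc_congr hf ε).sub hv)

theorem IsRightDeriv.zero (Ω : Set (Space n)) (α : ℝ) (P : Space n) :
    IsRightDeriv Ω α P 0 0 := by
  have h0 : ∀ Q, rightIntegrand α P (0 : Space n → ℂ) Q = 0 := fun Q => by
    ext t; simp [rightIntegrand]
  have h1 : ∀ ε, rightTrunc Ω α P ε (0 : Space n → ℂ) = 0 := fun ε => by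
    ext Q; simp [rightTrunc, rightPsi, h0]
  refine ⟨fun ε _ => Eventually.of_forall fun Q _ => ?_, fun ε _ => ?_, MemLp.zero, ?_⟩
  · rw [h0]; exact intervalIntegrable_const (c := (0 : ℂ))
  · rw [h1]; exact MemLp.zero
  · simp [h1]

theorem IsRightDeriv.add {Ω : Set (Space n)} {α : ℝ} {P : Space n}
    {f f' v v' : Space n → ℂ} (h : IsRightDeriv Ω α P f v) (h' : IsRightDeriv Ω α P f' v') :
    IsRightDeriv Ω α P (f + f') (v + v') := by
  have h0 : ∀ Q, rightIntegrand α P (f + f') Q =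
      rightIntegrand α P f Q + rightIntegrand α P f' Q := fun Q => by
    ext t
    simp only [rightIntegrand, Pi.add_apply, ← smul_add]
    congr 1; ring
  have h1 : ∀ ε : ℝ, 0 < ε → rightTrunc Ω α P ε (f + f') =ᵐ[volume.restrict Ω]
      rightTrunc Ω α P ε f + rightTrunc Ω α P ε f' := by
    intro ε hε
    filter_upwards [h.integrable ε hε, h'.integrable ε hε] with Q h2 h3
    by_cases hc : dist P Q ≤ rayLength Ω P Q - ε
    · simp only [rightTrunc, rightPsi, if_pos hc, h0, Pi.add_apply]
      rw [intervalIntegral.integral_add (h2 hc) (h3 hc)]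
      simp only [smul_add]
      abel
    · simp only [rightTrunc, rightPsi, if_neg hc, Pi.add_apply, smul_add]
      abel
  refine ⟨fun ε hε => ?_, fun ε hε => ?_, h.target.add h'.target, ?_⟩
  · filter_upwards [h.integrable ε hε, h'.integrable ε hε] with Q h2 h3 hc
    rw [h0]; exact (h2 hc).add (h3 hc)
  · exact (memLp_congr_ae (h1 ε hε)).2 ((h.memLp ε hε).add (h'.memLp ε hε))
  · have h2 := h.tendsto.add h'.tendsto
    rw [add_zero] at h2
    refine tendsto_of_tendsto_of_tendsto_of_le_of_le' tendsto_const_nhds h2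
      (Eventually.of_forall fun _ => bot_le) ?_
    filter_upwards [self_mem_nhdsWithin] with ε hε
    have e : rightTrunc Ω α P ε (f + f') - (v + v') =ᵐ[volume.restrict Ω]
        (rightTrunc Ω α P ε f - v) + (rightTrunc Ω α P ε f' - v') := by
      filter_upwards [h1 ε hε] with Q hQ
      simp only [Pi.sub_apply, Pi.add_apply, hQ]; ring
    rw [eLpNorm_congr_ae e]
    exact eLpNorm_add_le ((h.memLp ε hε).sub h.target).1 ((h'.memLp ε hε).sub h'.target).1
      (by norm_num)

theorem IsRightDeriv.smul {Ω : Set (Space n)} {α : ℝ} {P : Space n}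
    {f v : Space n → ℂ} (h : IsRightDeriv Ω α P f v) (c : ℂ) :
    IsRightDeriv Ω α P (c • f) (c • v) := by
  have h0 : ∀ Q, rightIntegrand α P (c • f) Q = c • rightIntegrand α P f Q := fun Q => by
    ext t
    simp only [rightIntegrand, Pi.smul_apply, ← smul_sub, smul_comm c]
  have h1 : ∀ ε : ℝ, rightTrunc Ω α P ε (c • f) = c • rightTrunc Ω α P ε f := by
    intro ε
    ext Q
    by_cases hc : dist P Q ≤ rayLength Ω P Q - ε
    · simp only [rightTrunc, rightPsi, if_pos hc, h0, Pi.smul_apply,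
        intervalIntegral.integral_smul, smul_add, smul_comm c]
    · simp only [rightTrunc, rightPsi, if_neg hc, Pi.smul_apply, smul_add, smul_comm c]
  refine ⟨fun ε hε => ?_, fun ε hε => ?_, h.target.const_smul c, ?_⟩
  · filter_upwards [h.integrable ε hε] with Q h2 hc
    rw [h0]; exact (h2 hc).smul c
  · rw [h1]; exact (h.memLp ε hε).const_smul c
  · have h2 := ENNReal.Tendsto.const_mul (a := ‖c‖ₑ) h.tendsto (Or.inr enorm_ne_top)
    rw [mul_zero] at h2
    refine h2.congr fun ε => ?_
    rw [h1, ← smul_sub, eLpNorm_const_smul]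

theorem IsRightDeriv.eq_zero {Ω : Set (Space n)} {α : ℝ} {P : Space n}
    {f v : Space n → ℂ} (h : IsRightDeriv Ω α P f v) (hf : f =ᵐ[volume] 0) :
    v =ᵐ[volume.restrict Ω] 0 := by
  have h1 := (h.congr hf (ae_eq_refl v)).tendsto
  have h0 : ∀ Q, rightIntegrand α P (0 : Space n → ℂ) Q = 0 := fun Q => by
    ext t; simp [rightIntegrand]
  have h2 : ∀ ε, rightTrunc Ω α P ε (0 : Space n → ℂ) = 0 := fun ε => by
    ext Q; simp [rightTrunc, rightPsi, h0]
  simp only [h2, zero_sub, eLpNorm_neg] at h1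
  have h3 := tendsto_nhds_unique h1 tendsto_const_nhds
  exact (eLpNorm_eq_zero_iff h.target.1 (by norm_num)).1 h3.symm

/-! ### The operators -/

/-- The extension by zero of an element of `L₂(Ω)`. -/
def ext0 (Ω : Set (Space n)) (u : L2 Ω) : Space n → ℂ := Ω.indicator u

theorem ext0_congr {Ω : Set (Space n)} {u : L2 Ω} {f : Space n → ℂ}
    (h : u =ᵐ[volume.restrict Ω] f) : ext0 Ω u =ᵐ[volume] Ω.indicator f := by
  filter_upwards [ae_imp_of_ae_restrict h] with x hx
  by_cases hm : x ∈ Ω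
  · simp [ext0, hm, hx hm]
  · simp [ext0, hm]

theorem ext0_zero (Ω : Set (Space n)) : ext0 Ω 0 =ᵐ[volume] 0 := by
  have := ext0_congr (Lp.coeFn_zero ℂ 2 (volume.restrict Ω))
  simpa using this

theorem ext0_add {Ω : Set (Space n)} (u v : L2 Ω) :
    ext0 Ω (u + v) =ᵐ[volume] ext0 Ω u + ext0 Ω v := by
  have := ext0_congr (Lp.coeFn_add u v)
  rwa [Set.indicator_add'] at this

theorem ext0_smul {Ω : Set (Space n)} (c : ℂ) (u : L2 Ω) :
    ext0 Ω (c • u) =ᵐ[volume] c • ext0 Ω u := by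
  have := ext0_congr (Lp.coeFn_smul c u)
  rwa [show Ω.indicator (c • (u : Space n → ℂ)) = c • ext0 Ω u from
    Set.indicator_const_smul Ω c _] at this

theorem smul_ae {f g : Space n → ℂ} (ρ : Space n → ℝ) (h : f =ᵐ[volume] g) :
    (fun x => ρ x • f x) =ᵐ[volume] fun x => ρ x • g x := by
  filter_upwards [h] with x hx
  rw [hx]

/-- The graph of `u ↦ ρ 𝔇^α u`. -/
def kipGraph (Ω : Set (Space n)) (α : ℝ) (P : Space n) (ρ : Space n → ℝ) :
    Submodule ℂ (L2 Ω × L2 Ω) where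
  carrier := {p | IsKip Ω α P ρ (ext0 Ω p.1) p.2}
  zero_mem' := (IsKip.zero Ω α P ρ).congr (ext0_zero Ω).symm (Lp.coeFn_zero _ _ _).symm
  add_mem' := fun {p q} hp hq =>
    (IsKip.add hp hq).congr (ext0_add p.1 q.1).symm (Lp.coeFn_add _ _).symm
  smul_mem' := fun c p hp =>
    (IsKip.smul hp c).congr (ext0_smul c p.1).symm (Lp.coeFn_smul _ _).symm

/-- The graph of `u ↦ 𝔇^α_{d-} (ρ u)`. -/
def rightGraph (Ω : Set (Space n)) (α : ℝ) (P : Space n) (ρ : Space n → ℝ) :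
    Submodule ℂ (L2 Ω × L2 Ω) where
  carrier := {p | IsRightDeriv Ω α P (fun x => ρ x • ext0 Ω p.1 x) p.2}
  zero_mem' := by
    refine (IsRightDeriv.zero Ω α P).congr ?_ (Lp.coeFn_zero _ _ _).symm
    refine EventuallyEq.trans ?_ (smul_ae ρ (ext0_zero Ω).symm)
    exact Eventually.of_forall fun x => by simp
  add_mem' := fun {p q} hp hq => by
    refine (IsRightDeriv.add hp hq).congr ?_ (Lp.coeFn_add _ _).symm
    refine EventuallyEq.trans ?_ (smul_ae ρ (ext0_add p.1 q.1).symm)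
    exact Eventually.of_forall fun x => by simp
  smul_mem' := fun c p hp => by
    refine (IsRightDeriv.smul hp c).congr ?_ (Lp.coeFn_smul _ _).symm
    refine EventuallyEq.trans ?_ (smul_ae ρ (ext0_smul c p.1).symm)
    exact Eventually.of_forall fun x => by simp [mul_left_comm]

/-- The graph of `u ↦ - ∑ D_j (a^{ij} D_i u)`, all derivatives being weak derivatives
in `L₂(Ω)`. -/
def divGraph (Ω : Set (Space n)) (a : Fin n → Fin n → Space n → ℝ) :
    Submodule ℂ (L2 Ω × L2 Ω) where
  carrier := {p | ∃ (g : Fin n → L2 Ω) (h : Fin n → Fin n → L2 Ω),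
    (∀ i, IsWeakDeriv Ω i p.1 (g i)) ∧
    (∀ i j, IsWeakDeriv Ω j (fun x => a i j x • g i x) (h i j)) ∧
    p.2 = - ∑ i, ∑ j, h i j}
  zero_mem' := by
    refine ⟨0, 0, fun i => ?_, fun i j => ?_, by simp⟩
    · exact (isWeakDeriv_zero Ω i).congr (Lp.coeFn_zero _ _ _).symm (Lp.coeFn_zero _ _ _).symm
    · refine (isWeakDeriv_zero Ω j).congr ?_ (Lp.coeFn_zero _ _ _).symm
      filter_upwards [Lp.coeFn_zero ℂ 2 (volume.restrict Ω)] with x hx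
      change (0 : ℂ) = a i j x • ((0 : L2 Ω) : Space n → ℂ) x
      rw [hx, Pi.zero_apply, smul_zero]
  add_mem' := by
    rintro p q ⟨g, h, hg, hh, hp⟩ ⟨g', h', hg', hh', hq⟩
    refine ⟨g + g', h + h', fun i => ?_, fun i j => ?_, ?_⟩
    · exact ((hg i).add (hg' i)).congr (Lp.coeFn_add _ _).symm (Lp.coeFn_add _ _).symm
    · refine ((hh i j).add (hh' i j)).congr ?_ (Lp.coeFn_add _ _).symm
      filter_upwards [Lp.coeFn_add (g i) (g' i)] with x hx
      change a i j x • (g i : Space n → ℂ) x + a i j x • (g' i : Space n → ℂ) x =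
        a i j x • ((g i + g' i : L2 Ω) : Space n → ℂ) x
      rw [hx, Pi.add_apply, smul_add]
    · simp [hp, hq, Finset.sum_add_distrib, add_comm]
  smul_mem' := by
    rintro c p ⟨g, h, hg, hh, hp⟩
    refine ⟨c • g, c • h, fun i => ?_, fun i j => ?_, ?_⟩
    · exact ((hg i).smul c).congr (Lp.coeFn_smul _ _).symm (Lp.coeFn_smul _ _).symm
    · refine ((hh i j).smul c).congr ?_ (Lp.coeFn_smul _ _).symm
      filter_upwards [Lp.coeFn_smul c (g i)] with x hx
      simp [hx, mul_left_comm]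
    · simp [hp, Finset.smul_sum]

/-- The graph of the sum of the operators with graphs `A` and `B`, restricted to the
domain `H²(Ω) ∩ H¹₀(Ω)`. -/
def sumGraph (Ω : Set (Space n)) (A B : Submodule ℂ (L2 Ω × L2 Ω)) :
    Submodule ℂ (L2 Ω × L2 Ω) where
  carrier := {p | p.1 ∈ H2 Ω ⊓ H10 Ω ∧ ∃ v w : L2 Ω, (p.1, v) ∈ A ∧ (p.1, w) ∈ B ∧ p.2 = v + w}
  zero_mem' := ⟨zero_mem _, 0, 0, A.zero_mem, B.zero_mem, by simp⟩
  add_mem' := by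
    rintro p q ⟨hp, v, w, hv, hw, h⟩ ⟨hq, v', w', hv', hw', h'⟩
    exact ⟨add_mem hp hq, v + v', w + w', A.add_mem hv hv', B.add_mem hw hw', by
      rw [Prod.snd_add, h, h']; abel⟩
  smul_mem' := by
    rintro c p ⟨hp, v, w, hv, hw, h⟩
    exact ⟨Submodule.smul_mem _ c hp, c • v, c • w, A.smul_mem c hv, B.smul_mem c hw, by
      rw [Prod.smul_snd, h, smul_add]⟩

/-- `L u = - D_j (a^{ij} D_i u) + ρ 𝔇^α u`, as an unbounded operator in `L₂(Ω)`. -/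
def opL (Ω : Set (Space n)) (α : ℝ) (P : Space n) (a : Fin n → Fin n → Space n → ℝ)
    (ρ : Space n → ℝ) : L2 Ω →ₗ.[ℂ] L2 Ω :=
  (sumGraph Ω (divGraph Ω a) (kipGraph Ω α P ρ)).toLinearPMap

/-- `L⁺ u = - D_i (a^{ij} D_j u) + 𝔇^α_{d-} (ρ u)`, as an unbounded operator in `L₂(Ω)`. -/
def opLPlus (Ω : Set (Space n)) (α : ℝ) (P : Space n) (a : Fin n → Fin n → Space n → ℝ)
    (ρ : Space n → ℝ) : L2 Ω →ₗ.[ℂ] L2 Ω :=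
  (sumGraph Ω (divGraph Ω fun i j => a j i) (rightGraph Ω α P ρ)).toLinearPMap

theorem divGraph_eq_zero {Ω : Set (Space n)} (hΩ : IsOpen Ω)
    {a : Fin n → Fin n → Space n → ℝ} {v : L2 Ω} (h : ((0 : L2 Ω), v) ∈ divGraph Ω a) :
    v = 0 := by
  obtain ⟨g, h, hg, hh, hv⟩ := h
  have h1 : ∀ i j, h i j = 0 := by
    intro i j
    have e1 := (hg i).eq_zero hΩ (Lp.coeFn_zero _ _ _)
    have e2 := (hh i j).eq_zero hΩ (by filter_upwards [e1] with x hx; simp [hx])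
    exact (Lp.eq_zero_iff_ae_eq_zero).2 e2
  simpa [h1] using hv

theorem kipGraph_eq_zero {Ω : Set (Space n)} {α : ℝ} {P : Space n} {ρ : Space n → ℝ}
    {v : L2 Ω} (h : ((0 : L2 Ω), v) ∈ kipGraph Ω α P ρ) : v = 0 := by
  have h1 := (IsKip.congr h (ext0_zero Ω) (ae_eq_refl _)).eq
  refine (Lp.eq_zero_iff_ae_eq_zero).2 (h1.trans (Eventually.of_forall fun Q => ?_))
  simp [kip, kipIntegrand]

theorem rightGraph_eq_zero {Ω : Set (Space n)} {α : ℝ} {P : Space n} {ρ : Space n → ℝ}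
    {v : L2 Ω} (h : ((0 : L2 Ω), v) ∈ rightGraph Ω α P ρ) : v = 0 := by
  refine (Lp.eq_zero_iff_ae_eq_zero).2 (IsRightDeriv.eq_zero h ?_)
  refine (smul_ae ρ (ext0_zero Ω)).trans (Eventually.of_forall fun x => ?_)
  simp

/-- For open `Ω` the graph of `L` is the one that defines it. -/
theorem opL_graph {Ω : Set (Space n)} (hΩ : IsOpen Ω) (α : ℝ) (P : Space n)
    (a : Fin n → Fin n → Space n → ℝ) (ρ : Space n → ℝ) :
    (opL Ω α P a ρ).graph = sumGraph Ω (divGraph Ω a) (kipGraph Ω α P ρ) := by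
  refine Submodule.toLinearPMap_graph_eq _ ?_
  rintro ⟨u, w⟩ ⟨-, v, v', hv, hv', h⟩ rfl
  rw [h, divGraph_eq_zero hΩ hv, kipGraph_eq_zero hv', add_zero]

/-- For open `Ω` the graph of `L⁺` is the one that defines it. -/
theorem opLPlus_graph {Ω : Set (Space n)} (hΩ : IsOpen Ω) (α : ℝ) (P : Space n)
    (a : Fin n → Fin n → Space n → ℝ) (ρ : Space n → ℝ) :
    (opLPlus Ω α P a ρ).graph =
      sumGraph Ω (divGraph Ω fun i j => a j i) (rightGraph Ω α P ρ) := by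
  refine Submodule.toLinearPMap_graph_eq _ ?_
  rintro ⟨u, w⟩ ⟨-, v, v', hv, hv', h⟩ rfl
  rw [h, divGraph_eq_zero hΩ hv, rightGraph_eq_zero hv', add_zero]

/-! ### Hypotheses on the coefficients -/

/-- `ρ` is non-increasing along every ray from `P`, within `Ω`. -/
def RayAntitone (Ω : Set (Space n)) (P : Space n) (ρ : Space n → ℝ) : Prop :=
  ∀ Q ∈ Ω, ∀ s : ℝ, 0 < s → s ≤ 1 → ρ Q ≤ ρ (P + s • (Q - P))

/-- `ρ` satisfies the Hölder-Lipschitz condition with exponent `lam` and constant `M` on the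
closure of `Ω`. -/
def IsLip (Ω : Set (Space n)) (lam M : ℝ) (ρ : Space n → ℝ) : Prop :=
  ∀ Q ∈ closure Ω, ∀ Q' ∈ closure Ω, |ρ Q - ρ Q'| ≤ M * dist Q Q' ^ lam

/-- The constant `½ 𝔡^{-α} (1 / Γ(1-α) + C_n^{(α)})`, with `𝔡 = diam Ω`. -/
def muMain (Ω : Set (Space n)) (α : ℝ) : ℝ :=
  1 / 2 * Metric.diam Ω ^ (-α) * (1 / Real.Gamma (1 - α) + kipConst n α)

/-- `μ` is the constant of the lower bound for `Re (f, 𝔇^α f)` in `L₂(Ω, ρ)`: the first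
alternative is for general `ρ` (the formula makes sense if `inf ρ > 0`), the second one for `ρ`
non-increasing along the rays from `P`. -/
def IsMu (Ω : Set (Space n)) (α : ℝ) (P : Space n) (ρ : Space n → ℝ) (lam M μ : ℝ) : Prop :=
  (0 < sInf (ρ '' Ω) ∧ μ = muMain Ω α - α * M * Metric.diam Ω ^ (lam - α) /
      (2 * Real.Gamma (1 - α) * (lam - α) * sInf (ρ '' Ω))) ∨
  (RayAntitone Ω P ρ ∧ μ = muMain Ω α)

/-- The standing assumptions on the coefficients: `a^{ij} ∈ C¹(closure Ω)` is uniformly elliptic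
with constant `a₀`, `ρ > 0` satisfies a Hölder-Lipschitz condition with exponent
`lam ∈ (α, 1]`, and `μ > 0`. -/
structure Coefficients (Ω : Set (Space n)) (α : ℝ) (P : Space n)
    (a : Fin n → Fin n → Space n → ℝ) (ρ : Space n → ℝ) (a₀ lam M μ : ℝ) : Prop where
  smooth : ∀ i j, ContDiffOn ℝ 1 (a i j) (closure Ω)
  elliptic : ∀ Q ∈ Ω, ∀ ξ : Space n, a₀ * ‖ξ‖ ^ 2 ≤ ∑ i, ∑ j, a i j Q * ξ i * ξ j
  pos : ∀ Q ∈ Ω, 0 < ρ Q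
  lt : α < lam
  le : lam ≤ 1
  lip : IsLip Ω lam M ρ
  isMu : IsMu Ω α P ρ lam M μ
  mu_pos : 0 < μ

/-! ### Numerical range, accretivity, sectors -/

section Hilbert

variable {E : Type*} [NormedAddCommGroup E] [InnerProductSpace ℂ E]

/-- `T` is strictly accretive: `Re (T u, u) ≥ δ ‖u‖²` on the domain of `T`, for some `δ > 0`.
Mathlib's inner product is linear in its second argument. -/
def StrictlyAccretive (T : E →ₗ.[ℂ] E) : Prop :=
  ∃ δ : ℝ, 0 < δ ∧ ∀ u : T.domain, δ * ‖(u : E)‖ ^ 2 ≤ (⟪(u : E), T u⟫_ℂ).re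

/-- The numerical range `Θ(T)`: the values `(T u, u)` for unit vectors `u` of the domain. -/
def numericalRange (T : E →ₗ.[ℂ] E) : Set ℂ :=
  {ζ | ∃ u : T.domain, ‖(u : E)‖ = 1 ∧ ζ = ⟪(u : E), T u⟫_ℂ}

end Hilbert

/-- The sector with vertex `γ` and semi-angle `θ`. -/
def sector (γ θ : ℝ) : Set ℂ := {ζ | |(ζ - γ).arg| ≤ θ}

end Kipriyanov

end

/-!
Dilations `Q ↦ P + s (Q - P)` carry the whole argument. Substituting `t = s r` in `𝔇^α` and
`t = r / s` in `𝔇^α_{d-}` turns both ray integrals into integrals over `s ∈ (0, 1)` of increments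
of the function under a dilation (`kipDil`, `rightDil`), with the factor `r^{-α}` and weights that
depend on `s` only.

*Boundedness.* At the boundary point `P` the convex set `Ω` has a supporting half-space, which
gives Hardy's inequality `∫ r⁻² |u|² ≤ 4 ∫ |∇u|²` on `H¹₀(Ω)` (`IsTest.hardy`). The fundamental
theorem of calculus along rays bounds `r⁻¹ (u(Q) - u(T))` in `L₂` by the Dirichlet norm
(`IsTest.lintegral_sub_dil_sq_le`). With Minkowski's inequality in `s` these show that `𝔇^α` is
bounded from `H¹₀(Ω)` to `L₂(Ω)`, with a bound in terms of `n`, `α` and `diam Ω` only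
(`lintegral_kip_sq_le`); this is why the constant `C` depends neither on `P` nor on the Hölder
data of `ρ`. The same estimates, applied to `ρ u`, give a square integrable majorant for the
truncations of `𝔇^α_{d-} (ρ u)`, which hence converge (`isRightDeriv_rightD`).

*Duality.* The dilations by `s` and `1 / s` are adjoint to each other up to the Jacobian, so that
`𝔇^α_{d-}` is the adjoint of `𝔇^α`; the diagonal terms contribute a regularized Beta integral,
and its value is exactly what `C_n^{(α)}` compensates (`integral_weight_sub`,
`integral_mul_rightD_eq`). Therefore `L⁺` is a formal adjoint of `L` on a common dense domain:
both are closable, and their quadratic forms are complex conjugates of each other.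

*Positivity.* From `2 Re (conj (u(Q)) (u(Q) - u(T))) ≥ |u(Q)|² - |u(T)|²` the real part of the form
of `ρ 𝔇^α` is bounded below by half of `∫ ρ 𝔇^α |u|² = ∫ |u|² 𝔇^α_{d-} ρ` and a term with
`C_n^{(α)} r^{-α}`. On the part of the ray beyond `Ω` the extended weight vanishes, which gives
`ρ (d - r)^{-α} / Γ(1 - α)`; within `Ω` the increments of `ρ` cost at most the Hölder term of `μ`,
or nothing if `ρ` does not increase along the rays (`le_re_rightD_extWeight`). The result is the
lower bound `μ inf ρ ‖u‖²` (`HasGrad.le_re_inner_kip`).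

*The sector.* Let `E` be the Dirichlet energy of `u`, and `K` the square of the bound for `𝔇^α`.
Ellipticity and positivity give `Re (Lu, u) ≥ a₀ E + μ inf ρ ‖u‖²`, and boundedness gives
`|Im (Lu, u)| ≤ a₁ E + ρ₁ √K √E ‖u‖ ≤ (a₁ + η) E + ρ₁² K ‖u‖² / (4 η)`, where `ρ ≤ ρ₁`.
Eliminating `E` yields the sector with `C = a₀ ρ₁² K / (4 η²)`, and Poincaré's inequality, again a
case of Hardy's, yields strict accretivity (`opL_estimates`). Both are closed conditions on the
graph and pass to the closures (`closure_induction`).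
-/

noncomputable section

namespace Kipriyanov

variable {n : ℕ}

/-! ### Weights on the unit interval -/

theorem integrableOn_beta {p q : ℝ} (hp : 0 < p) (hq : 0 < q) :
    IntegrableOn (fun s : ℝ => s ^ (p - 1) * (1 - s) ^ (q - 1)) (Set.Ioo 0 1) := by
  have h := (Complex.betaIntegral_convergent (u := (p : ℂ)) (v := (q : ℂ))
    (by simpa using hp) (by simpa using hq)).norm
  rw [intervalIntegrable_iff_integrableOn_Ioo_of_le zero_le_one] at h
  refine h.congr_fun (fun s hs => ?_) measurableSet_Ioo
  have h0 : 0 < s := hs.1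
  have h1 : 0 < 1 - s := sub_pos.2 hs.2
  simp only [norm_mul]
  rw [Complex.norm_cpow_eq_rpow_re_of_pos h0,
    show (1 - (s : ℂ)) = ((1 - s : ℝ) : ℂ) by push_cast; ring,
    Complex.norm_cpow_eq_rpow_re_of_pos h1]
  simp

theorem integral_beta {p q : ℝ} (hp : 0 < p) (hq : 0 < q) :
    ∫ s in Set.Ioo (0 : ℝ) 1, s ^ (p - 1) * (1 - s) ^ (q - 1) =
      Real.Gamma p * Real.Gamma q / Real.Gamma (p + q) := by
  have h := ProbabilityTheory.beta_eq_betaIntegralReal p q hp hq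
  rw [ProbabilityTheory.beta] at h
  rw [h, Complex.betaIntegral, intervalIntegral.integral_of_le zero_le_one,
    integral_Ioc_eq_integral_Ioo]
  have h2 : ∫ s in Set.Ioo (0 : ℝ) 1, (s : ℂ) ^ ((p : ℂ) - 1) * (1 - (s : ℂ)) ^ ((q : ℂ) - 1) =
      ∫ s in Set.Ioo (0 : ℝ) 1, ((s ^ (p - 1) * (1 - s) ^ (q - 1) : ℝ) : ℂ) := by
    refine setIntegral_congr_fun measurableSet_Ioo fun s hs => ?_
    have h0 : 0 < s := hs.1
    have h1 : 0 < 1 - s := sub_pos.2 hs.2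
    push_cast
    rw [Complex.ofReal_cpow h0.le, Complex.ofReal_cpow h1.le]
    push_cast
    rfl
  rw [h2, integral_complex_ofReal, Complex.ofReal_re]

theorem one_sub_pow_le {s : ℝ} (h0 : 0 < s) (h1 : s < 1) (n : ℕ) : 1 - s ^ n ≤ n * (1 - s) := by
  have := one_add_mul_le_pow (a := s - 1) (by linarith) n
  rw [show (1 + (s - 1)) = s by ring] at this
  linarith

/-- Each of the two terms has a singularity at `s = 1` that is not integrable, but their difference
vanishes there to first order. -/
theorem integrableOn_weight_sub {n : ℕ} (hn : 1 ≤ n) {α : ℝ} (h0 : 0 < α) (h1 : α < 1) :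
    IntegrableOn (fun s : ℝ => (s ^ (α - 1) - s ^ (n - 1)) * (1 - s) ^ (-α - 1))
      (Set.Ioo 0 1) := by
  have hb := (integrableOn_beta h0 (sub_pos.2 h1)).const_mul (n : ℝ)
  refine Integrable.mono' hb ?_ ?_
  · exact (by fun_prop : Measurable fun s : ℝ =>
      (s ^ (α - 1) - s ^ (n - 1)) * (1 - s) ^ (-α - 1)).aestronglyMeasurable
  · refine (ae_restrict_iff' measurableSet_Ioo).2 (Eventually.of_forall fun s hs => ?_)
    have p0 : 0 < s := hs.1
    have p1 : 0 < 1 - s := sub_pos.2 hs.2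
    have e1 : (1 - s) ^ (1 - α - 1) = (1 - s) * (1 - s) ^ (-α - 1) := by
      rw [← Real.rpow_one_add' p1.le (by linarith)]; congr 1; ring
    have e2 : s ^ (n - 1) = s ^ (α - 1) * s ^ ((n : ℝ) - α) := by
      rw [← Real.rpow_natCast, ← Real.rpow_add p0, Nat.cast_sub hn]; congr 1; push_cast; ring
    have e3 : s ^ n ≤ s ^ ((n : ℝ) - α) := by
      rw [← Real.rpow_natCast]
      exact Real.rpow_le_rpow_of_exponent_ge p0 hs.2.le (by linarith)
    have hn' : (1 : ℝ) ≤ n := by exact_mod_cast hn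
    have e4 : s ^ ((n : ℝ) - α) ≤ 1 := Real.rpow_le_one p0.le hs.2.le (by linarith)
    have e5 := one_sub_pow_le p0 hs.2 n
    have q1 := Real.rpow_pos_of_pos p0 (α - 1)
    have q2 := Real.rpow_pos_of_pos p1 (-α - 1)
    rw [e2, ← mul_one_sub, Real.norm_eq_abs, abs_of_nonneg (by
      have := sub_nonneg.2 e4
      positivity), e1]
    calc s ^ (α - 1) * (1 - s ^ ((n : ℝ) - α)) * (1 - s) ^ (-α - 1)
        ≤ s ^ (α - 1) * (n * (1 - s)) * (1 - s) ^ (-α - 1) := by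
          gcongr; linarith
      _ = _ := by ring

/-- The regularized Beta integral `B(α, -α) - B(n, -α)`, which ties the constant `C_n^{(α)}` to
the kernels of the two fractional derivatives. -/
theorem integral_weight_sub {n : ℕ} (hn : 1 ≤ n) {α : ℝ} (h0 : 0 < α) (h1 : α < 1) :
    ∫ s in Set.Ioo (0 : ℝ) 1, (s ^ (α - 1) - s ^ (n - 1)) * (1 - s) ^ (-α - 1) =
      kipConst n α * Real.Gamma (1 - α) / α := by
  have hI := integrableOn_weight_sub hn h0 h1
  -- Integration by parts with the primitive `(1 - s) ^ (-α) / α` of `(1 - s) ^ (-α - 1)`. Since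
  -- `(s / (1 - s)) ^ α / α` is a primitive of the singular term `s ^ (α - 1) * (1 - s) ^ (-α - 1)`,
  -- only the power `s ^ (n - 1)` leaves a remainder, the convergent Beta integral of `k`.
  set F : ℝ → ℝ := fun s => 1 / α * ((s ^ α - s ^ (n - 1)) * (1 - s) ^ (-α)) with hF
  set f : ℝ → ℝ := fun s => (s ^ (α - 1) - s ^ (n - 1)) * (1 - s) ^ (-α - 1) with hf
  set k : ℝ → ℝ := fun s => ((n - 1 : ℕ) : ℝ) / α * (s ^ (n - 1 - 1) * (1 - s) ^ (-α)) with hk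
  have hkI : IntegrableOn k (Set.Ioo 0 1) := by
    have hb := (integrableOn_beta one_pos (sub_pos.2 h1)).const_mul (((n - 1 : ℕ) : ℝ) / α)
    refine Integrable.mono' hb ?_ ?_
    · exact (by fun_prop : Measurable k).aestronglyMeasurable
    · refine (ae_restrict_iff' measurableSet_Ioo).2 (Eventually.of_forall fun s hs => ?_)
      have p0 : 0 < s := hs.1
      have p1 : 0 < 1 - s := sub_pos.2 hs.2
      have : s ^ (n - 1 - 1) ≤ 1 := pow_le_one₀ p0.le hs.2.le
      have q2 := Real.rpow_pos_of_pos p1 (-α)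
      rw [Real.norm_eq_abs, abs_of_nonneg (by positivity)]
      simp only [hk, sub_self, Real.rpow_zero, show 1 - α - 1 = -α by ring]
      gcongr
  have hd : ∀ s ∈ Set.Ioo (0 : ℝ) 1, HasDerivAt F (f s - k s) s := by
    intro s hs
    have p0 : 0 < s := hs.1
    have p1 : 0 < 1 - s := sub_pos.2 hs.2
    have d1 : HasDerivAt (fun s : ℝ => s ^ α) (α * s ^ (α - 1)) s := by
      simpa using (hasDerivAt_id s).rpow_const (p := α) (Or.inl p0.ne')
    have d2 : HasDerivAt (fun s : ℝ => (1 - s) ^ (-α)) (-1 * -α * (1 - s) ^ (-α - 1)) s :=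
      ((hasDerivAt_id s).const_sub 1).rpow_const (Or.inl p1.ne')
    have d3 := ((d1.sub (hasDerivAt_pow (n - 1) s)).mul d2).const_mul (1 / α)
    refine d3.congr_deriv ?_
    have e1 : (1 - s) ^ (-α) = (1 - s) * (1 - s) ^ (-α - 1) := by
      rw [← Real.rpow_one_add' p1.le (by linarith)]; congr 1; ring
    have e2 : s ^ α = s * s ^ (α - 1) := by
      rw [← Real.rpow_one_add' p0.le (by linarith)]; congr 1; ring
    simp only [hf, hk, Pi.sub_apply, e1, e2]
    field_simp
    ring
  -- the boundary term at `0` contains `0 ^ (n - 1)`, which is `1` for `n = 1`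
  have t0 : Tendsto F (𝓝[>] 0) (𝓝 (1 / α * ((0 - 0 ^ (n - 1)) * 1))) := by
    have c1 : Tendsto (fun s : ℝ => s ^ α) (𝓝 0) (𝓝 0) := by
      have := (Real.continuousAt_rpow_const 0 α (Or.inr h0.le)).tendsto
      rwa [Real.zero_rpow h0.ne'] at this
    have c2 : Tendsto (fun s : ℝ => s ^ (n - 1)) (𝓝 0) (𝓝 (0 ^ (n - 1))) :=
      (continuous_pow (n - 1)).tendsto 0
    have c3 : Tendsto (fun s : ℝ => (1 - s) ^ (-α)) (𝓝 0) (𝓝 1) := by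
      have : ContinuousAt (fun s : ℝ => (1 - s) ^ (-α)) 0 :=
        ContinuousAt.rpow_const (by fun_prop) (Or.inl (by norm_num))
      simpa using this.tendsto
    exact (((c1.sub c2).mul c3).const_mul (1 / α)).mono_left nhdsWithin_le_nhds
  have t1 : Tendsto F (𝓝[<] 1) (𝓝 0) := by
    have c1 : Tendsto (fun s : ℝ => 1 / α * (n * (1 - s) ^ (1 - α))) (𝓝[<] 1) (𝓝 0) := by
      have : ContinuousAt (fun s : ℝ => 1 / α * (n * (1 - s) ^ (1 - α))) 1 := by
        refine continuousAt_const.mul (continuousAt_const.mul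
          (ContinuousAt.rpow_const (by fun_prop) (Or.inr (by linarith))))
      have h := this.tendsto
      simp only [sub_self, Real.zero_rpow (sub_pos.2 h1).ne', mul_zero] at h
      exact h.mono_left nhdsWithin_le_nhds
    refine squeeze_zero_norm' ?_ c1
    filter_upwards [Ioo_mem_nhdsLT (zero_lt_one (α := ℝ))] with s hs
    have p0 : 0 < s := hs.1
    have p1 : 0 < 1 - s := sub_pos.2 hs.2
    have e1 : (1 - s) ^ (1 - α) = (1 - s) * (1 - s) ^ (-α) := by
      rw [← Real.rpow_one_add' p1.le (by linarith)]; congr 1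
    have hn' : (1 : ℝ) ≤ n := by exact_mod_cast hn
    have e3 : s ^ n ≤ s ^ α := by
      rw [← Real.rpow_natCast]
      exact Real.rpow_le_rpow_of_exponent_ge p0 hs.2.le (by linarith)
    have e3' : s ^ n ≤ s ^ (n - 1) := pow_le_pow_of_le_one p0.le hs.2.le (by omega)
    have e4 : s ^ α ≤ 1 := Real.rpow_le_one p0.le hs.2.le h0.le
    have e4' : s ^ (n - 1) ≤ 1 := pow_le_one₀ p0.le hs.2.le
    have e5 := one_sub_pow_le p0 hs.2 n
    have q2 := Real.rpow_pos_of_pos p1 (-α)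
    have e6 : |s ^ α - s ^ (n - 1)| ≤ n * (1 - s) := abs_le.2 ⟨by linarith, by linarith⟩
    simp only [hF, norm_mul, Real.norm_eq_abs, abs_of_pos q2, abs_of_pos (one_div_pos.2 h0)]
    rw [e1, ← mul_assoc (n : ℝ)]
    gcongr
  have hint : IntervalIntegrable (fun s => f s - k s) volume 0 1 := by
    rw [intervalIntegrable_iff_integrableOn_Ioo_of_le zero_le_one]
    exact hI.sub hkI
  have h2 := intervalIntegral.integral_eq_sub_of_hasDerivAt_of_tendsto zero_lt_one hd hint t0 t1
  rw [intervalIntegral.integral_of_le zero_le_one, integral_Ioc_eq_integral_Ioo,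
    integral_sub hI hkI] at h2
  have h3 : ∫ s in Set.Ioo (0 : ℝ) 1, f s =
      (∫ s in Set.Ioo (0 : ℝ) 1, k s) + 1 / α * 0 ^ (n - 1) := by
    linarith
  rw [h3, kipConst]
  have hG := (Real.Gamma_pos_of_pos (sub_pos.2 h1)).ne'
  obtain ⟨m, rfl⟩ : ∃ m, n = m + 1 := ⟨n - 1, by omega⟩
  rcases Nat.eq_zero_or_pos m with rfl | hm
  · simp only [hk]
    simp
    field_simp
  · obtain ⟨l, rfl⟩ : ∃ l, m = l + 1 := ⟨m - 1, by omega⟩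
    have e1 : ∫ s in Set.Ioo (0 : ℝ) 1, k s = ((l + 1 : ℕ) : ℝ) / α *
        ∫ s in Set.Ioo (0 : ℝ) 1, s ^ (((l + 1 : ℕ) : ℝ) - 1) * (1 - s) ^ ((1 - α) - 1) := by
      rw [← integral_const_mul]
      refine integral_congr_ae (Eventually.of_forall fun s => ?_)
      simp only [hk]
      rw [show (((l + 1 : ℕ) : ℝ) - 1) = (l : ℝ) by push_cast; ring, Real.rpow_natCast,
        show (1 - α - 1) = -α by ring]
      simp
    rw [e1, integral_beta (by positivity) (sub_pos.2 h1)]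
    have e2 : Real.Gamma ((l + 1 : ℕ) : ℝ) = (Nat.factorial l : ℝ) := by
      push_cast; exact Real.Gamma_nat_eq_factorial l
    rw [e2]
    simp only [Nat.add_sub_cancel, Nat.factorial_succ]
    push_cast
    rw [show (l : ℝ) + 1 + (1 - α) = l + 1 + 1 - α by ring]
    simp
    field_simp

/-! ### Inequalities for double integrals -/

/-- The Cauchy–Schwarz inequality. -/
theorem lintegral_mul_sq_le {β : Type*} [MeasurableSpace β] {μ : Measure β} {f g : β → ℝ≥0∞}
    (hf : AEMeasurable f μ) (hg : AEMeasurable g μ) :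
    (∫⁻ x, f x * g x ∂μ) ^ 2 ≤ (∫⁻ x, f x ^ 2 ∂μ) * ∫⁻ x, g x ^ 2 ∂μ := by
  have h := ENNReal.lintegral_mul_le_Lp_mul_Lq μ Real.HolderConjugate.two_two hf hg
  calc (∫⁻ x, f x * g x ∂μ) ^ 2
      ≤ ((∫⁻ x, f x ^ (2 : ℝ) ∂μ) ^ (1 / 2 : ℝ) * (∫⁻ x, g x ^ (2 : ℝ) ∂μ) ^ (1 / 2 : ℝ)) ^ 2 := by
        gcongr; exact h
    _ = _ := by
        rw [mul_pow, ← ENNReal.rpow_natCast, ← ENNReal.rpow_mul, ← ENNReal.rpow_natCast,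
          ← ENNReal.rpow_mul]
        norm_num

/-- Minkowski's integral inequality in `L₂`, in the form in which it is used: bounds for the
norms of the sections add up. -/
theorem lintegral_sq_lintegral_le {β γ : Type*} [MeasurableSpace β] [MeasurableSpace γ]
    {μ : Measure β} {ν : Measure γ} [SFinite μ] [SFinite ν] {F : β → γ → ℝ≥0∞}
    (hF : Measurable (Function.uncurry F)) {c : β → ℝ≥0∞} (hc : Measurable c)
    (hc0 : ∀ᵐ s ∂μ, c s ≠ 0) (hct : ∀ᵐ s ∂μ, c s ≠ ⊤) {B : ℝ≥0∞}
    (h : ∀ᵐ s ∂μ, ∫⁻ x, F s x ^ 2 ∂ν ≤ c s ^ 2 * B) :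
    ∫⁻ x, (∫⁻ s, F s x ∂μ) ^ 2 ∂ν ≤ (∫⁻ s, c s ∂μ) ^ 2 * B := by
  have m1 : Measurable fun p : γ × β => F p.2 p.1 := hF.comp measurable_swap
  -- Cauchy–Schwarz for `F = (F c^{-1/2}) c^{1/2}`
  have key : ∀ x, (∫⁻ s, F s x ∂μ) ^ 2 ≤ (∫⁻ s, F s x ^ 2 * (c s)⁻¹ ∂μ) * ∫⁻ s, c s ∂μ := by
    intro x
    have mx : Measurable fun s => F s x := m1.comp measurable_prodMk_left
    have e : ∫⁻ s, F s x ∂μ = ∫⁻ s, (F s x * (c s)⁻¹ ^ (1 / 2 : ℝ)) * c s ^ (1 / 2 : ℝ) ∂μ := by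
      refine lintegral_congr_ae ?_
      filter_upwards [hc0, hct] with s h0 ht
      rw [mul_assoc, ← ENNReal.mul_rpow_of_nonneg _ _ (by norm_num : (0 : ℝ) ≤ 1 / 2),
        ENNReal.inv_mul_cancel h0 ht, ENNReal.one_rpow, mul_one]
    have r : ∀ a : ℝ≥0∞, (a ^ (1 / 2 : ℝ)) ^ 2 = a := fun a => by
      rw [← ENNReal.rpow_natCast, ← ENNReal.rpow_mul]; norm_num
    rw [e]
    refine (lintegral_mul_sq_le (by fun_prop) (by fun_prop)).trans (le_of_eq ?_)
    simp only [mul_pow, r]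
  calc ∫⁻ x, (∫⁻ s, F s x ∂μ) ^ 2 ∂ν
      ≤ ∫⁻ x, (∫⁻ s, F s x ^ 2 * (c s)⁻¹ ∂μ) * ∫⁻ s, c s ∂μ ∂ν := lintegral_mono key
    _ = (∫⁻ s, ∫⁻ x, F s x ^ 2 * (c s)⁻¹ ∂ν ∂μ) * ∫⁻ s, c s ∂μ := by
        rw [lintegral_mul_const _ (by
          refine Measurable.lintegral_prod_right'
            (f := fun p : γ × β => F p.2 p.1 ^ 2 * (c p.2)⁻¹) ?_
          fun_prop), lintegral_lintegral_swap (by fun_prop)]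
    _ ≤ (∫⁻ s, c s * B ∂μ) * ∫⁻ s, c s ∂μ := by
        gcongr ?_ * _
        refine lintegral_mono_ae ?_
        filter_upwards [h, hc0, hct] with s hs h0 ht
        have ms : Measurable fun x => F s x := hF.comp measurable_prodMk_left
        rw [lintegral_mul_const _ (by fun_prop)]
        calc (∫⁻ x, F s x ^ 2 ∂ν) * (c s)⁻¹ ≤ c s ^ 2 * B * (c s)⁻¹ := by gcongr
          _ = c s * B * (c s * (c s)⁻¹) := by ring
          _ = c s * B := by rw [ENNReal.mul_inv_cancel h0 ht, mul_one]
    _ = _ := by rw [lintegral_mul_const _ hc]; ring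

/-! ### Dilations about a point -/

/-- The dilation with centre `P` and factor `s`. -/
def dil (P : Space n) (s : ℝ) (Q : Space n) : Space n := P + s • (Q - P)

@[fun_prop]
theorem continuous_dil (P : Space n) : Continuous fun p : ℝ × Space n => dil P p.1 p.2 := by
  unfold dil; fun_prop

@[fun_prop]
theorem Measurable.dil {β : Type*} [MeasurableSpace β] (P : Space n) {s : β → ℝ}
    {Q : β → Space n} (hs : Measurable s) (hQ : Measurable Q) :
    Measurable fun x => dil P (s x) (Q x) :=
  (continuous_dil P).measurable.comp (hs.prodMk hQ)

theorem dil_one (P Q : Space n) : dil P 1 Q = Q := by simp [dil]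

theorem dil_dil (P Q : Space n) (s t : ℝ) : dil P s (dil P t Q) = dil P (s * t) Q := by
  simp [dil, mul_smul]

theorem dil_inv_dil (P Q : Space n) {s : ℝ} (hs : s ≠ 0) : dil P s⁻¹ (dil P s Q) = Q := by
  rw [dil_dil, inv_mul_cancel₀ hs, dil_one]

theorem dist_dil (P Q : Space n) {s : ℝ} (hs : 0 ≤ s) : dist P (dil P s Q) = s * dist P Q := by
  rw [dist_comm P, dist_comm P, dist_eq_norm, dist_eq_norm]
  simp [dil, norm_smul, abs_of_nonneg hs]

theorem dist_dil_self (P Q : Space n) (s : ℝ) : dist Q (dil P s Q) = |1 - s| * dist P Q := by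
  rw [dist_comm P, dist_eq_norm, dist_eq_norm, dil,
    show Q - (P + s • (Q - P)) = (1 - s) • (Q - P) by module, norm_smul, Real.norm_eq_abs]

/-- An open convex set is mapped into itself by the contractions towards a point of its closure. -/
theorem dil_mem {Ω : Set (Space n)} (hopen : IsOpen Ω) (hconv : Convex ℝ Ω) {P Q : Space n}
    (hP : P ∈ closure Ω) (hQ : Q ∈ Ω) {s : ℝ} (h0 : 0 < s) (h1 : s ≤ 1) : dil P s Q ∈ Ω := by
  have := hconv.combo_closure_interior_mem_interior (a := 1 - s) (b := s) hP
    (by rwa [hopen.interior_eq]) (by linarith) h0 (by ring)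
  rw [hopen.interior_eq] at this
  convert this using 1
  simp only [dil]; module

theorem map_dil (P : Space n) {s : ℝ} (hs : 0 < s) :
    Measure.map (dil P s) volume = ENNReal.ofReal (s ^ n)⁻¹ • (volume : Measure (Space n)) := by
  have e : dil P s = (fun x => P + x) ∘ (fun x => s • x) ∘ fun x => x - P := rfl
  rw [e, ← Measure.map_map (by fun_prop) (by fun_prop),
    ← Measure.map_map (by fun_prop) (by fun_prop),
    (measurePreserving_sub_right volume P).map_eq, Measure.map_addHaar_smul _ hs.ne',
    Measure.map_smul, (measurePreserving_add_left volume P).map_eq]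
  rw [finrank_euclideanSpace, Fintype.card_fin, abs_of_pos (by positivity)]

theorem measurableEmbedding_dil (P : Space n) {s : ℝ} (hs : s ≠ 0) :
    MeasurableEmbedding (dil P s) := by
  have e : dil P s = (Homeomorph.addLeft P) ∘ (Homeomorph.smulOfNeZero s hs) ∘
      Homeomorph.subRight P := rfl
  rw [e]
  exact (Homeomorph.measurableEmbedding _).comp
    ((Homeomorph.measurableEmbedding _).comp (Homeomorph.measurableEmbedding _))

theorem lintegral_comp_dil (P : Space n) {s : ℝ} (hs : 0 < s) (f : Space n → ℝ≥0∞) :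
    ∫⁻ Q, f (dil P s Q) = ENNReal.ofReal (s ^ n)⁻¹ * ∫⁻ Q, f Q := by
  rw [← (measurableEmbedding_dil P hs.ne').lintegral_map, map_dil P hs, lintegral_smul_measure,
    smul_eq_mul]

theorem integral_comp_dil (P : Space n) {s : ℝ} (hs : 0 < s) (f : Space n → ℂ) :
    ∫ Q, f (dil P s Q) = (s ^ n)⁻¹ • ∫ Q, f Q := by
  rw [← (measurableEmbedding_dil P hs.ne').integral_map, map_dil P hs, integral_smul_measure,
    ENNReal.toReal_ofReal (by positivity)]

theorem quasiMeasurePreserving_dil (P : Space n) {s : ℝ} (hs : 0 < s) :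
    Measure.QuasiMeasurePreserving (dil P s) := by
  refine ⟨by fun_prop, ?_⟩
  rw [map_dil P hs]
  exact Measure.smul_absolutelyContinuous

/-! ### Reduction of the ray integrals to dilations -/

/-- The integrand of `𝔇^α` after the substitution `t = s r`. -/
def kipDil (α : ℝ) (P : Space n) (f : Space n → ℂ) (s : ℝ) (Q : Space n) : ℂ :=
  (dist P Q ^ (-α) * (s ^ (n - 1) * (1 - s) ^ (-α - 1))) • (f Q - f (dil P s Q))

/-- The integrand of `𝔇^α_{d-}` after the substitution `t = r / s`. The range `(0, 1)` of `s`
corresponds to the whole of `(r, ∞)`; for functions that vanish off `Ω` the part beyond `d`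
accounts for the term with `(d - r)^{-α}`. -/
def rightDil (α : ℝ) (P : Space n) (f : Space n → ℂ) (s : ℝ) (Q : Space n) : ℂ :=
  (dist P Q ^ (-α) * (s ^ (α - 1) * (1 - s) ^ (-α - 1))) • (f Q - f (dil P s⁻¹ Q))

theorem image_mul_Ioo {r : ℝ} (hr : 0 < r) : (fun s => r * s) '' Set.Ioo 0 1 = Set.Ioo 0 r := by
  rw [Set.image_mul_left_Ioo hr]; simp

theorem image_div_Ioo {r : ℝ} (hr : 0 < r) : (fun s => r / s) '' Set.Ioo 0 1 = Set.Ioi r := by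
  ext t
  simp only [Set.mem_image, Set.mem_Ioo, Set.mem_Ioi]
  constructor
  · rintro ⟨s, ⟨h0, h1⟩, rfl⟩
    rw [lt_div_iff₀ h0]; nlinarith
  · intro ht
    have h0 : 0 < t := hr.trans ht
    exact ⟨r / t, ⟨by positivity, by rwa [div_lt_one h0]⟩, by field_simp⟩

theorem hasDerivWithinAt_mul_Ioo (r : ℝ) (s : ℝ) :
    HasDerivWithinAt (fun s => r * s) r (Set.Ioo 0 1) s := by
  simpa using ((hasDerivAt_id s).const_mul r).hasDerivWithinAt

theorem hasDerivWithinAt_div_Ioo (r : ℝ) {s : ℝ} (hs : s ∈ Set.Ioo (0 : ℝ) 1) :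
    HasDerivWithinAt (fun s => r / s) (-r / s ^ 2) (Set.Ioo 0 1) s := by
  have h := ((hasDerivAt_inv hs.1.ne').const_mul r).hasDerivWithinAt (s := Set.Ioo 0 1)
  simp only [← div_eq_mul_inv] at h
  exact h.congr_deriv (by ring)

theorem injOn_mul_Ioo {r : ℝ} (hr : 0 < r) : Set.InjOn (fun s => r * s) (Set.Ioo (0 : ℝ) 1) :=
  (mul_right_injective₀ hr.ne').injOn

theorem injOn_div_Ioo {r : ℝ} (hr : 0 < r) : Set.InjOn (fun s => r / s) (Set.Ioo (0 : ℝ) 1) := by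
  intro s hs t ht h
  simp only [div_eq_mul_inv] at h
  exact inv_injective (mul_right_injective₀ hr.ne' h)

theorem rpow_neg_eq_mul_inv {r : ℝ} (hr : 0 < r) (α : ℝ) :
    r ^ (-α) = r * (r ^ (α + 1))⁻¹ := by
  rw [Real.rpow_add hr, Real.rpow_neg hr.le, Real.rpow_one]
  field_simp

theorem abs_smul_kipIntegrand {α : ℝ} {P Q : Space n} (hr : 0 < dist P Q) (f : Space n → ℂ)
    {s : ℝ} (hs : s ∈ Set.Ioo (0 : ℝ) 1) :
    |dist P Q| • kipIntegrand α P f Q (dist P Q * s) = kipDil α P f s Q := by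
  set r := dist P Q
  have p1 : 0 < 1 - s := sub_pos.2 hs.2
  rw [kipIntegrand, kipDil, smul_smul, ray, dil, mul_div_cancel_left₀ _ hr.ne', abs_of_pos hr]
  congr 1
  rw [show r - r * s = r * (1 - s) by ring, Real.mul_rpow hr.le p1.le,
    show -α - 1 = -(α + 1) by ring, Real.rpow_neg p1.le, rpow_neg_eq_mul_inv hr]
  field_simp

theorem abs_smul_rightIntegrand {α : ℝ} {P Q : Space n} (hr : 0 < dist P Q) (f : Space n → ℂ)
    {s : ℝ} (hs : s ∈ Set.Ioo (0 : ℝ) 1) :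
    |-dist P Q / s ^ 2| • rightIntegrand α P f Q (dist P Q / s) = rightDil α P f s Q := by
  set r := dist P Q
  have p0 : 0 < s := hs.1
  have p1 : 0 < 1 - s := sub_pos.2 hs.2
  rw [rightIntegrand, rightDil, smul_smul, ray, dil, neg_div, abs_neg, abs_of_pos (by positivity),
    show r / s / dist P Q = s⁻¹ by change r / s / r = s⁻¹; field_simp]
  congr 1
  change r / s ^ 2 * (1 / (r / s - r) ^ (α + 1)) = r ^ (-α) * (s ^ (α - 1) * (1 - s) ^ (-α - 1))
  rw [show r / s - r = r * ((1 - s) * s⁻¹) by field_simp, Real.mul_rpow hr.le (by positivity),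
    Real.mul_rpow p1.le (by positivity), Real.inv_rpow p0.le,
    show -α - 1 = -(α + 1) by ring, Real.rpow_neg p1.le, rpow_neg_eq_mul_inv hr,
    show α - 1 = (α + 1) - 2 by ring, Real.rpow_sub p0]
  norm_num
  field_simp

theorem intervalIntegrable_kipIntegrand {α : ℝ} {P Q : Space n} (hr : 0 < dist P Q)
    {f : Space n → ℂ} :
    IntervalIntegrable (kipIntegrand α P f Q) volume 0 (dist P Q) ↔
      IntegrableOn (fun s => kipDil α P f s Q) (Set.Ioo 0 1) := by
  rw [intervalIntegrable_iff_integrableOn_Ioo_of_le hr.le, ← image_mul_Ioo hr,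
    integrableOn_image_iff_integrableOn_abs_deriv_smul measurableSet_Ioo
      (fun s _ => hasDerivWithinAt_mul_Ioo _ s) (injOn_mul_Ioo hr)]
  exact integrableOn_congr_fun (fun s hs => abs_smul_kipIntegrand hr f hs) measurableSet_Ioo

theorem integral_kipIntegrand {α : ℝ} {P Q : Space n} (hr : 0 < dist P Q) (f : Space n → ℂ) :
    ∫ t in (0)..(dist P Q), kipIntegrand α P f Q t =
      ∫ s in Set.Ioo (0 : ℝ) 1, kipDil α P f s Q := by
  rw [intervalIntegral.integral_of_le hr.le, integral_Ioc_eq_integral_Ioo, ← image_mul_Ioo hr,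
    integral_image_eq_integral_abs_deriv_smul measurableSet_Ioo
      (fun s _ => hasDerivWithinAt_mul_Ioo _ s) (injOn_mul_Ioo hr)]
  exact setIntegral_congr_fun measurableSet_Ioo (fun s hs => abs_smul_kipIntegrand hr f hs)

theorem integrableOn_rightIntegrand {α : ℝ} {P Q : Space n} (hr : 0 < dist P Q)
    {f : Space n → ℂ} :
    IntegrableOn (rightIntegrand α P f Q) (Set.Ioi (dist P Q)) ↔
      IntegrableOn (fun s => rightDil α P f s Q) (Set.Ioo 0 1) := by
  rw [← image_div_Ioo hr, integrableOn_image_iff_integrableOn_abs_deriv_smul measurableSet_Ioo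
      (fun s hs => hasDerivWithinAt_div_Ioo _ hs) (injOn_div_Ioo hr)]
  exact integrableOn_congr_fun (fun s hs => abs_smul_rightIntegrand hr f hs) measurableSet_Ioo

theorem integral_rightIntegrand {α : ℝ} {P Q : Space n} (hr : 0 < dist P Q) (f : Space n → ℂ) :
    ∫ t in Set.Ioi (dist P Q), rightIntegrand α P f Q t =
      ∫ s in Set.Ioo (0 : ℝ) 1, rightDil α P f s Q := by
  rw [← image_div_Ioo hr, integral_image_eq_integral_abs_deriv_smul measurableSet_Ioo
      (fun s hs => hasDerivWithinAt_div_Ioo _ hs) (injOn_div_Ioo hr)]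
  exact setIntegral_congr_fun measurableSet_Ioo (fun s hs => abs_smul_rightIntegrand hr f hs)

theorem lintegral_rightIntegrand {α : ℝ} {P Q : Space n} (hr : 0 < dist P Q) (f : Space n → ℂ) :
    ∫⁻ t in Set.Ioi (dist P Q), ‖rightIntegrand α P f Q t‖ₑ =
      ∫⁻ s in Set.Ioo (0 : ℝ) 1, ‖rightDil α P f s Q‖ₑ := by
  rw [← image_div_Ioo hr, lintegral_image_eq_lintegral_abs_deriv_mul measurableSet_Ioo
      (fun s hs => hasDerivWithinAt_div_Ioo _ hs) (injOn_div_Ioo hr)]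
  refine setLIntegral_congr_fun measurableSet_Ioo (fun s hs => ?_)
  rw [← abs_smul_rightIntegrand hr f hs, enorm_smul, Real.enorm_eq_ofReal (abs_nonneg _)]

theorem measurable_kipDil {α : ℝ} {P : Space n} {f : Space n → ℂ} (hf : Measurable f) :
    Measurable (Function.uncurry (kipDil α P f)) := by
  unfold Function.uncurry kipDil; fun_prop

theorem measurable_rightDil {α : ℝ} {P : Space n} {f : Space n → ℂ} (hf : Measurable f) :
    Measurable (Function.uncurry (rightDil α P f)) := by
  unfold Function.uncurry rightDil; fun_prop

/-! ### Hardy's inequality and increments along rays -/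

theorem eLpNorm_two_sq {β F : Type*} [MeasurableSpace β] [NormedAddCommGroup F] (f : β → F)
    (μ : Measure β) : eLpNorm f 2 μ ^ 2 = ∫⁻ x, ‖f x‖ₑ ^ 2 ∂μ := by
  have := eLpNorm_nnreal_pow_eq_lintegral (f := f) (μ := μ) (p := 2) (by norm_num)
  simpa using this

theorem memLp_two_of_lintegral_sq {β F : Type*} [MeasurableSpace β] [NormedAddCommGroup F]
    {f : β → F} {μ : Measure β} (hf : AEStronglyMeasurable f μ) (h : ∫⁻ x, ‖f x‖ₑ ^ 2 ∂μ < ⊤) :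
    MemLp f 2 μ := by
  refine ⟨hf, ?_⟩
  rw [← eLpNorm_two_sq] at h
  by_contra hne
  rw [not_lt, top_le_iff] at hne
  simp [hne] at h

theorem MemLp.lintegral_sq_lt_top {β F : Type*} [MeasurableSpace β] [NormedAddCommGroup F]
    {f : β → F} {μ : Measure β} (hf : MemLp f 2 μ) : ∫⁻ x, ‖f x‖ₑ ^ 2 ∂μ < ⊤ := by
  rw [← eLpNorm_two_sq]
  exact ENNReal.pow_lt_top hf.2

/-- The squared length `∑ |D_i φ|²` of the gradient. -/
def gradSq (φ : Space n → ℂ) (Q : Space n) : ℝ := ∑ i, ‖pderiv i φ Q‖ ^ 2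

/-- The Dirichlet energy `∫ ∑ |D_i φ|²`. -/
def energy (φ : Space n → ℂ) : ℝ≥0∞ := ∫⁻ Q, ENNReal.ofReal (gradSq φ Q)

theorem gradSq_nonneg (φ : Space n → ℂ) (Q : Space n) : 0 ≤ gradSq φ Q :=
  Finset.sum_nonneg fun _ _ => by positivity

theorem fderiv_eq_sum (φ : Space n → ℂ) (Q v : Space n) :
    fderiv ℝ φ Q v = ∑ i, v i • pderiv i φ Q := by
  conv_lhs => rw [← (EuclideanSpace.basisFun (Fin n) ℝ).sum_repr v]
  simp [pderiv]

theorem norm_fderiv_sq_le (φ : Space n → ℂ) (Q v : Space n) :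
    ‖fderiv ℝ φ Q v‖ ^ 2 ≤ ‖v‖ ^ 2 * gradSq φ Q := by
  have h : ‖fderiv ℝ φ Q v‖ ≤ ∑ i, |v i| * ‖pderiv i φ Q‖ := by
    rw [fderiv_eq_sum]
    refine (norm_sum_le _ _).trans (le_of_eq ?_)
    simp
  calc ‖fderiv ℝ φ Q v‖ ^ 2 ≤ (∑ i, |v i| * ‖pderiv i φ Q‖) ^ 2 := by gcongr
    _ ≤ (∑ i, |v i| ^ 2) * ∑ i, ‖pderiv i φ Q‖ ^ 2 := Finset.sum_mul_sq_le_sq_mul_sq _ _ _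
    _ = _ := by rw [EuclideanSpace.norm_sq_eq, gradSq]; simp

theorem IsTest.continuous_fderiv {Ω : Set (Space n)} {φ : Space n → ℂ} (h : IsTest Ω φ) :
    Continuous (fderiv ℝ φ) := h.smooth.continuous_fderiv (by simp)

theorem IsTest.continuous_pderiv {Ω : Set (Space n)} {φ : Space n → ℂ} (h : IsTest Ω φ)
    (i : Fin n) : Continuous (pderiv i φ) := h.continuous_fderiv.clm_apply continuous_const

theorem tsupport_pderiv_subset {F : Type*} [NormedAddCommGroup F] [NormedSpace ℝ F]
    (φ : Space n → F) (i : Fin n) : tsupport (pderiv i φ) ⊆ tsupport φ := by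
  refine closure_minimal ?_ (isClosed_tsupport φ)
  intro x hx
  apply support_fderiv_subset ℝ
  intro h0
  exact hx (by simp [pderiv, h0])

theorem IsTest.hasCompactSupport_pderiv {F : Type*} [NormedAddCommGroup F] [NormedSpace ℝ F]
    {Ω : Set (Space n)} {φ : Space n → F} (h : IsTest Ω φ)
    (i : Fin n) : HasCompactSupport (pderiv i φ) :=
  h.compact.of_isClosed_subset (isClosed_tsupport _) (tsupport_pderiv_subset φ i)

theorem IsTest.continuous_gradSq {Ω : Set (Space n)} {φ : Space n → ℂ} (h : IsTest Ω φ) :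
    Continuous (gradSq φ) := by
  unfold gradSq
  exact continuous_finsetSum _ fun i _ => (h.continuous_pderiv i).norm.pow 2

theorem IsTest.integrable_gradSq {Ω : Set (Space n)} {φ : Space n → ℂ} (h : IsTest Ω φ) :
    Integrable (gradSq φ) := by
  unfold gradSq
  refine integrable_finsetSum _ fun i _ => ?_
  refine Continuous.integrable_of_hasCompactSupport ((h.continuous_pderiv i).norm.pow 2) ?_
  exact (h.hasCompactSupport_pderiv i).comp_left (g := fun z => ‖z‖ ^ 2) (by simp)

theorem IsTest.eq_zero {F : Type*} [NormedAddCommGroup F] [NormedSpace ℝ F] {Ω : Set (Space n)}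
    {φ : Space n → F} (h : IsTest Ω φ) {Q : Space n} (hQ : Q ∉ Ω) : φ Q = 0 :=
  image_eq_zero_of_notMem_tsupport fun h' => hQ (h.subset h')

theorem integral_fderiv_eq_zero {q : Space n → ℝ} (hq : ContDiff ℝ 1 q)
    (hc : HasCompactSupport q) (v : Space n) : ∫ x, fderiv ℝ q x v = 0 := by
  have hc' : HasCompactSupport fun x => fderiv ℝ q x v :=
    (hc.fderiv ℝ).comp_left (g := fun L : Space n →L[ℝ] ℝ => L v) (by simp)
  have i1 : Integrable fun x => fderiv ℝ q x v :=
    Continuous.integrable_of_hasCompactSupport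
      ((hq.continuous_fderiv (by simp)).clm_apply continuous_const) hc'
  have h := integral_mul_fderiv_eq_neg_fderiv_mul_of_integrable (μ := (volume : Measure (Space n)))
    (f := fun _ => (1 : ℝ)) (g := q) (v := v) (by simp) (by simpa using i1)
    (by simpa using hq.continuous.integrable_of_hasCompactSupport hc)
    (fun x _ => differentiableAt_const _) (fun x _ => hq.differentiable (by simp) x)
  simpa using h

/-- Hardy's inequality. For a supporting half-space `{ℓ > 0}` of `Ω` at `P` with normal `ν`,
`ℓ ≤ ‖ν‖ r`, and the estimate is that of the one-dimensional Hardy inequality in the direction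
of `ν`. -/
theorem IsTest.hardy {Ω : Set (Space n)} (hopen : IsOpen Ω) (hconv : Convex ℝ Ω) {P : Space n}
    (hP : P ∉ Ω) {φ : Space n → ℂ} (h : IsTest Ω φ) :
    ∫⁻ Q, ‖(dist P Q)⁻¹ • φ Q‖ₑ ^ 2 ≤ 4 * energy φ := by
  obtain ⟨f, hf⟩ := geometric_hahn_banach_open_point hconv hopen hP
  set ν := (InnerProductSpace.toDual ℝ (Space n)).symm f with hν
  have hfν : ∀ x, f x = ⟪ν, x⟫_ℝ := fun x => by simp [hν]
  by_cases hne : Ω.Nonempty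
  swap
  · rw [Set.not_nonempty_iff_eq_empty] at hne
    have : ∀ Q, φ Q = 0 := fun Q => h.eq_zero (by simp [hne])
    simp [this]
  obtain ⟨Q₀, hQ₀⟩ := hne
  have hN : 0 < ‖ν‖ := by
    refine norm_pos_iff.2 fun h0 => ?_
    have := hf Q₀ hQ₀
    simp [hfν, h0] at this
  set ℓ : Space n → ℝ := fun Q => f P - f Q with hℓ
  have hℓpos : ∀ Q ∈ Ω, 0 < ℓ Q := fun Q hQ => sub_pos.2 (hf Q hQ)
  have hℓle : ∀ Q, ℓ Q ≤ ‖ν‖ * dist P Q := fun Q => by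
    simp only [hℓ]
    rw [← map_sub, hfν, dist_eq_norm]
    exact real_inner_le_norm _ _
  -- The derivative of `q` along `ν` has integral zero. It consists of a positive multiple of
  -- `|φ|² / ℓ²` and a product of `φ / ℓ` with the derivative of `φ`.
  set q : Space n → ℝ := fun Q => ‖φ Q‖ ^ 2 * (ℓ Q)⁻¹ with hq
  have hdℓ : ∀ Q, HasFDerivAt ℓ (-f) Q := fun Q => by
    simpa using (f.hasFDerivAt (x := Q)).const_sub (f P)
  have hqd : ∀ Q ∈ Ω, HasFDerivAt q ((‖φ Q‖ ^ 2) • (-(ℓ Q ^ 2)⁻¹ • (-f)) +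
      (ℓ Q)⁻¹ • (2 • (innerSL ℝ (φ Q)).comp (fderiv ℝ φ Q))) Q := fun Q hQ =>
    ((h.smooth.differentiable (by simp) Q).hasFDerivAt.norm_sq).mul
      ((hasDerivAt_inv (hℓpos Q hQ).ne').comp_hasFDerivAt Q (hdℓ Q))
  have hts : tsupport q ⊆ tsupport φ := by
    refine closure_mono fun x hx h0 => hx ?_
    simp [hq, h0]
  have hqc : HasCompactSupport q := h.compact.of_isClosed_subset (isClosed_tsupport _) hts
  have hqC : ContDiff ℝ 1 q := by
    refine contDiff_iff_contDiffAt.2 fun x => ?_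
    by_cases hx : x ∈ tsupport q
    · have hx' := h.subset (hts hx)
      refine ContDiffAt.mul ?_ (ContDiffAt.inv ?_ (hℓpos x hx').ne')
      · exact ((h.smooth.of_le (by simp)).norm_sq ℝ).contDiffAt
      · exact (contDiff_const.sub f.contDiff).contDiffAt
    · exact contDiffAt_const.congr_of_eventuallyEq (notMem_tsupport_iff_eventuallyEq.1 hx)
  have hzero := integral_fderiv_eq_zero hqC hqc ν
  have hint : Integrable fun x => fderiv ℝ q x ν :=
    Continuous.integrable_of_hasCompactSupport
      ((hqC.continuous_fderiv (by simp)).clm_apply continuous_const)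
      ((hqc.fderiv ℝ).comp_left (g := fun L : Space n →L[ℝ] ℝ => L ν) (by simp))
  have key : ∀ Q, ‖(dist P Q)⁻¹ • φ Q‖ ^ 2 ≤ 2 * fderiv ℝ q Q ν + 4 * gradSq φ Q := by
    intro Q
    have hg := gradSq_nonneg φ Q
    by_cases hQ : Q ∈ tsupport φ
    · have hQ' := h.subset hQ
      have hl := hℓpos Q hQ'
      have hr : 0 < dist P Q := dist_pos.2 fun e => hP (e ▸ hQ')
      rw [(hqd Q hQ').fderiv]
      have e : ((‖φ Q‖ ^ 2) • (-(ℓ Q ^ 2)⁻¹ • (-f)) +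
          (ℓ Q)⁻¹ • (2 • (innerSL ℝ (φ Q)).comp (fderiv ℝ φ Q))) ν =
          (ℓ Q)⁻¹ * (2 * ⟪φ Q, fderiv ℝ φ Q ν⟫_ℝ) + (ℓ Q)⁻¹ ^ 2 * ‖φ Q‖ ^ 2 * ‖ν‖ ^ 2 := by
        simp only [smul_apply, add_apply,
          ContinuousLinearMap.comp_apply, innerSL_apply_apply, neg_apply,
          smul_eq_mul, hfν, real_inner_self_eq_norm_sq, nsmul_eq_mul]
        push_cast
        ring_nf
      rw [e]
      set a := (ℓ Q)⁻¹ * ‖φ Q‖ with ha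
      have b1 : -(‖φ Q‖ * ‖fderiv ℝ φ Q ν‖) ≤ ⟪φ Q, fderiv ℝ φ Q ν⟫_ℝ :=
        neg_le_of_abs_le (abs_real_inner_le_norm _ _)
      have b2 : ‖fderiv ℝ φ Q ν‖ ≤ ‖ν‖ * √(gradSq φ Q) := by
        rw [← Real.sqrt_sq (norm_nonneg ν), ← Real.sqrt_mul (sq_nonneg _)]
        exact Real.le_sqrt_of_sq_le (norm_fderiv_sq_le φ Q ν)
      have b3 : ‖(dist P Q)⁻¹ • φ Q‖ ≤ ‖ν‖ * a := by
        rw [norm_smul, norm_inv, Real.norm_eq_abs, abs_of_pos hr, ha, ← mul_assoc]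
        gcongr
        rw [inv_le_iff_one_le_mul₀ hr, mul_comm ‖ν‖, mul_assoc]
        rw [← div_eq_inv_mul, one_le_div hl]
        exact hℓle Q
      set S := √(gradSq φ Q) with hS
      have hS2 : gradSq φ Q = S ^ 2 := (Real.sq_sqrt hg).symm
      have b4 : (ℓ Q)⁻¹ * -(‖φ Q‖ * (‖ν‖ * S)) ≤ (ℓ Q)⁻¹ * ⟪φ Q, fderiv ℝ φ Q ν⟫_ℝ := by
        refine mul_le_mul_of_nonneg_left (le_trans (neg_le_neg ?_) b1) (inv_pos.2 hl).le
        gcongr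
      have b5 : ‖(dist P Q)⁻¹ • φ Q‖ ^ 2 ≤ (‖ν‖ * a) ^ 2 := by gcongr
      have b6 : (ℓ Q)⁻¹ * -(‖φ Q‖ * (‖ν‖ * S)) = -((‖ν‖ * a) * S) := by rw [ha]; ring
      have b7 : (ℓ Q)⁻¹ ^ 2 * ‖φ Q‖ ^ 2 * ‖ν‖ ^ 2 = (‖ν‖ * a) ^ 2 := by rw [ha]; ring
      rw [b6] at b4
      rw [b7, hS2]
      -- with `A = ‖ν‖ a`, this is `A² ≤ 2 (A² - 2 A S) + 4 S²`
      nlinarith [sq_nonneg (‖ν‖ * a - 2 * S)]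
    · have hQ' : Q ∉ tsupport q := fun h' => hQ (hts h')
      rw [image_eq_zero_of_notMem_tsupport hQ, fderiv_of_notMem_tsupport ℝ hQ']
      simpa using hg
  calc ∫⁻ Q, ‖(dist P Q)⁻¹ • φ Q‖ₑ ^ 2
      ≤ ∫⁻ Q, ENNReal.ofReal (2 * fderiv ℝ q Q ν + 4 * gradSq φ Q) := by
        refine lintegral_mono fun Q => ?_
        rw [← ofReal_norm, ← ENNReal.ofReal_pow (norm_nonneg _)]
        exact ENNReal.ofReal_le_ofReal (key Q)
    _ = ENNReal.ofReal (∫ Q, (2 * fderiv ℝ q Q ν + 4 * gradSq φ Q)) := by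
        exact (ofReal_integral_eq_lintegral_ofReal ((hint.const_mul 2).add
          (h.integrable_gradSq.const_mul 4))
          (Eventually.of_forall fun Q => (sq_nonneg _).trans (key Q))).symm
    _ = 4 * energy φ := by
        rw [integral_add (hint.const_mul 2) (h.integrable_gradSq.const_mul 4),
          integral_const_mul, integral_const_mul, hzero, energy,
          ← ofReal_integral_eq_lintegral_ofReal h.integrable_gradSq
          (Eventually.of_forall (gradSq_nonneg φ)), mul_zero, zero_add,
          ENNReal.ofReal_mul (by norm_num)]
        simp

/-- The fundamental theorem of calculus along the ray through `Q`, and Cauchy–Schwarz. -/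
theorem IsTest.enorm_sub_dil_sq_le {Ω : Set (Space n)} {φ : Space n → ℂ} (h : IsTest Ω φ)
    (P Q : Space n) (s : ℝ) :
    ‖(dist P Q)⁻¹ • (φ Q - φ (dil P s Q))‖ₑ ^ 2 ≤
      ENNReal.ofReal |1 - s| * ∫⁻ σ in Set.uIoc s 1, ENNReal.ofReal (gradSq φ (dil P σ Q)) := by
  have hd : ∀ σ : ℝ, HasDerivAt (fun σ => φ (dil P σ Q)) (fderiv ℝ φ (dil P σ Q) (Q - P)) σ := by
    intro σ
    have h1 : HasDerivAt (fun σ : ℝ => dil P σ Q) (Q - P) σ := by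
      simpa [dil] using ((hasDerivAt_id σ).smul_const (Q - P)).const_add P
    exact (h.smooth.differentiable (by simp) _).hasFDerivAt.comp_hasDerivAt σ h1
  have hc : Continuous fun σ : ℝ => fderiv ℝ φ (dil P σ Q) (Q - P) := by
    refine (h.continuous_fderiv.comp ?_).clm_apply continuous_const
    unfold dil; fun_prop
  have hI := intervalIntegral.integral_eq_sub_of_hasDerivAt (a := s) (b := 1)
    (fun σ _ => hd σ) (hc.intervalIntegrable _ _)
  rw [dil_one] at hI
  have e1 : ‖φ Q - φ (dil P s Q)‖ₑ ≤
      ∫⁻ σ in Set.uIoc s 1, ‖fderiv ℝ φ (dil P σ Q) (Q - P)‖ₑ := by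
    rw [← hI, ← ofReal_norm, intervalIntegral.norm_intervalIntegral_eq, ofReal_norm]
    exact enorm_integral_le_lintegral_enorm _
  have e2 : ‖φ Q - φ (dil P s Q)‖ₑ ^ 2 ≤ ENNReal.ofReal |1 - s| *
      ∫⁻ σ in Set.uIoc s 1, ‖fderiv ℝ φ (dil P σ Q) (Q - P)‖ₑ ^ 2 := by
    calc _ ≤ (∫⁻ σ in Set.uIoc s 1, 1 * ‖fderiv ℝ φ (dil P σ Q) (Q - P)‖ₑ) ^ 2 := by
          simp only [one_mul]; gcongr
      _ ≤ _ := lintegral_mul_sq_le aemeasurable_const hc.enorm.measurable.aemeasurable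
      _ = _ := by
        congr 1
        simp [Set.uIoc, abs_sub_comm, max_sub_min_eq_abs]
  have e3 : ∀ σ, ‖fderiv ℝ φ (dil P σ Q) (Q - P)‖ₑ ^ 2 ≤
      ENNReal.ofReal (dist P Q ^ 2) * ENNReal.ofReal (gradSq φ (dil P σ Q)) := by
    intro σ
    rw [← ofReal_norm, ← ENNReal.ofReal_pow (norm_nonneg _), ← ENNReal.ofReal_mul (by positivity)]
    refine ENNReal.ofReal_le_ofReal ((norm_fderiv_sq_le _ _ _).trans (le_of_eq ?_))
    rw [dist_comm, dist_eq_norm]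
  have hm : Measurable fun σ : ℝ => ENNReal.ofReal (gradSq φ (dil P σ Q)) :=
    ENNReal.measurable_ofReal.comp (h.continuous_gradSq.measurable.comp (by fun_prop))
  have e4 : ‖φ Q - φ (dil P s Q)‖ₑ ^ 2 ≤ ENNReal.ofReal |1 - s| * (ENNReal.ofReal (dist P Q ^ 2) *
      ∫⁻ σ in Set.uIoc s 1, ENNReal.ofReal (gradSq φ (dil P σ Q))) := by
    refine e2.trans ?_
    gcongr
    rw [← lintegral_const_mul _ hm]
    exact lintegral_mono e3
  by_cases hr : dist P Q = 0
  · simp [hr]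
  · have hr' : 0 < dist P Q := lt_of_le_of_ne dist_nonneg (Ne.symm hr)
    rw [enorm_smul, mul_pow, Real.enorm_eq_ofReal (by positivity),
      ← ENNReal.ofReal_pow (by positivity)]
    calc ENNReal.ofReal ((dist P Q)⁻¹ ^ 2) * ‖φ Q - φ (dil P s Q)‖ₑ ^ 2
        ≤ ENNReal.ofReal ((dist P Q)⁻¹ ^ 2) *
          (ENNReal.ofReal |1 - s| * (ENNReal.ofReal (dist P Q ^ 2) *
            ∫⁻ σ in Set.uIoc s 1, ENNReal.ofReal (gradSq φ (dil P σ Q)))) := by gcongr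
      _ = (ENNReal.ofReal ((dist P Q)⁻¹ ^ 2) * ENNReal.ofReal (dist P Q ^ 2)) *
          (ENNReal.ofReal |1 - s| *
            ∫⁻ σ in Set.uIoc s 1, ENNReal.ofReal (gradSq φ (dil P σ Q))) := by ring
      _ = _ := by
        rw [← ENNReal.ofReal_mul (by positivity), ← mul_pow, inv_mul_cancel₀ hr]
        simp

/-- The increment of a test function under the dilation by `s`. The constant `A` bounds the
Jacobians of the intermediate dilations; the cases `s < 1` and `s > 1` are both needed. -/
theorem IsTest.lintegral_sub_dil_sq_le {Ω : Set (Space n)} {φ : Space n → ℂ} (h : IsTest Ω φ)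
    (P : Space n) {s A : ℝ} (hs : 0 < s) (hA : ∀ σ ∈ Set.uIoc s 1, (σ ^ n)⁻¹ ≤ A) :
    ∫⁻ Q, ‖(dist P Q)⁻¹ • (φ Q - φ (dil P s Q))‖ₑ ^ 2 ≤
      ENNReal.ofReal (|1 - s| ^ 2 * A) * energy φ := by
  have hm : Measurable fun p : Space n × ℝ => ENNReal.ofReal (gradSq φ (dil P p.2 p.1)) :=
    ENNReal.measurable_ofReal.comp (h.continuous_gradSq.measurable.comp (by fun_prop))
  calc ∫⁻ Q, ‖(dist P Q)⁻¹ • (φ Q - φ (dil P s Q))‖ₑ ^ 2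
      ≤ ∫⁻ Q, ENNReal.ofReal |1 - s| *
        ∫⁻ σ in Set.uIoc s 1, ENNReal.ofReal (gradSq φ (dil P σ Q)) :=
        lintegral_mono fun Q => h.enorm_sub_dil_sq_le P Q s
    _ = ENNReal.ofReal |1 - s| *
        ∫⁻ σ in Set.uIoc s 1, ∫⁻ Q, ENNReal.ofReal (gradSq φ (dil P σ Q)) := by
        rw [lintegral_const_mul _ hm.lintegral_prod_right',
          lintegral_lintegral_swap hm.aemeasurable]
    _ ≤ ENNReal.ofReal |1 - s| * ∫⁻ σ in Set.uIoc s 1, ENNReal.ofReal A * energy φ := by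
        gcongr 1
        refine setLIntegral_mono' measurableSet_uIoc fun σ hσ => ?_
        have h0 : 0 < σ := lt_of_le_of_lt (le_min hs.le zero_le_one) hσ.1
        rw [lintegral_comp_dil P h0 (fun Q => ENNReal.ofReal (gradSq φ Q)), energy]
        gcongr
        exact hA σ hσ
    _ = _ := by
        have : (volume (Set.uIoc s 1)) = ENNReal.ofReal |1 - s| := by
          simp [Set.uIoc, max_sub_min_eq_abs, abs_sub_comm]
        rw [lintegral_const, Measure.restrict_apply_univ, this,
          ENNReal.ofReal_mul (by positivity), ENNReal.ofReal_pow (by positivity)]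
        ring

/-! ### Limits of test functions -/

/-- `f` is the almost everywhere limit of test functions whose Dirichlet energies converge
to `E`. Convergence of the gradients is not part of it: by Fatou's lemma this much suffices to
carry over quadratic estimates. -/
def HasEnergy (Ω : Set (Space n)) (f : Space n → ℂ) (E : ℝ≥0∞) : Prop :=
  ∃ φ : ℕ → Space n → ℂ, (∀ k, IsTest Ω (φ k)) ∧
    (∀ᵐ Q, Tendsto (fun k => φ k Q) atTop (𝓝 (f Q))) ∧
    Tendsto (fun k => energy (φ k)) atTop (𝓝 E)

theorem IsTest.hasEnergy {Ω : Set (Space n)} {φ : Space n → ℂ} (h : IsTest Ω φ) :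
    HasEnergy Ω φ (energy φ) :=
  ⟨fun _ => φ, fun _ => h, Eventually.of_forall fun _ => tendsto_const_nhds, tendsto_const_nhds⟩

/-- Quadratic estimates pass to almost everywhere limits, by Fatou's lemma. -/
theorem lintegral_sq_le_of_tendsto {F : ℕ → Space n → ℂ} {f : Space n → ℂ}
    (hm : ∀ k, Measurable (F k)) (h : ∀ᵐ Q, Tendsto (fun k => F k Q) atTop (𝓝 (f Q)))
    {e : ℕ → ℝ≥0∞} {E c : ℝ≥0∞} (he : Tendsto e atTop (𝓝 E)) (hc : c ≠ ⊤)
    (hF : ∀ k, ∫⁻ Q, ‖F k Q‖ₑ ^ 2 ≤ c * e k) : ∫⁻ Q, ‖f Q‖ₑ ^ 2 ≤ c * E := by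
  have h1 : ∀ᵐ Q, ‖f Q‖ₑ ^ 2 = liminf (fun k => ‖F k Q‖ₑ ^ 2) atTop := by
    filter_upwards [h] with Q hQ
    have : Tendsto (fun k => ‖F k Q‖ₑ ^ 2) atTop (𝓝 (‖f Q‖ₑ ^ 2)) :=
      ((ENNReal.continuous_pow 2).tendsto _).comp hQ.enorm
    exact this.liminf_eq.symm
  have h2 : Tendsto (fun k => c * e k) atTop (𝓝 (c * E)) :=
    ENNReal.Tendsto.const_mul he (Or.inr hc)
  calc ∫⁻ Q, ‖f Q‖ₑ ^ 2 = ∫⁻ Q, liminf (fun k => ‖F k Q‖ₑ ^ 2) atTop := lintegral_congr_ae h1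
    _ ≤ liminf (fun k => ∫⁻ Q, ‖F k Q‖ₑ ^ 2) atTop :=
        lintegral_liminf_le fun k => (hm k).enorm.pow_const 2
    _ ≤ liminf (fun k => c * e k) atTop := liminf_le_liminf (Eventually.of_forall hF)
    _ = c * E := h2.liminf_eq

theorem HasEnergy.hardy {Ω : Set (Space n)} (hopen : IsOpen Ω) (hconv : Convex ℝ Ω)
    {P : Space n} (hP : P ∉ Ω) {f : Space n → ℂ} {E : ℝ≥0∞} (h : HasEnergy Ω f E) :
    ∫⁻ Q, ‖(dist P Q)⁻¹ • f Q‖ₑ ^ 2 ≤ 4 * E := by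
  obtain ⟨φ, h1, h2, h3⟩ := h
  refine lintegral_sq_le_of_tendsto (F := fun k Q => (dist P Q)⁻¹ • φ k Q) (fun k => ?_) ?_ h3
    (by norm_num) (fun k => (h1 k).hardy hopen hconv hP)
  · have := (h1 k).smooth.continuous.measurable
    fun_prop
  · filter_upwards [h2] with Q hQ
    exact hQ.const_smul _

theorem HasEnergy.lintegral_sub_dil_sq_le {Ω : Set (Space n)} {f : Space n → ℂ} {E : ℝ≥0∞}
    (h : HasEnergy Ω f E) (P : Space n) {s A : ℝ} (hs : 0 < s)
    (hA : ∀ σ ∈ Set.uIoc s 1, (σ ^ n)⁻¹ ≤ A) :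
    ∫⁻ Q, ‖(dist P Q)⁻¹ • (f Q - f (dil P s Q))‖ₑ ^ 2 ≤
      ENNReal.ofReal (|1 - s| ^ 2 * A) * E := by
  obtain ⟨φ, h1, h2, h3⟩ := h
  refine lintegral_sq_le_of_tendsto
    (F := fun k Q => (dist P Q)⁻¹ • (φ k Q - φ k (dil P s Q))) (fun k => ?_) ?_ h3
    ENNReal.ofReal_ne_top (fun k => (h1 k).lintegral_sub_dil_sq_le P hs hA)
  · have m := (h1 k).smooth.continuous.measurable
    have m' : Measurable fun Q => φ k (dil P s Q) := m.comp (by fun_prop)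
    fun_prop
  · filter_upwards [h2, (quasiMeasurePreserving_dil P hs).ae h2] with Q hQ hQ'
    exact (hQ.sub hQ').const_smul _

/-! ### `L₂` bounds for the two fractional derivatives -/

theorem enorm_smul_sq (c : ℝ) (z : ℂ) : ‖c • z‖ₑ ^ 2 = ENNReal.ofReal (c ^ 2) * ‖z‖ₑ ^ 2 := by
  rw [enorm_smul, mul_pow, Real.enorm_eq_ofReal_abs, ← ENNReal.ofReal_pow (abs_nonneg c), sq_abs]

theorem add_sq_le_four_mul (a b : ℝ≥0∞) : (a + b) ^ 2 ≤ 4 * (a ^ 2 + b ^ 2) := by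
  rcases le_total a b with h | h
  · calc (a + b) ^ 2 ≤ (b + b) ^ 2 := by gcongr
      _ = 4 * b ^ 2 := by ring
      _ ≤ _ := by gcongr; exact le_add_self
  · calc (a + b) ^ 2 ≤ (a + a) ^ 2 := by gcongr
      _ = 4 * a ^ 2 := by ring
      _ ≤ _ := by gcongr; exact le_self_add

theorem enorm_add_sq_le (z w : ℂ) : ‖z + w‖ₑ ^ 2 ≤ 4 * (‖z‖ₑ ^ 2 + ‖w‖ₑ ^ 2) :=
  (by gcongr; exact enorm_add_le z w : ‖z + w‖ₑ ^ 2 ≤ (‖z‖ₑ + ‖w‖ₑ) ^ 2).trans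
    (add_sq_le_four_mul _ _)

/-- In dimension zero every set has empty frontier. -/
theorem one_le_of_mem_frontier {Ω : Set (Space n)} {P : Space n} (hP : P ∈ frontier Ω) :
    1 ≤ n := by
  rcases Nat.eq_zero_or_pos n with rfl | h
  · rcases Subsingleton.set_cases (p := fun Ω : Set (Space 0) => frontier Ω = ∅) (by simp)
      (by simp) Ω with h
    exact absurd hP (by simp)
  · exact h

theorem notMem_of_mem_frontier {Ω : Set (Space n)} (hopen : IsOpen Ω) {P : Space n}
    (hP : P ∈ frontier Ω) : P ∉ Ω := by
  rw [hopen.frontier_eq] at hP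
  exact hP.2

theorem dist_le_diam {Ω : Set (Space n)} (hbdd : Bornology.IsBounded Ω) {P Q : Space n}
    (hP : P ∈ frontier Ω) (hQ : Q ∈ Ω) : dist P Q ≤ Metric.diam Ω := by
  rw [← Metric.diam_closure]
  exact Metric.dist_le_diam_of_mem hbdd.closure hP.1 (subset_closure hQ)

theorem dist_pos_of_mem {Ω : Set (Space n)} (hopen : IsOpen Ω) {P Q : Space n}
    (hP : P ∈ frontier Ω) (hQ : Q ∈ Ω) : 0 < dist P Q :=
  dist_pos.2 fun e => notMem_of_mem_frontier hopen hP (e ▸ hQ)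

theorem rpow_neg_sq_le {r d α : ℝ} (hr : 0 < r) (hd : r ≤ d) (h1 : α < 1) :
    (r ^ (-α)) ^ 2 ≤ (d ^ (1 - α)) ^ 2 * (r⁻¹) ^ 2 := by
  have e : r ^ (-α) = r ^ (1 - α) * r⁻¹ := by
    rw [← Real.rpow_neg_one r, ← Real.rpow_add hr]; congr 1; ring
  rw [e, mul_pow]
  have : r ^ (1 - α) ≤ d ^ (1 - α) := Real.rpow_le_rpow hr.le hd (by linarith)
  gcongr

theorem lintegral_rpow_smul_sq_le {Ω : Set (Space n)} (hopen : IsOpen Ω)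
    (hbdd : Bornology.IsBounded Ω) {P : Space n} (hP : P ∈ frontier Ω) {α : ℝ} (h1 : α < 1)
    (g : Space n → ℂ) :
    ∫⁻ Q in Ω, ‖dist P Q ^ (-α) • g Q‖ₑ ^ 2 ≤
      ENNReal.ofReal ((Metric.diam Ω ^ (1 - α)) ^ 2) * ∫⁻ Q, ‖(dist P Q)⁻¹ • g Q‖ₑ ^ 2 := by
  rw [← lintegral_const_mul' _ _ ENNReal.ofReal_ne_top]
  refine (setLIntegral_mono' hopen.measurableSet fun Q hQ => ?_).trans
    (setLIntegral_le_lintegral _ _)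
  rw [enorm_smul_sq, enorm_smul_sq, ← mul_assoc, ← ENNReal.ofReal_mul (by positivity)]
  gcongr
  exact rpow_neg_sq_le (dist_pos_of_mem hopen hP hQ) (dist_le_diam hbdd hP hQ) h1

theorem HasEnergy.lintegral_rpow_smul_sq_le {Ω : Set (Space n)} (hopen : IsOpen Ω)
    (hconv : Convex ℝ Ω) (hbdd : Bornology.IsBounded Ω) {P : Space n} (hP : P ∈ frontier Ω)
    {α : ℝ} (h1 : α < 1) {f : Space n → ℂ} {E : ℝ≥0∞} (h : HasEnergy Ω f E) :
    ∫⁻ Q in Ω, ‖dist P Q ^ (-α) • f Q‖ₑ ^ 2 ≤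
      ENNReal.ofReal (4 * (Metric.diam Ω ^ (1 - α)) ^ 2) * E := by
  refine (Kipriyanov.lintegral_rpow_smul_sq_le hopen hbdd hP h1 f).trans ?_
  calc _ ≤ ENNReal.ofReal ((Metric.diam Ω ^ (1 - α)) ^ 2) * (4 * E) := by
        gcongr; exact h.hardy hopen hconv (notMem_of_mem_frontier hopen hP)
    _ = _ := by
        rw [ENNReal.ofReal_mul (by norm_num)]; simp; ring

/-- The bound for the norm of the sections of the integral that defines `𝔇^α`. The exponent
`-1/2` at `s = 0` does not depend on `n`: it comes from the weight `s^{2(n-1)}` and the Jacobian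
`s^{-n}`, whose product is at most `s⁻¹`. -/
def kipWeight (d α s : ℝ) : ℝ := d ^ (1 - α) * (s ^ (1 / 2 - 1 : ℝ) * (1 - s) ^ ((1 - α) - 1))

/-- For fixed `s` the integrand of `𝔇^α` is controlled by the energy. -/
theorem kipDil_section_le {Ω : Set (Space n)} (hopen : IsOpen Ω)
    (hbdd : Bornology.IsBounded Ω) {P : Space n} (hP : P ∈ frontier Ω) {α : ℝ} (h1 : α < 1)
    {f : Space n → ℂ} {E : ℝ≥0∞} (h : HasEnergy Ω f E) {s : ℝ} (hs : s ∈ Set.Ioo (0 : ℝ) 1) :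
    ∫⁻ Q in Ω, ‖kipDil α P f s Q‖ₑ ^ 2 ≤
      ENNReal.ofReal (kipWeight (Metric.diam Ω) α s) ^ 2 * E := by
  have p0 : 0 < s := hs.1
  have p1 : 0 < 1 - s := sub_pos.2 hs.2
  have hn := one_le_of_mem_frontier hP
  set d := Metric.diam Ω
  have hd : 0 ≤ d := Metric.diam_nonneg
  have hA : ∀ σ ∈ Set.uIoc s 1, (σ ^ n)⁻¹ ≤ (s ^ n)⁻¹ := fun σ hσ => by
    rw [Set.uIoc_of_le hs.2.le] at hσ
    gcongr
    exact hσ.1.le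
  set W := s ^ (n - 1) * (1 - s) ^ (-α - 1) with hW
  have e1 : ∀ Q, ‖kipDil α P f s Q‖ₑ ^ 2 =
      ENNReal.ofReal (W ^ 2) * ‖dist P Q ^ (-α) • (f Q - f (dil P s Q))‖ₑ ^ 2 := fun Q => by
    rw [kipDil, ← enorm_smul_sq, smul_smul, mul_comm W]
  calc ∫⁻ Q in Ω, ‖kipDil α P f s Q‖ₑ ^ 2
      = ENNReal.ofReal (W ^ 2) *
        ∫⁻ Q in Ω, ‖dist P Q ^ (-α) • (f Q - f (dil P s Q))‖ₑ ^ 2 := by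
        simp only [e1]
        rw [lintegral_const_mul' _ _ ENNReal.ofReal_ne_top]
    _ ≤ ENNReal.ofReal (W ^ 2) * (ENNReal.ofReal ((d ^ (1 - α)) ^ 2) *
          (ENNReal.ofReal (|1 - s| ^ 2 * (s ^ n)⁻¹) * E)) := by
        gcongr
        refine (lintegral_rpow_smul_sq_le hopen hbdd hP h1 _).trans ?_
        gcongr
        exact h.lintegral_sub_dil_sq_le P p0 hA
    _ = ENNReal.ofReal (W ^ 2 * ((d ^ (1 - α)) ^ 2 * (|1 - s| ^ 2 * (s ^ n)⁻¹))) * E := by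
        rw [ENNReal.ofReal_mul (p := W ^ 2) (by positivity),
          ENNReal.ofReal_mul (p := (d ^ (1 - α)) ^ 2) (by positivity)]
        ring
    _ ≤ _ := by
        rw [← ENNReal.ofReal_pow (by unfold kipWeight; positivity)]
        gcongr ENNReal.ofReal ?_ * E
        rw [abs_of_pos p1, kipWeight, hW]
        have t1 : (1 - s) ^ ((1 - α) - 1) = (1 - s) * (1 - s) ^ (-α - 1) := by
          rw [show (1 - α) - 1 = 1 + (-α - 1) by ring, Real.rpow_add p1, Real.rpow_one]
        have t2 : (s ^ (1 / 2 - 1 : ℝ)) ^ 2 = s⁻¹ := by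
          rw [← Real.rpow_natCast, ← Real.rpow_mul p0.le, ← Real.rpow_neg_one]; norm_num
        have t3 : (s ^ (n - 1)) ^ 2 * (s ^ n)⁻¹ ≤ s⁻¹ := by
          rw [← div_eq_mul_inv, div_le_iff₀ (by positivity)]
          obtain ⟨m, rfl⟩ : ∃ m, n = m + 1 := ⟨n - 1, by omega⟩
          rw [pow_succ s m, inv_mul_eq_div, mul_div_assoc, div_self p0.ne', mul_one,
            Nat.add_sub_cancel, ← pow_mul]
          exact pow_le_pow_of_le_one p0.le hs.2.le (by omega)
        calc _ = (d ^ (1 - α)) ^ 2 * ((s ^ (n - 1)) ^ 2 * (s ^ n)⁻¹) *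
              ((1 - s) * (1 - s) ^ (-α - 1)) ^ 2 := by ring
          _ ≤ (d ^ (1 - α)) ^ 2 * s⁻¹ * ((1 - s) * (1 - s) ^ (-α - 1)) ^ 2 := by gcongr
          _ = _ := by rw [t1, ← t2]; ring

/-- A bound for the norm of `f ↦ ∫ kipDil α P f s ds` as an operator from `H¹₀(Ω)` to `L₂(Ω)`;
it does not depend on `P`. -/
def kipNorm (d α : ℝ) : ℝ≥0∞ := ∫⁻ s in Set.Ioo (0 : ℝ) 1, ENNReal.ofReal (kipWeight d α s)

theorem kipNorm_lt_top {d α : ℝ} (h1 : α < 1) : kipNorm d α < ⊤ :=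
  ((integrableOn_beta (by norm_num : (0 : ℝ) < 1 / 2) (sub_pos.2 h1)).const_mul
    (d ^ (1 - α))).lintegral_lt_top

theorem lintegral_sq_lintegral_kipDil_le {Ω : Set (Space n)} (hopen : IsOpen Ω)
    (hbdd : Bornology.IsBounded Ω) {P : Space n} (hP : P ∈ frontier Ω) {α : ℝ} (h1 : α < 1)
    {f : Space n → ℂ} (hf : Measurable f) {E : ℝ≥0∞} (h : HasEnergy Ω f E) :
    ∫⁻ Q in Ω, (∫⁻ s in Set.Ioo (0 : ℝ) 1, ‖kipDil α P f s Q‖ₑ) ^ 2 ≤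
      kipNorm (Metric.diam Ω) α ^ 2 * E := by
  by_cases hΩ : Ω.Nonempty
  swap
  · simp [Set.not_nonempty_iff_eq_empty.1 hΩ]
  obtain ⟨Q₀, hQ₀⟩ := hΩ
  have hd : 0 < Metric.diam Ω :=
    (dist_pos_of_mem hopen hP hQ₀).trans_le (dist_le_diam hbdd hP hQ₀)
  refine lintegral_sq_lintegral_le (measurable_kipDil hf).enorm ?_ ?_ ?_ ?_
  · unfold kipWeight; fun_prop
  · refine (ae_restrict_iff' measurableSet_Ioo).2 (Eventually.of_forall fun s hs => ?_)
    have p0 : 0 < s := hs.1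
    have p1 : 0 < 1 - s := sub_pos.2 hs.2
    have : 0 < kipWeight (Metric.diam Ω) α s := by unfold kipWeight; positivity
    simpa using this
  · exact Eventually.of_forall fun s => ENNReal.ofReal_ne_top
  · exact (ae_restrict_iff' measurableSet_Ioo).2 (Eventually.of_forall fun s hs =>
      kipDil_section_le hopen hbdd hP h1 h hs)

theorem integrableOn_of_lintegral_sq_lintegral {Ω : Set (Space n)} {F : ℝ → Space n → ℂ}
    (hF : Measurable (Function.uncurry F))
    (h : ∫⁻ Q in Ω, (∫⁻ s in Set.Ioo (0 : ℝ) 1, ‖F s Q‖ₑ) ^ 2 < ⊤) :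
    ∀ᵐ Q ∂volume.restrict Ω, IntegrableOn (fun s => F s Q) (Set.Ioo 0 1) := by
  have m1 : Measurable fun p : Space n × ℝ => F p.2 p.1 := hF.comp measurable_swap
  have m2 : Measurable fun Q => (∫⁻ s in Set.Ioo (0 : ℝ) 1, ‖F s Q‖ₑ) ^ 2 :=
    (Measurable.lintegral_prod_right' m1.enorm).pow_const 2
  filter_upwards [ae_lt_top m2 h.ne] with Q hQ
  refine ⟨(m1.comp measurable_prodMk_left).aestronglyMeasurable, ?_⟩
  by_contra hne
  rw [HasFiniteIntegral, not_lt, top_le_iff] at hne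
  rw [hne] at hQ
  simp at hQ

theorem stronglyMeasurable_integral_section {F : ℝ → Space n → ℂ}
    (hF : Measurable (Function.uncurry F)) :
    StronglyMeasurable fun Q => ∫ s in Set.Ioo (0 : ℝ) 1, F s Q :=
  (hF.comp measurable_swap).stronglyMeasurable.integral_prod_right'

theorem kip_eq {α : ℝ} {P Q : Space n} (hr : 0 < dist P Q) (f : Space n → ℂ) :
    kip α P f Q = (α / Real.Gamma (1 - α)) • (∫ s in Set.Ioo (0 : ℝ) 1, kipDil α P f s Q) +
      kipConst n α • (dist P Q ^ (-α) • f Q) := by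
  rw [kip, integral_kipIntegrand hr, smul_smul]

/-- A bound for the square of the norm of `𝔇^α` as an operator from `H¹₀(Ω)` to `L₂(Ω)`,
in terms of the diameter of `Ω`. -/
def kipBound (n : ℕ) (d α : ℝ) : ℝ≥0∞ :=
  4 * (ENNReal.ofReal ((α / Real.Gamma (1 - α)) ^ 2) * kipNorm d α ^ 2 +
    ENNReal.ofReal (kipConst n α ^ 2) * ENNReal.ofReal (4 * (d ^ (1 - α)) ^ 2))

theorem kipBound_lt_top {d α : ℝ} (h1 : α < 1) : kipBound n d α < ⊤ := by
  have := kipNorm_lt_top (d := d) h1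
  unfold kipBound
  finiteness

/-- `𝔇^α` is bounded from `H¹₀(Ω)` to `L₂(Ω)`, uniformly in `P`. -/
theorem lintegral_kip_sq_le {Ω : Set (Space n)} (hopen : IsOpen Ω) (hconv : Convex ℝ Ω)
    (hbdd : Bornology.IsBounded Ω) {P : Space n} (hP : P ∈ frontier Ω) {α : ℝ} (h1 : α < 1)
    {f : Space n → ℂ} (hf : Measurable f) {E : ℝ≥0∞} (h : HasEnergy Ω f E) :
    ∫⁻ Q in Ω, ‖kip α P f Q‖ₑ ^ 2 ≤ kipBound n (Metric.diam Ω) α * E := by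
  have m := stronglyMeasurable_integral_section (measurable_kipDil (α := α) (P := P) hf)
  calc ∫⁻ Q in Ω, ‖kip α P f Q‖ₑ ^ 2
      ≤ ∫⁻ Q in Ω, 4 * (ENNReal.ofReal ((α / Real.Gamma (1 - α)) ^ 2) *
          (∫⁻ s in Set.Ioo (0 : ℝ) 1, ‖kipDil α P f s Q‖ₑ) ^ 2 +
          ENNReal.ofReal (kipConst n α ^ 2) * ‖dist P Q ^ (-α) • f Q‖ₑ ^ 2) := by
        refine setLIntegral_mono' hopen.measurableSet fun Q hQ => ?_
        rw [kip_eq (dist_pos_of_mem hopen hP hQ)]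
        refine (enorm_add_sq_le _ _).trans ?_
        rw [enorm_smul_sq, enorm_smul_sq (kipConst n α)]
        gcongr
        exact enorm_integral_le_lintegral_enorm _
    _ = 4 * (ENNReal.ofReal ((α / Real.Gamma (1 - α)) ^ 2) *
          (∫⁻ Q in Ω, (∫⁻ s in Set.Ioo (0 : ℝ) 1, ‖kipDil α P f s Q‖ₑ) ^ 2) +
          ENNReal.ofReal (kipConst n α ^ 2) * ∫⁻ Q in Ω, ‖dist P Q ^ (-α) • f Q‖ₑ ^ 2) := by
        rw [lintegral_const_mul' _ _ (by norm_num), lintegral_add_right _ (by fun_prop),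
          lintegral_const_mul' _ _ ENNReal.ofReal_ne_top,
          lintegral_const_mul' _ _ ENNReal.ofReal_ne_top]
    _ ≤ 4 * (ENNReal.ofReal ((α / Real.Gamma (1 - α)) ^ 2) *
          (kipNorm (Metric.diam Ω) α ^ 2 * E) +
          ENNReal.ofReal (kipConst n α ^ 2) *
          (ENNReal.ofReal (4 * (Metric.diam Ω ^ (1 - α)) ^ 2) * E)) := by
        gcongr
        · exact lintegral_sq_lintegral_kipDil_le hopen hbdd hP h1 hf h
        · exact h.lintegral_rpow_smul_sq_le hopen hconv hbdd hP h1
    _ = _ := by unfold kipBound; ring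

theorem aestronglyMeasurable_kip {Ω : Set (Space n)} (hopen : IsOpen Ω) {P : Space n}
    (hP : P ∈ frontier Ω) {α : ℝ} {f : Space n → ℂ} (hf : Measurable f) :
    AEStronglyMeasurable (kip α P f) (volume.restrict Ω) := by
  have m := (stronglyMeasurable_integral_section
    (measurable_kipDil (α := α) (P := P) hf)).measurable
  refine AEStronglyMeasurable.congr (f := fun Q => (α / Real.Gamma (1 - α)) •
    (∫ s in Set.Ioo (0 : ℝ) 1, kipDil α P f s Q) + kipConst n α • (dist P Q ^ (-α) • f Q)) ?_ ?_
  · exact (by fun_prop : Measurable _).aestronglyMeasurable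
  · exact (ae_restrict_iff' hopen.measurableSet).2 (Eventually.of_forall fun Q hQ =>
      (kip_eq (dist_pos_of_mem hopen hP hQ) f).symm)

/-- Increments outward along the rays. Near `s = 1` they are bounded by the energy, away from
`s = 1` both terms are bounded by Hardy's inequality. The Jacobian leaves the power
`s^{n - 2α}`, which is replaced by one that is valid for all `n ≥ 1` and becomes, after
multiplication by `s^{2(α - 1)}`, the square of an integrable function. -/
theorem HasEnergy.lintegral_sub_dil_inv_sq_le {Ω : Set (Space n)} (hopen : IsOpen Ω)
    (hconv : Convex ℝ Ω) (hbdd : Bornology.IsBounded Ω) {P : Space n} (hP : P ∈ frontier Ω)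
    {α : ℝ} (h1 : α < 1) {u : Space n → ℂ} (hu : Measurable u) (hu0 : ∀ Q ∉ Ω, u Q = 0)
    {E : ℝ≥0∞} (h : HasEnergy Ω u E) {s : ℝ} (hs : s ∈ Set.Ioo (0 : ℝ) 1) :
    ∫⁻ Q in Ω, ‖dist P Q ^ (-α) • (u Q - u (dil P s⁻¹ Q))‖ₑ ^ 2 ≤
      ENNReal.ofReal (128 * (Metric.diam Ω ^ (1 - α)) ^ 2 * (1 - s) ^ 2 *
        s ^ (2 * (min α (1 / 2) - α))) * E := by
  have p0 : 0 < s := hs.1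
  have p1 : 0 < 1 - s := sub_pos.2 hs.2
  have hn := one_le_of_mem_frontier hP
  set d := Metric.diam Ω
  have hd : 0 ≤ d := Metric.diam_nonneg
  set β := min α (1 / 2)
  have hβ : β ≤ α := min_le_left _ _
  have hβ' : β ≤ 1 / 2 := min_le_right _ _
  have w1 : 1 ≤ s ^ (2 * (β - α)) :=
    Real.one_le_rpow_of_pos_of_le_one_of_nonpos p0 hs.2.le (by linarith)
  rcases le_total (1 / 2) s with hs2 | hs2
  · have hi : 1 < s⁻¹ := (one_lt_inv₀ p0).2 hs.2
    have hA : ∀ σ ∈ Set.uIoc s⁻¹ 1, (σ ^ n)⁻¹ ≤ 1 := fun σ hσ => by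
      rw [Set.uIoc_of_ge hi.le] at hσ
      exact inv_le_one_of_one_le₀ (one_le_pow₀ hσ.1.le)
    refine (Kipriyanov.lintegral_rpow_smul_sq_le hopen hbdd hP h1 _).trans ?_
    calc _ ≤ ENNReal.ofReal ((d ^ (1 - α)) ^ 2) * (ENNReal.ofReal (|1 - s⁻¹| ^ 2 * 1) * E) := by
          gcongr
          exact h.lintegral_sub_dil_sq_le P (inv_pos.2 p0) hA
      _ = ENNReal.ofReal ((d ^ (1 - α)) ^ 2 * |1 - s⁻¹| ^ 2) * E := by
          rw [mul_one, ← mul_assoc, ENNReal.ofReal_mul (by positivity)]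
      _ ≤ _ := by
          gcongr ENNReal.ofReal ?_ * E
          have : |1 - s⁻¹| ≤ 2 * (1 - s) := by
            rw [abs_sub_comm, abs_of_pos (by linarith), show s⁻¹ - 1 = (1 - s) * s⁻¹ by field_simp,
              mul_comm 2]
            gcongr
            rw [inv_le_comm₀ p0 (by norm_num)]
            linarith
          calc (d ^ (1 - α)) ^ 2 * |1 - s⁻¹| ^ 2
              ≤ (d ^ (1 - α)) ^ 2 * (2 * (1 - s)) ^ 2 := by gcongr
            _ = 4 * (d ^ (1 - α)) ^ 2 * (1 - s) ^ 2 * 1 := by ring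
            _ ≤ _ := by gcongr; norm_num
  · set H := ENNReal.ofReal (4 * (d ^ (1 - α)) ^ 2) * E
    have b1 := h.lintegral_rpow_smul_sq_le hopen hconv hbdd hP h1
    have b2 : ∫⁻ Q in Ω, ‖dist P Q ^ (-α) • u (dil P s⁻¹ Q)‖ₑ ^ 2 ≤
        ENNReal.ofReal (s ^ (2 * (β - α))) * H := by
      have e1 : ∀ Q, ‖dist P Q ^ (-α) • u (dil P s⁻¹ Q)‖ₑ ^ 2 =
          ENNReal.ofReal ((s ^ (-α)) ^ 2) *
            ‖dist P (dil P s⁻¹ Q) ^ (-α) • u (dil P s⁻¹ Q)‖ₑ ^ 2 := fun Q => by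
        rw [← enorm_smul_sq, smul_smul, dist_dil _ _ (inv_pos.2 p0).le,
          ← Real.mul_rpow p0.le (by positivity), mul_inv_cancel_left₀ p0.ne']
      calc ∫⁻ Q in Ω, ‖dist P Q ^ (-α) • u (dil P s⁻¹ Q)‖ₑ ^ 2
          ≤ ∫⁻ Q, ‖dist P Q ^ (-α) • u (dil P s⁻¹ Q)‖ₑ ^ 2 := setLIntegral_le_lintegral _ _
        _ = ENNReal.ofReal ((s ^ (-α)) ^ 2) * (ENNReal.ofReal ((s⁻¹ ^ n)⁻¹) *
              ∫⁻ Q, ‖dist P Q ^ (-α) • u Q‖ₑ ^ 2) := by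
            simp only [e1]
            rw [lintegral_const_mul' _ _ ENNReal.ofReal_ne_top,
              lintegral_comp_dil P (inv_pos.2 p0) fun Q => ‖dist P Q ^ (-α) • u Q‖ₑ ^ 2]
        _ = ENNReal.ofReal ((s ^ (-α)) ^ 2) * (ENNReal.ofReal ((s⁻¹ ^ n)⁻¹) *
              ∫⁻ Q in Ω, ‖dist P Q ^ (-α) • u Q‖ₑ ^ 2) := by
            congr 2
            refine (setLIntegral_eq_of_support_subset fun Q hQ => ?_).symm
            by_contra hQ'
            exact hQ (by simp [hu0 Q hQ'])
        _ ≤ ENNReal.ofReal ((s ^ (-α)) ^ 2) * (ENNReal.ofReal ((s⁻¹ ^ n)⁻¹) * H) := by gcongr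
        _ = ENNReal.ofReal ((s ^ (-α)) ^ 2 * (s⁻¹ ^ n)⁻¹) * H := by
            rw [← mul_assoc, ENNReal.ofReal_mul (by positivity)]
        _ ≤ _ := by
            gcongr
            rw [inv_pow, inv_inv, ← Real.rpow_natCast, ← Real.rpow_natCast, ← Real.rpow_mul p0.le,
              ← Real.rpow_add p0]
            refine Real.rpow_le_rpow_of_exponent_ge p0 hs.2.le ?_
            have : (1 : ℝ) ≤ n := by exact_mod_cast hn
            push_cast
            linarith
    calc ∫⁻ Q in Ω, ‖dist P Q ^ (-α) • (u Q - u (dil P s⁻¹ Q))‖ₑ ^ 2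
        ≤ ∫⁻ Q in Ω, 4 * (‖dist P Q ^ (-α) • u Q‖ₑ ^ 2 +
          ‖dist P Q ^ (-α) • u (dil P s⁻¹ Q)‖ₑ ^ 2) := by
          refine lintegral_mono fun Q => ?_
          rw [smul_sub, sub_eq_add_neg]
          refine (enorm_add_sq_le _ _).trans ?_
          rw [enorm_neg]
      _ ≤ 4 * (H + ENNReal.ofReal (s ^ (2 * (β - α))) * H) := by
          rw [lintegral_const_mul' _ _ (by norm_num), lintegral_add_left (by fun_prop)]
          gcongr
      _ = ENNReal.ofReal (4 * (1 + s ^ (2 * (β - α))) * (4 * (d ^ (1 - α)) ^ 2)) * E := by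
          rw [ENNReal.ofReal_mul (by positivity), ENNReal.ofReal_mul (by norm_num),
            ENNReal.ofReal_add (by norm_num) (by positivity)]
          simp only [ENNReal.ofReal_one, ENNReal.ofReal_ofNat, H]
          ring
      _ ≤ _ := by
          gcongr ENNReal.ofReal ?_ * E
          have : 1 ≤ 4 * (1 - s) ^ 2 := by nlinarith
          calc 4 * (1 + s ^ (2 * (β - α))) * (4 * (d ^ (1 - α)) ^ 2)
              ≤ 4 * (s ^ (2 * (β - α)) + s ^ (2 * (β - α))) * (4 * (d ^ (1 - α)) ^ 2) := by gcongr
            _ = 32 * (d ^ (1 - α)) ^ 2 * 1 * s ^ (2 * (β - α)) := by ring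
            _ ≤ 32 * (d ^ (1 - α)) ^ 2 * (4 * (1 - s) ^ 2) * s ^ (2 * (β - α)) := by gcongr
            _ = _ := by ring

/-! ### The right-side derivative of a product with a Hölder continuous function -/

/-- The increments of `ρ` outward along the rays are controlled by the Hölder condition, where
`u` does not vanish. -/
theorem lintegral_sub_smul_dil_inv_sq_le {Ω : Set (Space n)} (hopen : IsOpen Ω)
    (hbdd : Bornology.IsBounded Ω) {P : Space n} (hP : P ∈ frontier Ω)
    {α lam M : ℝ} (hlam : α < lam) (hM : 0 ≤ M) {ρ : Space n → ℝ} (hρ : IsLip Ω lam M ρ)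
    {u : Space n → ℂ} (hu0 : ∀ Q ∉ Ω, u Q = 0) {s : ℝ} (hs : s ∈ Set.Ioo (0 : ℝ) 1) :
    ∫⁻ Q in Ω, ‖(dist P Q ^ (-α) * (ρ Q - ρ (dil P s⁻¹ Q))) • u (dil P s⁻¹ Q)‖ₑ ^ 2 ≤
      ENNReal.ofReal ((M * Metric.diam Ω ^ (lam - α)) ^ 2 * ((1 - s) ^ lam) ^ 2 *
        s ^ (2 * (min α (1 / 2) - α))) * ∫⁻ Q, ‖u Q‖ₑ ^ 2 := by
  have p0 : 0 < s := hs.1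
  have p1 : 0 < 1 - s := sub_pos.2 hs.2
  have hn := one_le_of_mem_frontier hP
  have hn' : (1 : ℝ) ≤ n := by exact_mod_cast hn
  set d := Metric.diam Ω
  have hd : 0 ≤ d := Metric.diam_nonneg
  set K := M * d ^ (lam - α) * s ^ (-α) * (1 - s) ^ lam with hK
  have key : ∀ Q ∈ Ω, ‖(dist P Q ^ (-α) * (ρ Q - ρ (dil P s⁻¹ Q))) • u (dil P s⁻¹ Q)‖ₑ ^ 2 ≤
      ENNReal.ofReal (K ^ 2) * ‖u (dil P s⁻¹ Q)‖ₑ ^ 2 := by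
    intro Q hQ
    by_cases hT : dil P s⁻¹ Q ∈ Ω
    · rw [enorm_smul_sq]
      gcongr ENNReal.ofReal ?_ * _
      have hr : 0 < dist P Q := dist_pos_of_mem hopen hP hQ
      have hr' : dist P Q ≤ s * d := by
        have := dist_le_diam hbdd hP hT
        rwa [dist_dil _ _ (inv_pos.2 p0).le, inv_mul_le_iff₀ p0] at this
      have b1 := hρ Q (subset_closure hQ) _ (subset_closure hT)
      rw [dist_dil_self, abs_sub_comm 1, abs_of_pos (sub_pos.2 ((one_lt_inv₀ p0).2 hs.2)),
        show s⁻¹ - 1 = (1 - s) * s⁻¹ by field_simp, Real.mul_rpow (by positivity) hr.le,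
        Real.mul_rpow p1.le (by positivity), Real.inv_rpow p0.le] at b1
      have b2 : dist P Q ^ (lam - α) ≤ s ^ (lam - α) * d ^ (lam - α) := by
        rw [← Real.mul_rpow p0.le hd]
        exact Real.rpow_le_rpow hr.le hr' (by linarith)
      have b3 : |dist P Q ^ (-α) * (ρ Q - ρ (dil P s⁻¹ Q))| ≤ K := by
        rw [abs_mul, abs_of_pos (by positivity)]
        calc dist P Q ^ (-α) * |ρ Q - ρ (dil P s⁻¹ Q)|
            ≤ dist P Q ^ (-α) * (M * ((1 - s) ^ lam * (s ^ lam)⁻¹ * dist P Q ^ lam)) := by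
              gcongr
          _ = M * (1 - s) ^ lam * (s ^ lam)⁻¹ * dist P Q ^ (lam - α) := by
              rw [show lam - α = -α + lam by ring, Real.rpow_add hr]; ring
          _ ≤ M * (1 - s) ^ lam * (s ^ lam)⁻¹ * (s ^ (lam - α) * d ^ (lam - α)) := by gcongr
          _ = K := by
              rw [hK, show s ^ (-α) = (s ^ lam)⁻¹ * s ^ (lam - α) by
                rw [← Real.rpow_neg p0.le, ← Real.rpow_add p0]; congr 1; ring]
              ring
      rw [← sq_abs]
      exact pow_le_pow_left₀ (abs_nonneg _) b3 2
    -- the Hölder condition is void for points beyond `Ω`, but there `u` vanishes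
    · simp [hu0 _ hT]
  calc _ ≤ ∫⁻ Q in Ω, ENNReal.ofReal (K ^ 2) * ‖u (dil P s⁻¹ Q)‖ₑ ^ 2 :=
        setLIntegral_mono' hopen.measurableSet key
    _ ≤ ∫⁻ Q, ENNReal.ofReal (K ^ 2) * ‖u (dil P s⁻¹ Q)‖ₑ ^ 2 := setLIntegral_le_lintegral _ _
    _ = ENNReal.ofReal (K ^ 2) * (ENNReal.ofReal (s⁻¹ ^ n)⁻¹ * ∫⁻ Q, ‖u Q‖ₑ ^ 2) := by
        rw [lintegral_const_mul' _ _ ENNReal.ofReal_ne_top,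
          lintegral_comp_dil P (inv_pos.2 p0) fun Q => ‖u Q‖ₑ ^ 2]
    _ = ENNReal.ofReal (K ^ 2 * (s⁻¹ ^ n)⁻¹) * ∫⁻ Q, ‖u Q‖ₑ ^ 2 := by
        rw [ENNReal.ofReal_mul (by positivity), mul_assoc]
    _ ≤ _ := by
        gcongr ENNReal.ofReal ?_ * _
        have : (s ^ (-α)) ^ 2 * (s⁻¹ ^ n)⁻¹ ≤ s ^ (2 * (min α (1 / 2) - α)) := by
          rw [inv_pow, inv_inv, ← Real.rpow_natCast, ← Real.rpow_natCast, ← Real.rpow_mul p0.le,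
            ← Real.rpow_add p0]
          refine Real.rpow_le_rpow_of_exponent_ge p0 hs.2.le ?_
          have := min_le_right α (1 / 2)
          push_cast
          linarith
        calc K ^ 2 * (s⁻¹ ^ n)⁻¹ = (M * d ^ (lam - α)) ^ 2 * ((1 - s) ^ lam) ^ 2 *
              ((s ^ (-α)) ^ 2 * (s⁻¹ ^ n)⁻¹) := by rw [hK]; ring
          _ ≤ _ := by gcongr

/-- The integral that defines `𝔇^α_{d-} (ρ u)` converges absolutely to an element of `L₂(Ω)`, by
`ρ(Q) u(Q) - ρ(T) u(T) = ρ(Q) (u(Q) - u(T)) + (ρ(Q) - ρ(T)) u(T)`. -/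
theorem lintegral_sq_lintegral_rightDil_lt_top {Ω : Set (Space n)} (hopen : IsOpen Ω)
    (hconv : Convex ℝ Ω) (hbdd : Bornology.IsBounded Ω) {P : Space n} (hP : P ∈ frontier Ω)
    {α lam M : ℝ} (h0 : 0 < α) (h1 : α < 1) (hlam : α < lam) (hlam1 : lam ≤ 1) (hM : 0 ≤ M)
    {ρ : Space n → ℝ} (hρ : IsLip Ω lam M ρ) {ρ₁ : ℝ} (hρ1 : ∀ Q ∈ Ω, |ρ Q| ≤ ρ₁)
    {u : Space n → ℂ} (hu : Measurable u) (hu0 : ∀ Q ∉ Ω, u Q = 0)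
    (hρu : Measurable fun Q => ρ Q • u Q)
    {E : ℝ≥0∞} (h : HasEnergy Ω u E) (hE : E < ⊤) (hu2 : ∫⁻ Q, ‖u Q‖ₑ ^ 2 < ⊤) :
    ∫⁻ Q in Ω, (∫⁻ s in Set.Ioo (0 : ℝ) 1, ‖rightDil α P (fun Q => ρ Q • u Q) s Q‖ₑ) ^ 2 < ⊤ := by
  set d := Metric.diam Ω
  have hd : 0 ≤ d := Metric.diam_nonneg
  set β := min α (1 / 2) with hβ
  have hβ0 : 0 < β := lt_min h0 (by norm_num)
  set B₁ : ℝ := ρ₁ ^ 2 * (128 * (d ^ (1 - α)) ^ 2)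
  set B₂ : ℝ := (M * d ^ (lam - α)) ^ 2
  set B : ℝ≥0∞ := 4 * (ENNReal.ofReal B₁ * E + ENNReal.ofReal B₂ * ∫⁻ Q, ‖u Q‖ₑ ^ 2) with hB
  set c : ℝ → ℝ := fun s => s ^ (β - 1) * (1 - s) ^ ((lam - α) - 1) with hc
  have hcpos : ∀ s ∈ Set.Ioo (0 : ℝ) 1, 0 < c s := fun s hs => by
    have p0 : 0 < s := hs.1
    have p1 : 0 < 1 - s := sub_pos.2 hs.2
    simp only [hc]; positivity
  have hsec : ∀ s ∈ Set.Ioo (0 : ℝ) 1, ∫⁻ Q in Ω, ‖rightDil α P (fun Q => ρ Q • u Q) s Q‖ₑ ^ 2 ≤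
      ENNReal.ofReal (c s) ^ 2 * B := by
    intro s hs
    have p0 : 0 < s := hs.1
    have p1 : 0 < 1 - s := sub_pos.2 hs.2
    set W := s ^ (α - 1) * (1 - s) ^ (-α - 1) with hW
    have e1 : ∀ Q ∈ Ω, ‖rightDil α P (fun Q => ρ Q • u Q) s Q‖ₑ ^ 2 ≤ ENNReal.ofReal (W ^ 2) *
        (4 * (ENNReal.ofReal (ρ₁ ^ 2) * ‖dist P Q ^ (-α) • (u Q - u (dil P s⁻¹ Q))‖ₑ ^ 2 +
          ‖(dist P Q ^ (-α) * (ρ Q - ρ (dil P s⁻¹ Q))) • u (dil P s⁻¹ Q)‖ₑ ^ 2)) := by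
      intro Q hQ
      have e : rightDil α P (fun Q => ρ Q • u Q) s Q = W • (
          ρ Q • (dist P Q ^ (-α) • (u Q - u (dil P s⁻¹ Q))) +
          (dist P Q ^ (-α) * (ρ Q - ρ (dil P s⁻¹ Q))) • u (dil P s⁻¹ Q)) := by
        rw [rightDil, ← hW]; module
      rw [e, enorm_smul_sq]
      gcongr
      refine (enorm_add_sq_le _ _).trans ?_
      rw [enorm_smul_sq (ρ Q)]
      gcongr 4 * (ENNReal.ofReal ?_ * _ + _)
      exact sq_le_sq' (by have := (abs_le.1 (hρ1 Q hQ)).1; linarith) (abs_le.1 (hρ1 Q hQ)).2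
    calc _ ≤ ∫⁻ Q in Ω, ENNReal.ofReal (W ^ 2) *
        (4 * (ENNReal.ofReal (ρ₁ ^ 2) * ‖dist P Q ^ (-α) • (u Q - u (dil P s⁻¹ Q))‖ₑ ^ 2 +
          ‖(dist P Q ^ (-α) * (ρ Q - ρ (dil P s⁻¹ Q))) • u (dil P s⁻¹ Q)‖ₑ ^ 2)) :=
          setLIntegral_mono' hopen.measurableSet e1
      _ = ENNReal.ofReal (W ^ 2) * (4 * (ENNReal.ofReal (ρ₁ ^ 2) *
            (∫⁻ Q in Ω, ‖dist P Q ^ (-α) • (u Q - u (dil P s⁻¹ Q))‖ₑ ^ 2) +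
            ∫⁻ Q in Ω, ‖(dist P Q ^ (-α) * (ρ Q - ρ (dil P s⁻¹ Q))) • u (dil P s⁻¹ Q)‖ₑ ^ 2)) := by
          have m : Measurable fun Q => u (dil P s⁻¹ Q) := hu.comp (by fun_prop)
          rw [lintegral_const_mul' _ _ ENNReal.ofReal_ne_top,
            lintegral_const_mul' _ _ (by norm_num), lintegral_add_left (by fun_prop),
            lintegral_const_mul' _ _ ENNReal.ofReal_ne_top]
      _ ≤ ENNReal.ofReal (W ^ 2) * (4 * (ENNReal.ofReal (ρ₁ ^ 2) *
            (ENNReal.ofReal (128 * (d ^ (1 - α)) ^ 2 * (1 - s) ^ 2 * s ^ (2 * (β - α))) * E) +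
            ENNReal.ofReal ((M * d ^ (lam - α)) ^ 2 * ((1 - s) ^ lam) ^ 2 *
              s ^ (2 * (β - α))) * ∫⁻ Q, ‖u Q‖ₑ ^ 2)) := by
          gcongr
          · exact h.lintegral_sub_dil_inv_sq_le hopen hconv hbdd hP h1 hu hu0 hs
          · exact lintegral_sub_smul_dil_inv_sq_le hopen hbdd hP hlam hM hρ hu0 hs
      _ = 4 * (ENNReal.ofReal (W ^ 2 * (ρ₁ ^ 2 *
            (128 * (d ^ (1 - α)) ^ 2 * (1 - s) ^ 2 * s ^ (2 * (β - α))))) * E +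
            ENNReal.ofReal (W ^ 2 * ((M * d ^ (lam - α)) ^ 2 * ((1 - s) ^ lam) ^ 2 *
              s ^ (2 * (β - α)))) * ∫⁻ Q, ‖u Q‖ₑ ^ 2) := by
          rw [ENNReal.ofReal_mul (p := W ^ 2) (by positivity),
            ENNReal.ofReal_mul (p := W ^ 2) (by positivity),
            ENNReal.ofReal_mul (p := ρ₁ ^ 2) (by positivity)]
          ring
      _ ≤ 4 * (ENNReal.ofReal (c s ^ 2 * B₁) * E +
            ENNReal.ofReal (c s ^ 2 * B₂) * ∫⁻ Q, ‖u Q‖ₑ ^ 2) := by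
          have t1 : W ^ 2 * s ^ (2 * (β - α)) * ((1 - s) ^ lam) ^ 2 = c s ^ 2 := by
            have a1 : s ^ (2 * (β - α)) = (s ^ (β - α)) ^ 2 := by
              rw [← Real.rpow_natCast, ← Real.rpow_mul p0.le]; congr 1; push_cast; ring
            rw [a1, ← mul_pow, ← mul_pow]
            congr 1
            simp only [hc, hW]
            rw [show β - 1 = (α - 1) + (β - α) by ring, Real.rpow_add p0,
              show (lam - α) - 1 = (-α - 1) + lam by ring, Real.rpow_add p1]
            ring
          have t2 : (1 - s) ≤ (1 - s) ^ lam := by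
            conv_lhs => rw [← Real.rpow_one (1 - s)]
            exact Real.rpow_le_rpow_of_exponent_ge p1 (by linarith) hlam1
          gcongr 4 * (ENNReal.ofReal ?_ * _ + ENNReal.ofReal ?_ * _)
          · calc _ = W ^ 2 * s ^ (2 * (β - α)) * (1 - s) ^ 2 * B₁ := by simp only [B₁]; ring
              _ ≤ W ^ 2 * s ^ (2 * (β - α)) * ((1 - s) ^ lam) ^ 2 * B₁ := by
                have : 0 ≤ B₁ := by positivity
                gcongr
              _ = _ := by rw [t1]
          · rw [← t1]; simp only [B₂]
            exact le_of_eq (by ring)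
      _ = _ := by
          rw [hB, ENNReal.ofReal_mul (p := c s ^ 2) (by positivity),
            ENNReal.ofReal_mul (p := c s ^ 2) (by positivity),
            ENNReal.ofReal_pow (hcpos s hs).le]
          ring
  have hmink := lintegral_sq_lintegral_le (μ := volume.restrict (Set.Ioo (0 : ℝ) 1))
    (ν := volume.restrict Ω) (F := fun s Q => ‖rightDil α P (fun Q => ρ Q • u Q) s Q‖ₑ)
    (c := fun s => ENNReal.ofReal (c s)) (B := B) (measurable_rightDil hρu).enorm
    (by fun_prop) ((ae_restrict_iff' measurableSet_Ioo).2 (Eventually.of_forall fun s hs => by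
      simpa using hcpos s hs)) (Eventually.of_forall fun s => ENNReal.ofReal_ne_top)
    ((ae_restrict_iff' measurableSet_Ioo).2 (Eventually.of_forall hsec))
  refine hmink.trans_lt ?_
  have hcI := (integrableOn_beta hβ0 (sub_pos.2 hlam)).lintegral_lt_top
  have hBt : B < ⊤ := by rw [hB]; finiteness
  exact ENNReal.mul_lt_top (ENNReal.pow_lt_top hcI) hBt

/-! ### The truncated derivatives -/

theorem ray_eq_dil (P Q : Space n) (t : ℝ) :
    ray P Q t = dil P (t / dist P Q) Q := rfl

theorem ray_dist {P Q : Space n} (hr : 0 < dist P Q) : ray P Q (dist P Q) = Q := by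
  rw [ray, div_self hr.ne']; simp

theorem bddAbove_ray {Ω : Set (Space n)} (hbdd : Bornology.IsBounded Ω) {P Q : Space n}
    (hP : P ∈ frontier Ω) (hr : 0 < dist P Q) : BddAbove {t : ℝ | ray P Q t ∈ Ω} := by
  refine ⟨Metric.diam Ω, fun t ht => ?_⟩
  by_contra hlt
  rw [not_le] at hlt
  have ht0 : 0 < t := Metric.diam_nonneg.trans_lt hlt
  have := dist_le_diam hbdd hP ht
  rw [ray_eq_dil P Q, dist_dil _ _ (by positivity), div_mul_cancel₀ _ hr.ne'] at this
  linarith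

theorem dist_lt_rayLength {Ω : Set (Space n)} (hopen : IsOpen Ω)
    (hbdd : Bornology.IsBounded Ω) {P Q : Space n} (hP : P ∈ frontier Ω) (hQ : Q ∈ Ω) :
    dist P Q < rayLength Ω P Q := by
  have hr := dist_pos_of_mem hopen hP hQ
  have hc : Continuous fun t => ray P Q t := by unfold ray; fun_prop
  have ho : IsOpen {t : ℝ | ray P Q t ∈ Ω} := hopen.preimage hc
  have hm : dist P Q ∈ {t : ℝ | ray P Q t ∈ Ω} := by
    change ray P Q (dist P Q) ∈ Ω
    rwa [ray_dist hr]
  obtain ⟨ε, hε, hb⟩ := Metric.isOpen_iff.1 ho _ hm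
  have : dist P Q + ε / 2 ∈ {t : ℝ | ray P Q t ∈ Ω} := hb (by
    rw [Metric.mem_ball, Real.dist_eq]; simp only [add_sub_cancel_left]
    rw [abs_of_pos (by positivity)]; linarith)
  have := le_csSup (bddAbove_ray hbdd hP hr) this
  rw [rayLength]
  linarith

theorem rayLength_le_diam {Ω : Set (Space n)} (hopen : IsOpen Ω)
    (hbdd : Bornology.IsBounded Ω) {P Q : Space n} (hP : P ∈ frontier Ω) (hQ : Q ∈ Ω) :
    rayLength Ω P Q ≤ Metric.diam Ω := by
  have hr := dist_pos_of_mem hopen hP hQ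
  refine csSup_le ⟨dist P Q, by change ray P Q (dist P Q) ∈ Ω; rwa [ray_dist hr]⟩ fun t ht => ?_
  by_contra hlt
  rw [not_le] at hlt
  have ht0 : 0 < t := Metric.diam_nonneg.trans_lt hlt
  have := dist_le_diam hbdd hP ht
  rw [ray_eq_dil P Q, dist_dil _ _ (by positivity), div_mul_cancel₀ _ hr.ne'] at this
  linarith

theorem ray_notMem {Ω : Set (Space n)} (hbdd : Bornology.IsBounded Ω) {P Q : Space n}
    (hP : P ∈ frontier Ω) (hr : 0 < dist P Q) {t : ℝ} (ht : rayLength Ω P Q < t) :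
    ray P Q t ∉ Ω := fun h =>
  (le_csSup (bddAbove_ray hbdd hP hr) h).not_gt ht

theorem ray_mem {Ω : Set (Space n)} (hopen : IsOpen Ω) (hconv : Convex ℝ Ω) {P Q : Space n}
    (hP : P ∈ frontier Ω) (hQ : Q ∈ Ω) {t : ℝ} (h0 : 0 < t) (ht : t < rayLength Ω P Q) :
    ray P Q t ∈ Ω := by
  have hr := dist_pos_of_mem hopen hP hQ
  obtain ⟨t', ht', hlt⟩ := exists_lt_of_lt_csSup
    ⟨dist P Q, by change ray P Q (dist P Q) ∈ Ω; rwa [ray_dist hr]⟩ ht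
  have h0' : 0 < t' := h0.trans hlt
  have := dil_mem hopen hconv hP.1 ht' (s := t / t') (by positivity)
    ((div_le_one h0').2 hlt.le)
  rw [ray_eq_dil P Q, dil_dil] at this
  rw [ray_eq_dil P Q]
  convert this using 2
  field_simp

/-- Beyond the end of the ray within `Ω` the integrand of `𝔇^α_{d-}` is a power. -/
theorem integral_Ioi_rightIntegrand {Ω : Set (Space n)} (hbdd : Bornology.IsBounded Ω)
    {P Q : Space n} (hP : P ∈ frontier Ω) (hr : 0 < dist P Q) {α : ℝ} (h0 : 0 < α)
    {f : Space n → ℂ} (hf : ∀ Q ∉ Ω, f Q = 0) {b : ℝ} (hb : rayLength Ω P Q ≤ b)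
    (hb' : dist P Q < b) :
    IntegrableOn (rightIntegrand α P f Q) (Set.Ioi b) ∧
    ∫ t in Set.Ioi b, rightIntegrand α P f Q t = ((b - dist P Q) ^ (-α) / α) • f Q := by
  have e1 : Set.EqOn (rightIntegrand α P f Q) (fun t => ((t - dist P Q) ^ (-α - 1)) • f Q)
      (Set.Ioi b) := by
    intro t ht
    have ht' : b < t := ht
    simp only [rightIntegrand]
    rw [hf _ (ray_notMem hbdd hP hr (hb.trans_lt ht')), sub_zero, one_div,
      ← Real.rpow_neg (by linarith), neg_add']
  have he : (fun t => t - dist P Q) ⁻¹' Set.Ioi (b - dist P Q) = Set.Ioi b := by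
    ext t; simp
  have hI : IntegrableOn (fun t : ℝ => (t - dist P Q) ^ (-α - 1)) (Set.Ioi b) := by
    have := integrableOn_Ioi_rpow_of_lt (a := -α - 1) (by linarith) (sub_pos.2 hb')
    rw [← he]
    exact ((measurePreserving_sub_right volume (dist P Q)).integrableOn_comp_preimage
      (MeasurableEquiv.subRight (dist P Q)).measurableEmbedding).2 this
  constructor
  · exact (IntegrableOn.congr_fun (hI.smul_const (f Q)) e1.symm measurableSet_Ioi)
  · rw [setIntegral_congr_fun measurableSet_Ioi e1, integral_smul_const]
    have h3 := (measurePreserving_sub_right volume (dist P Q)).setIntegral_preimage_emb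
      (MeasurableEquiv.subRight (dist P Q)).measurableEmbedding (fun t : ℝ => t ^ (-α - 1))
      (Set.Ioi (b - dist P Q))
    rw [he] at h3
    rw [h3, integral_Ioi_rpow_of_lt (by linarith) (sub_pos.2 hb'), show -α - 1 + 1 = -α by ring,
      neg_div_neg_eq]

/-- The value of `𝔇^α_{d-} f` for `f` vanishing off `Ω`, as one absolutely convergent integral. -/
def rightD (α : ℝ) (P : Space n) (f : Space n → ℂ) (Q : Space n) : ℂ :=
  (α / Real.Gamma (1 - α)) • ∫ s in Set.Ioo (0 : ℝ) 1, rightDil α P f s Q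

/-- Both branches of the truncated derivative are one integral over `(r + ε, ∞)`, because `f`
vanishes on the part of the ray beyond `Ω`. -/
theorem rightTrunc_eq {Ω : Set (Space n)} (hopen : IsOpen Ω) (hbdd : Bornology.IsBounded Ω)
    {P Q : Space n} (hP : P ∈ frontier Ω) (hQ : Q ∈ Ω) {α : ℝ} (h0 : 0 < α)
    {f : Space n → ℂ} (hf : ∀ Q ∉ Ω, f Q = 0)
    (hI : IntegrableOn (rightIntegrand α P f Q) (Set.Ioi (dist P Q))) {ε : ℝ} (hε : 0 < ε) :
    rightTrunc Ω α P ε f Q =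
      (α / Real.Gamma (1 - α)) • ∫ t in Set.Ioi (dist P Q + ε), rightIntegrand α P f Q t := by
  have hr := dist_pos_of_mem hopen hP hQ
  have hL := dist_lt_rayLength hopen hbdd hP hQ
  have hLr : 0 < rayLength Ω P Q - dist P Q := sub_pos.2 hL
  rw [rightTrunc, rightPsi]
  split_ifs with hc
  · rw [← intervalIntegral.integral_interval_add_Ioi
      (hI.mono_set (Set.Ioi_subset_Ioi (by linarith)))
      (hI.mono_set (Set.Ioi_subset_Ioi hL.le)),
      (integral_Ioi_rightIntegrand hbdd hP hr h0 hf le_rfl hL).2, smul_add, smul_smul, add_comm]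
    congr 2
    field_simp
  · rw [(integral_Ioi_rightIntegrand hbdd hP hr h0 hf (by linarith) (by linarith)).2,
      smul_smul, smul_smul, ← add_smul, add_sub_cancel_left, Real.rpow_neg hLr.le,
      Real.rpow_neg hε.le]
    congr 1
    field_simp
    ring

/-- The integrand of the truncated derivative after the substitution `t = r / s`. -/
def truncDil (α : ℝ) (P : Space n) (ε : ℝ) (f : Space n → ℂ) (s : ℝ) (Q : Space n) : ℂ :=
  if dist P Q + ε < dist P Q / s then rightDil α P f s Q else 0

theorem measurable_truncDil {α : ℝ} {P : Space n} {ε : ℝ} {f : Space n → ℂ} (hf : Measurable f) :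
    Measurable (Function.uncurry (truncDil α P ε f)) := by
  have := measurable_rightDil (α := α) (P := P) hf
  unfold Function.uncurry truncDil
  refine Measurable.ite ?_ this measurable_const
  exact measurableSet_lt (by fun_prop) (by fun_prop)

theorem norm_truncDil_le (α : ℝ) (P : Space n) (ε : ℝ) (f : Space n → ℂ) (s : ℝ) (Q : Space n) :
    ‖truncDil α P ε f s Q‖ ≤ ‖rightDil α P f s Q‖ := by
  unfold truncDil
  split_ifs <;> simp

theorem integral_truncDil {α : ℝ} {P Q : Space n} (hr : 0 < dist P Q) (f : Space n → ℂ)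
    {ε : ℝ} (hε : 0 < ε) :
    ∫ t in Set.Ioi (dist P Q + ε), rightIntegrand α P f Q t =
      ∫ s in Set.Ioo (0 : ℝ) 1, truncDil α P ε f s Q := by
  have e : Set.Ioi (dist P Q + ε) = Set.Ioi (dist P Q) ∩ Set.Ioi (dist P Q + ε) :=
    (Set.inter_eq_right.2 (Set.Ioi_subset_Ioi (by linarith))).symm
  rw [e, ← setIntegral_indicator measurableSet_Ioi, ← image_div_Ioo hr,
    integral_image_eq_integral_abs_deriv_smul measurableSet_Ioo
      (fun s hs => hasDerivWithinAt_div_Ioo _ hs) (injOn_div_Ioo hr)]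
  refine setIntegral_congr_fun measurableSet_Ioo fun s hs => ?_
  simp only [truncDil, Set.indicator_apply, Set.mem_Ioi, smul_ite, smul_zero]
  rw [abs_smul_rightIntegrand hr f hs]

theorem tendsto_zero_of_sq {ι : Type*} {l : Filter ι} {x : ι → ℝ≥0∞}
    (h : Tendsto (fun i => x i ^ 2) l (𝓝 0)) : Tendsto x l (𝓝 0) := by
  have h2 := (ENNReal.continuous_rpow_const (y := (1 / 2 : ℝ))).tendsto 0 |>.comp h
  rw [ENNReal.zero_rpow_of_pos (by norm_num)] at h2
  refine h2.congr fun i => ?_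
  simp only [Function.comp_apply]
  rw [← ENNReal.rpow_natCast, ← ENNReal.rpow_mul]
  norm_num

/-- If the absolute value of the integrand of `𝔇^α_{d-} f` has an integral in `L₂(Ω)`, then the
truncated derivatives converge by dominated convergence. -/
theorem isRightDeriv_rightD {Ω : Set (Space n)} (hopen : IsOpen Ω) (hbdd : Bornology.IsBounded Ω)
    {P : Space n} (hP : P ∈ frontier Ω) {α : ℝ} (h0 : 0 < α)
    {f : Space n → ℂ} (hfm : Measurable f) (hf : ∀ Q ∉ Ω, f Q = 0)
    (hfin : ∫⁻ Q in Ω, (∫⁻ s in Set.Ioo (0 : ℝ) 1, ‖rightDil α P f s Q‖ₑ) ^ 2 < ⊤) :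
    IsRightDeriv Ω α P f (rightD α P f) := by
  set c := α / Real.Gamma (1 - α) with hc
  set G : Space n → ℝ≥0∞ := fun Q => ∫⁻ s in Set.Ioo (0 : ℝ) 1, ‖rightDil α P f s Q‖ₑ with hG
  have hmem : ∀ᵐ Q ∂volume.restrict Ω, Q ∈ Ω := ae_restrict_mem hopen.measurableSet
  have hI := integrableOn_of_lintegral_sq_lintegral (measurable_rightDil (α := α) (P := P) hfm) hfin
  have hI' : ∀ᵐ Q ∂volume.restrict Ω,
      IntegrableOn (rightIntegrand α P f Q) (Set.Ioi (dist P Q)) := by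
    filter_upwards [hI, hmem] with Q h hQ
    exact (integrableOn_rightIntegrand (dist_pos_of_mem hopen hP hQ)).2 h
  have hT : ∀ ε : ℝ, 0 < ε → rightTrunc Ω α P ε f =ᵐ[volume.restrict Ω]
      fun Q => c • ∫ s in Set.Ioo (0 : ℝ) 1, truncDil α P ε f s Q := by
    intro ε hε
    filter_upwards [hI', hmem] with Q h hQ
    rw [rightTrunc_eq hopen hbdd hP hQ h0 hf h hε,
      integral_truncDil (dist_pos_of_mem hopen hP hQ) f hε]
  have hTm : ∀ ε : ℝ, AEStronglyMeasurable
      (fun Q => c • ∫ s in Set.Ioo (0 : ℝ) 1, truncDil α P ε f s Q) (volume.restrict Ω) := fun ε =>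
    ((stronglyMeasurable_integral_section
      (measurable_truncDil hfm)).const_smul c).aestronglyMeasurable
  have hDm : AEStronglyMeasurable (rightD α P f) (volume.restrict Ω) :=
    ((stronglyMeasurable_integral_section
      (measurable_rightDil hfm)).const_smul c).aestronglyMeasurable
  have hTb : ∀ ε Q, ‖c • ∫ s in Set.Ioo (0 : ℝ) 1, truncDil α P ε f s Q‖ₑ ≤ ‖c‖ₑ * G Q := by
    intro ε Q
    rw [enorm_smul]
    gcongr
    refine (enorm_integral_le_lintegral_enorm _).trans (lintegral_mono fun s => ?_)
    exact enorm_le_iff_norm_le.2 (norm_truncDil_le α P ε f s Q)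
  have hDb : ∀ Q, ‖rightD α P f Q‖ₑ ≤ ‖c‖ₑ * G Q := by
    intro Q
    rw [rightD, enorm_smul]
    gcongr
    exact enorm_integral_le_lintegral_enorm _
  have hL2 : ∀ g : Space n → ℂ, AEStronglyMeasurable g (volume.restrict Ω) →
      (∀ Q, ‖g Q‖ₑ ≤ ‖c‖ₑ * G Q) → MemLp g 2 (volume.restrict Ω) := by
    intro g hg hb
    refine memLp_two_of_lintegral_sq hg ?_
    calc _ ≤ ∫⁻ Q in Ω, ‖c‖ₑ ^ 2 * G Q ^ 2 := by
          refine lintegral_mono fun Q => ?_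
          rw [← mul_pow]
          gcongr
          exact hb Q
      _ < ⊤ := by
          rw [lintegral_const_mul' _ _ (by finiteness)]
          exact ENNReal.mul_lt_top (by finiteness) hfin
  refine ⟨fun ε hε => ?_, fun ε hε => ?_, hL2 _ hDm hDb, ?_⟩
  · filter_upwards [hI'] with Q h hle
    rw [intervalIntegrable_iff_integrableOn_Ioc_of_le (by linarith)]
    exact h.mono_set fun t ht => (by linarith [ht.1] : dist P Q < t)
  · exact (memLp_congr_ae (hT ε hε)).2 (hL2 _ (hTm ε) (hTb ε))
  · apply tendsto_zero_of_sq
    have hz : (0 : ℝ≥0∞) = ∫⁻ _ in Ω, (0 : ℝ≥0∞) := by simp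
    have hlim : Tendsto (fun ε => ∫⁻ Q in Ω,
        ‖(c • ∫ s in Set.Ioo (0 : ℝ) 1, truncDil α P ε f s Q) - rightD α P f Q‖ₑ ^ 2)
        (𝓝[>] 0) (𝓝 (∫⁻ _ in Ω, (0 : ℝ≥0∞))) := by
      refine tendsto_lintegral_filter_of_dominated_convergence'
        (fun Q => (2 * (‖c‖ₑ * G Q)) ^ 2) ?_ ?_ ?_ ?_
      · exact Eventually.of_forall fun ε => ((hTm ε).sub hDm).enorm.pow_const 2
      · refine Eventually.of_forall fun ε => Eventually.of_forall fun Q => ?_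
        gcongr
        refine (enorm_sub_le).trans ?_
        rw [two_mul]
        exact add_le_add (hTb ε Q) (hDb Q)
      · have : ∀ Q, (2 * (‖c‖ₑ * G Q)) ^ 2 = (2 * ‖c‖ₑ) ^ 2 * G Q ^ 2 := fun Q => by ring
        simp only [this]
        rw [lintegral_const_mul' _ _ (by finiteness)]
        exact (ENNReal.mul_lt_top (by finiteness) hfin).ne
      · filter_upwards [hI, hmem] with Q h hQ
        have hr := dist_pos_of_mem hopen hP hQ
        have t1 : Tendsto (fun ε => ∫ s in Set.Ioo (0 : ℝ) 1, truncDil α P ε f s Q) (𝓝[>] 0)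
            (𝓝 (∫ s in Set.Ioo (0 : ℝ) 1, rightDil α P f s Q)) := by
          refine tendsto_integral_filter_of_dominated_convergence
            (fun s => ‖rightDil α P f s Q‖) ?_ ?_ h.norm ?_
          · exact Eventually.of_forall fun ε => ((measurable_truncDil hfm).comp
              measurable_prodMk_right).aestronglyMeasurable
          · exact Eventually.of_forall fun ε => Eventually.of_forall fun s =>
              norm_truncDil_le α P ε f s Q
          · refine (ae_restrict_iff' measurableSet_Ioo).2 (Eventually.of_forall fun s hs => ?_)
            refine tendsto_const_nhds.congr' ?_
            have hlt : dist P Q < dist P Q / s := by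
              rw [lt_div_iff₀ hs.1]; nlinarith [hs.2]
            filter_upwards [Ioo_mem_nhdsGT (sub_pos.2 hlt)] with ε hε
            rw [truncDil, if_pos (by linarith [hε.2])]
        have t2 := (t1.const_smul c).sub_const (rightD α P f Q)
        rw [show c • ∫ s in Set.Ioo (0 : ℝ) 1, rightDil α P f s Q = rightD α P f Q from rfl,
          sub_self] at t2
        have t3 := ((ENNReal.continuous_pow 2).tendsto _).comp t2.enorm
        rw [enorm_zero, zero_pow two_ne_zero] at t3
        exact t3
    rw [← hz] at hlim
    refine hlim.congr' ?_
    filter_upwards [self_mem_nhdsWithin] with ε hε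
    rw [eLpNorm_two_sq]
    refine lintegral_congr_ae ?_
    filter_upwards [hT ε hε] with Q hQ
    rw [Pi.sub_apply, hQ]

/-! ### Fractional integration by parts -/

theorem integrable_mul_section {F : ℝ → Space n → ℂ} (hF : Measurable (Function.uncurry F))
    {v : Space n → ℂ} (hv : Measurable v)
    (h : ∫⁻ Q, ‖v Q‖ₑ * ∫⁻ s in Set.Ioo (0 : ℝ) 1, ‖F s Q‖ₑ < ⊤) :
    Integrable (fun p : Space n × ℝ => v p.1 * F p.2 p.1)
      ((volume : Measure (Space n)).prod (volume.restrict (Set.Ioo (0 : ℝ) 1))) := by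
  have m1 : Measurable fun p : Space n × ℝ => F p.2 p.1 := hF.comp measurable_swap
  have m2 : Measurable fun p : Space n × ℝ => v p.1 * F p.2 p.1 := (hv.comp measurable_fst).mul m1
  refine ⟨m2.aestronglyMeasurable, ?_⟩
  rw [HasFiniteIntegral, lintegral_prod _ m2.enorm.aemeasurable]
  refine lt_of_eq_of_lt (lintegral_congr fun Q => ?_) h
  simp only [enorm_mul]
  rw [lintegral_const_mul' _ _ enorm_ne_top]

/-- For a single dilation factor the two fractional derivatives are adjoint to each other up to
a multiple of `∫ r^{-α} f v`; this is the change of variables `Q ↦ s Q`. -/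
theorem integral_rightDil_sub_integral_kipDil {P : Space n} {α : ℝ} (hn : 1 ≤ n)
    {f v : Space n → ℂ} (hJ : Integrable fun Q => dist P Q ^ (-α) • (f Q * v Q)) {s : ℝ}
    (hs : s ∈ Set.Ioo (0 : ℝ) 1) (hR : Integrable fun Q => v Q * rightDil α P f s Q)
    (hK : Integrable fun Q => f Q * kipDil α P v s Q) :
    (∫ Q, v Q * rightDil α P f s Q) - ∫ Q, f Q * kipDil α P v s Q =
      ((s ^ (α - 1) - s ^ (n - 1)) * (1 - s) ^ (-α - 1)) •
        ∫ Q, dist P Q ^ (-α) • (f Q * v Q) := by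
  have p0 : 0 < s := hs.1
  have p1 : 0 < 1 - s := sub_pos.2 hs.2
  set w := (1 - s) ^ (-α - 1) with hw
  have hw0 : 0 < w := by positivity
  set J : Space n → ℂ := fun Q => dist P Q ^ (-α) • (f Q * v Q) with hJd
  set g₁ : Space n → ℂ := fun Q => dist P Q ^ (-α) • (f Q * v (dil P s Q)) with hg1
  set g₂ : Space n → ℂ := fun Q => dist P Q ^ (-α) • (v Q * f (dil P s⁻¹ Q)) with hg2
  have c1 : s ^ (α - 1) * w ≠ 0 := by positivity
  have c2 : s ^ (n - 1) * w ≠ 0 := by positivity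
  have e1 : ∀ Q, v Q * rightDil α P f s Q = (s ^ (α - 1) * w) • (J Q - g₂ Q) := fun Q => by
    simp only [rightDil, hJd, hg2, ← hw, Complex.real_smul]; push_cast; ring
  have e2 : ∀ Q, f Q * kipDil α P v s Q = (s ^ (n - 1) * w) • (J Q - g₁ Q) := fun Q => by
    simp only [kipDil, hJd, hg1, ← hw, Complex.real_smul]; push_cast; ring
  simp only [e1] at hR ⊢
  simp only [e2] at hK ⊢
  have i2 : Integrable g₂ := by
    have := hJ.sub ((integrable_smul_iff c1 _).1 hR)
    refine this.congr (Eventually.of_forall fun Q => ?_)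
    simp
  have i1 : Integrable g₁ := by
    have := hJ.sub ((integrable_smul_iff c2 _).1 hK)
    refine this.congr (Eventually.of_forall fun Q => ?_)
    simp
  have h12 : ∫ Q, g₁ Q = (s ^ α * (s ^ n)⁻¹) • ∫ Q, g₂ Q := by
    rw [mul_smul, ← integral_comp_dil P p0 g₂, ← integral_smul]
    refine integral_congr_ae (Eventually.of_forall fun Q => ?_)
    simp only [hg1, hg2]
    rw [dil_inv_dil P Q p0.ne', dist_dil P Q p0.le, Real.mul_rpow p0.le dist_nonneg, mul_smul,
      smul_smul, ← Real.rpow_add p0, add_neg_cancel, Real.rpow_zero, one_smul, mul_comm]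
  rw [integral_smul, integral_smul, integral_sub hJ i2, integral_sub hJ i1, h12]
  have h3 : s ^ (n - 1) * (s ^ α * (s ^ n)⁻¹) = s ^ (α - 1) := by
    obtain ⟨m, rfl⟩ : ∃ m, n = m + 1 := ⟨n - 1, by omega⟩
    rw [Real.rpow_sub_one p0.ne', Nat.add_sub_cancel, pow_succ]
    field_simp
  simp only [smul_sub, smul_smul]
  rw [show s ^ (n - 1) * w * (s ^ α * (s ^ n)⁻¹) = s ^ (α - 1) * w by rw [← h3]; ring]
  rw [sub_mul, sub_smul]
  abel

/-- Fractional integration by parts: `∫ v 𝔇^α_{d-} f = ∫ f 𝔇^α v` when everything converges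
absolutely. The constant `C_n^{(α)}` is exactly the regularized Beta integral that arises from
the dilations. At `Q = P` the formula for `𝔇^α` in terms of dilations degenerates, hence the
condition `f P = 0`. -/
theorem integral_mul_rightD_eq {P : Space n} {α : ℝ} (hn : 1 ≤ n) (h0 : 0 < α) (h1 : α < 1)
    {f v : Space n → ℂ} (hf : Measurable f) (hv : Measurable v) (hfP : f P = 0)
    (hJ : Integrable fun Q => dist P Q ^ (-α) • (f Q * v Q))
    (hR : ∫⁻ Q, ‖v Q‖ₑ * ∫⁻ s in Set.Ioo (0 : ℝ) 1, ‖rightDil α P f s Q‖ₑ < ⊤)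
    (hK : ∫⁻ Q, ‖f Q‖ₑ * ∫⁻ s in Set.Ioo (0 : ℝ) 1, ‖kipDil α P v s Q‖ₑ < ⊤) :
    ∫ Q, v Q * rightD α P f Q = ∫ Q, f Q * kip α P v Q := by
  have iR := integrable_mul_section (measurable_rightDil (α := α) (P := P) hf) hv hR
  have iK := integrable_mul_section (measurable_kipDil (α := α) (P := P) hv) hf hK
  set c := α / Real.Gamma (1 - α) with hc
  set J := ∫ Q, dist P Q ^ (-α) • (f Q * v Q) with hJd
  have eR : ∫ Q, v Q * rightD α P f Q =
      c • ∫ s in Set.Ioo (0 : ℝ) 1, ∫ Q, v Q * rightDil α P f s Q := by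
    rw [← integral_integral_swap (f := fun Q s => v Q * rightDil α P f s Q) iR, ← integral_smul]
    refine integral_congr_ae (Eventually.of_forall fun Q => ?_)
    simp only [rightD]
    rw [integral_const_mul, mul_smul_comm]
  have eK : ∫ Q, f Q * kip α P v Q =
      c • (∫ s in Set.Ioo (0 : ℝ) 1, ∫ Q, f Q * kipDil α P v s Q) + kipConst n α • J := by
    have h3 : ∀ Q, f Q * kip α P v Q = c • (∫ s in Set.Ioo (0 : ℝ) 1, f Q * kipDil α P v s Q) +
        kipConst n α • (dist P Q ^ (-α) • (f Q * v Q)) := by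
      intro Q
      rcases (dist_nonneg (x := P) (y := Q)).eq_or_lt with h | h
      · have : Q = P := (dist_eq_zero.1 h.symm).symm
        subst this
        simp [hfP]
      · rw [kip_eq h, integral_const_mul, mul_add, mul_smul_comm, mul_smul_comm, mul_smul_comm]
    simp only [h3]
    refine (integral_add (iK.integral_prod_left.smul c) (hJ.smul (kipConst n α))).trans ?_
    simp only [Pi.smul_apply]
    rw [integral_smul, integral_smul,
      integral_integral_swap (f := fun Q s => f Q * kipDil α P v s Q) iK]
  have hsub : (∫ s in Set.Ioo (0 : ℝ) 1, ∫ Q, v Q * rightDil α P f s Q) -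
      (∫ s in Set.Ioo (0 : ℝ) 1, ∫ Q, f Q * kipDil α P v s Q) =
      (kipConst n α * Real.Gamma (1 - α) / α) • J := by
    rw [← integral_sub iR.integral_prod_right iK.integral_prod_right,
      ← integral_weight_sub hn h0 h1, ← integral_smul_const]
    refine integral_congr_ae ?_
    filter_upwards [iR.prod_left_ae, iK.prod_left_ae, ae_restrict_mem measurableSet_Ioo]
      with s hs1 hs2 hs
    exact integral_rightDil_sub_integral_kipDil hn hJ hs hs1 hs2
  rw [eR, eK, eq_add_of_sub_eq hsub, smul_add, smul_smul, add_comm]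
  congr 2
  have hG := (Real.Gamma_pos_of_pos (sub_pos.2 h1)).ne'
  rw [hc]
  field_simp

theorem lintegral_mul_lt_top_of_sq {Ω : Set (Space n)} {v : Space n → ℂ} (hv : Measurable v)
    (hv0 : ∀ Q ∉ Ω, v Q = 0) (hv2 : ∫⁻ Q in Ω, ‖v Q‖ₑ ^ 2 < ⊤) {G : Space n → ℝ≥0∞}
    (hG : Measurable G) (hG2 : ∫⁻ Q in Ω, G Q ^ 2 < ⊤) : ∫⁻ Q, ‖v Q‖ₑ * G Q < ⊤ := by
  have e : ∫⁻ Q, ‖v Q‖ₑ * G Q = ∫⁻ Q in Ω, ‖v Q‖ₑ * G Q := by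
    refine (setLIntegral_eq_of_support_subset fun Q hQ => ?_).symm
    by_contra hQ'
    exact hQ (by simp [hv0 Q hQ'])
  have := (lintegral_mul_sq_le (μ := volume.restrict Ω) hv.enorm.aemeasurable
    hG.aemeasurable).trans_lt (ENNReal.mul_lt_top hv2 hG2)
  rw [e]
  by_contra hne
  rw [not_lt, top_le_iff] at hne
  simp [hne] at this

theorem measurable_lintegral_section {F : ℝ → Space n → ℂ} (hF : Measurable (Function.uncurry F)) :
    Measurable fun Q => ∫⁻ s in Set.Ioo (0 : ℝ) 1, ‖F s Q‖ₑ :=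
  Measurable.lintegral_prod_right' (f := fun p : Space n × ℝ => ‖F p.2 p.1‖ₑ)
    (hF.comp measurable_swap).enorm

/-- Fractional integration by parts in `L₂(Ω)`. -/
theorem integral_mul_rightD_eq_of_sq {Ω : Set (Space n)} (hopen : IsOpen Ω)
    (hconv : Convex ℝ Ω) (hbdd : Bornology.IsBounded Ω) {P : Space n} (hP : P ∈ frontier Ω)
    {α : ℝ} (h0 : 0 < α) (h1 : α < 1) {f v : Space n → ℂ} (hf : Measurable f) (hv : Measurable v)
    (hf0 : ∀ Q ∉ Ω, f Q = 0)
    (hf2 : ∫⁻ Q in Ω, ‖f Q‖ₑ ^ 2 < ⊤) {E : ℝ≥0∞} (hE : HasEnergy Ω v E) (hEt : E < ⊤)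
    (hR : ∫⁻ Q, ‖v Q‖ₑ * ∫⁻ s in Set.Ioo (0 : ℝ) 1, ‖rightDil α P f s Q‖ₑ < ⊤) :
    ∫ Q, v Q * rightD α P f Q = ∫ Q, f Q * kip α P v Q := by
  have m := measurable_kipDil (α := α) (P := P) hv
  refine integral_mul_rightD_eq (one_le_of_mem_frontier hP) h0 h1 hf hv
    (hf0 P (notMem_of_mem_frontier hopen hP)) ?_ hR ?_
  · have h2 : ∫⁻ Q, ‖f Q‖ₑ * ‖dist P Q ^ (-α) • v Q‖ₑ < ⊤ :=
      lintegral_mul_lt_top_of_sq hf hf0 hf2 (by fun_prop)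
        ((hE.lintegral_rpow_smul_sq_le hopen hconv hbdd hP h1).trans_lt (by finiteness))
    refine ⟨(by fun_prop : Measurable _).aestronglyMeasurable, ?_⟩
    refine lt_of_eq_of_lt (lintegral_congr fun Q => ?_) h2
    rw [← enorm_mul, mul_smul_comm]
  · refine lintegral_mul_lt_top_of_sq hf hf0 hf2 (measurable_lintegral_section m) ?_
    exact (lintegral_sq_lintegral_kipDil_le hopen hbdd hP h1 hv hE).trans_lt
      (ENNReal.mul_lt_top (ENNReal.pow_lt_top (kipNorm_lt_top h1)) hEt)

/-! ### The right-side derivative of the weight -/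

theorem IsLip.continuousOn {Ω : Set (Space n)} {lam M : ℝ} (hlam : 0 < lam) {ρ : Space n → ℝ}
    (h : IsLip Ω lam M ρ) : ContinuousOn ρ Ω := by
  intro Q hQ
  rw [ContinuousWithinAt, tendsto_iff_dist_tendsto_zero]
  have t : Tendsto (fun x => M * dist x Q ^ lam) (𝓝[Ω] Q) (𝓝 0) := by
    have : ContinuousAt (fun x => M * dist x Q ^ lam) Q :=
      continuousAt_const.mul (ContinuousAt.rpow_const (by fun_prop) (Or.inr hlam.le))
    have h2 := this.tendsto
    simp only [dist_self, Real.zero_rpow hlam.ne', mul_zero] at h2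
    exact h2.mono_left nhdsWithin_le_nhds
  refine squeeze_zero' (Eventually.of_forall fun _ => dist_nonneg) ?_ t
  filter_upwards [self_mem_nhdsWithin] with x hx
  exact h x (subset_closure hx) Q (subset_closure hQ)

theorem IsLip.measurable_indicator {Ω : Set (Space n)} (hopen : IsOpen Ω) {lam M : ℝ}
    (hlam : 0 < lam) {ρ : Space n → ℝ} (h : IsLip Ω lam M ρ) : Measurable (Ω.indicator ρ) := by
  classical
  rw [← Set.piecewise_eq_indicator]
  exact (h.continuousOn hlam).measurable_piecewise continuousOn_const hopen.measurableSet

theorem IsLip.nonneg {Ω : Set (Space n)} (hopen : IsOpen Ω) {P Q : Space n}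
    (hP : P ∈ frontier Ω) (hQ : Q ∈ Ω) {lam M : ℝ}
    {ρ : Space n → ℝ} (h : IsLip Ω lam M ρ) : 0 ≤ M := by
  have h1 := (abs_nonneg _).trans (h P hP.1 Q (subset_closure hQ))
  exact nonneg_of_mul_nonneg_left h1 (Real.rpow_pos_of_pos (dist_pos_of_mem hopen hP hQ) _)

/-- The weight `ρ`, extended by zero off `Ω`, as a complex function. -/
def extWeight (Ω : Set (Space n)) (ρ : Space n → ℝ) (Q : Space n) : ℂ := (Ω.indicator ρ Q : ℝ)

theorem extWeight_of_mem {Ω : Set (Space n)} (ρ : Space n → ℝ) {Q : Space n} (hQ : Q ∈ Ω) :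
    extWeight Ω ρ Q = ρ Q := by simp [extWeight, hQ]

theorem extWeight_of_notMem {Ω : Set (Space n)} (ρ : Space n → ℝ) {Q : Space n} (hQ : Q ∉ Ω) :
    extWeight Ω ρ Q = 0 := by simp [extWeight, hQ]

theorem norm_extWeight_le {Ω : Set (Space n)} {ρ : Space n → ℝ} {ρ₁ : ℝ} (h1 : 0 ≤ ρ₁)
    (hρ1 : ∀ Q ∈ Ω, |ρ Q| ≤ ρ₁) (Q : Space n) : ‖extWeight Ω ρ Q‖ ≤ ρ₁ := by
  by_cases hQ : Q ∈ Ω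
  · rw [extWeight_of_mem ρ hQ, Complex.norm_real]; exact hρ1 Q hQ
  · rw [extWeight_of_notMem ρ hQ, norm_zero]; exact h1

theorem dist_ray {P Q : Space n} (hr : 0 < dist P Q) {t : ℝ} (ht : dist P Q ≤ t) :
    dist Q (ray P Q t) = t - dist P Q := by
  have : 1 ≤ t / dist P Q := by rwa [one_le_div hr]
  rw [ray_eq_dil, dist_dil_self, abs_sub_comm, abs_of_nonneg (by linarith), sub_mul,
    div_mul_cancel₀ _ hr.ne', one_mul]

/-- On a compact subset of `Ω` the integral that defines `𝔇^α_{d-}` of the weight converges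
absolutely and uniformly: close to `Q` by the Hölder condition, and further away because the
weight is bounded. -/
theorem exists_lintegral_rightDil_le {Ω : Set (Space n)} (hopen : IsOpen Ω)
    {P : Space n} (hP : P ∈ frontier Ω) {α lam M : ℝ} (h0 : 0 < α) (hlam : α < lam)
    {ρ : Space n → ℝ} (hρ : IsLip Ω lam M ρ) {ρ₁ : ℝ} (h1 : 0 ≤ ρ₁) (hρ1 : ∀ Q ∈ Ω, |ρ Q| ≤ ρ₁)
    {K : Set (Space n)} (hK : IsCompact K) (hKΩ : K ⊆ Ω) :
    ∃ c : ℝ≥0∞, c < ⊤ ∧ ∀ Q ∈ K,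
      ∫⁻ s in Set.Ioo (0 : ℝ) 1, ‖rightDil α P (extWeight Ω ρ) s Q‖ₑ ≤ c := by
  obtain ⟨δ, hδ, hsub⟩ := hK.exists_thickening_subset_open hopen hKΩ
  -- `σ = t - r`; for `σ ≤ δ / 2` the point of the ray stays in `Ω`
  set k₁ : ℝ → ℝ := fun σ => M * σ ^ (lam - α - 1) with hk1
  set k₂ : ℝ → ℝ := fun σ => (ρ₁ + ρ₁) * σ ^ (-α - 1) with hk2
  set c : ℝ≥0∞ := (∫⁻ σ in Set.Ioc 0 (δ / 2), ENNReal.ofReal (k₁ σ)) +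
    ∫⁻ σ in Set.Ioi (δ / 2), ENNReal.ofReal (k₂ σ) with hc
  refine ⟨c, ENNReal.add_lt_top.2 ⟨?_, ?_⟩, fun Q hQ => ?_⟩
  · have := (intervalIntegral.intervalIntegrable_rpow' (a := 0) (b := δ / 2)
      (by linarith : -1 < lam - α - 1)).const_mul M
    rw [intervalIntegrable_iff_integrableOn_Ioc_of_le (by positivity)] at this
    exact this.lintegral_lt_top
  · exact ((integrableOn_Ioi_rpow_of_lt (by linarith : -α - 1 < -1)
      (by positivity : 0 < δ / 2)).const_mul (ρ₁ + ρ₁)).lintegral_lt_top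
  · have hr := dist_pos_of_mem hopen hP (hKΩ hQ)
    set r := dist P Q
    set k : ℝ → ℝ≥0∞ := fun σ => if σ ≤ δ / 2 then ENNReal.ofReal (k₁ σ) else
      ENNReal.ofReal (k₂ σ) with hk
    have key : ∀ t ∈ Set.Ioi r, ‖rightIntegrand α P (extWeight Ω ρ) Q t‖ₑ ≤ k (t - r) := by
      intro t ht
      have ht' : 0 < t - r := sub_pos.2 ht
      have e : ‖rightIntegrand α P (extWeight Ω ρ) Q t‖ =
          (t - r) ^ (-α - 1) * ‖extWeight Ω ρ Q - extWeight Ω ρ (ray P Q t)‖ := by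
        rw [rightIntegrand, norm_smul, Real.norm_of_nonneg (by positivity), one_div,
          ← Real.rpow_neg ht'.le, neg_add']
      rw [← ofReal_norm, e]
      simp only [hk]
      split_ifs with hle
      · refine ENNReal.ofReal_le_ofReal ?_
        have hd := dist_ray hr (le_of_lt ht)
        have hT : ray P Q t ∈ Ω := hsub (Metric.mem_thickening_iff.2 ⟨Q, hQ, by
          rw [dist_comm, hd]; linarith⟩)
        rw [extWeight_of_mem ρ (hKΩ hQ), extWeight_of_mem ρ hT, ← Complex.ofReal_sub,
          Complex.norm_real]
        have := hρ Q (subset_closure (hKΩ hQ)) _ (subset_closure hT)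
        rw [hd] at this
        calc _ ≤ (t - r) ^ (-α - 1) * (M * (t - r) ^ lam) := by gcongr; exact this
          _ = k₁ (t - r) := by
            simp only [hk1]
            rw [show lam - α - 1 = (-α - 1) + lam by ring, Real.rpow_add ht']; ring
      · refine ENNReal.ofReal_le_ofReal ?_
        simp only [hk2]
        rw [mul_comm]
        gcongr
        exact (norm_sub_le _ _).trans (add_le_add (norm_extWeight_le h1 hρ1 _)
          (norm_extWeight_le h1 hρ1 _))
    rw [← lintegral_rightIntegrand hr]
    refine (setLIntegral_mono' measurableSet_Ioi key).trans (le_of_eq ?_)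
    have he : (fun t => t - r) ⁻¹' Set.Ioi 0 = Set.Ioi r := by ext t; simp
    have h3 := (measurePreserving_sub_right volume r).setLIntegral_comp_preimage_emb
      (MeasurableEquiv.subRight r).measurableEmbedding k (Set.Ioi 0)
    rw [he] at h3
    rw [h3, ← Set.Ioc_union_Ioi_eq_Ioi (by positivity : (0 : ℝ) ≤ δ / 2),
      lintegral_union measurableSet_Ioi (Set.Ioc_disjoint_Ioi le_rfl), hc]
    congr 1
    · refine setLIntegral_congr_fun measurableSet_Ioc fun σ hσ => ?_
      simp only [hk, if_pos hσ.2]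
    · refine setLIntegral_congr_fun measurableSet_Ioi fun σ hσ => ?_
      simp only [hk, if_neg (not_le.2 (Set.mem_Ioi.1 hσ))]

/-- Pointwise lower bound for the right-side derivative of the weight: the part of the ray beyond
`Ω` contributes `ρ (d - r)^{-α} / Γ(1 - α)`, and the part within `Ω` is controlled by the
one-sided Hölder bound `hM`. -/
theorem le_re_rightD_extWeight {Ω : Set (Space n)} (hopen : IsOpen Ω) (hconv : Convex ℝ Ω)
    (hbdd : Bornology.IsBounded Ω) {P Q : Space n} (hP : P ∈ frontier Ω) (hQ : Q ∈ Ω)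
    {α lam M : ℝ} (h0 : 0 < α) (h1 : α < 1) (hlam : α < lam) (hM0 : 0 ≤ M) {ρ : Space n → ℝ}
    (hpos : 0 ≤ ρ Q)
    (hM : ∀ t, dist P Q < t → ray P Q t ∈ Ω → -(M * (t - dist P Q) ^ lam) ≤ ρ Q - ρ (ray P Q t))
    (hI : IntegrableOn (fun s => rightDil α P (extWeight Ω ρ) s Q) (Set.Ioo 0 1)) :
    ρ Q * Metric.diam Ω ^ (-α) / Real.Gamma (1 - α) -
      α * M * Metric.diam Ω ^ (lam - α) / (Real.Gamma (1 - α) * (lam - α)) ≤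
      (rightD α P (extWeight Ω ρ) Q).re := by
  have hr := dist_pos_of_mem hopen hP hQ
  have hL := dist_lt_rayLength hopen hbdd hP hQ
  have hLd := rayLength_le_diam hopen hbdd hP hQ
  set r := dist P Q
  set L := rayLength Ω P Q
  set d := Metric.diam Ω
  have hG := Real.Gamma_pos_of_pos (sub_pos.2 h1)
  have hlr : 0 < L - r := sub_pos.2 hL
  have hI' := (integrableOn_rightIntegrand hr).2 hI
  have htail := integral_Ioi_rightIntegrand hbdd hP hr h0
    (fun Q hQ => extWeight_of_notMem ρ hQ) (le_refl L) hL (f := extWeight Ω ρ)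
  have hI1 : IntegrableOn (rightIntegrand α P (extWeight Ω ρ) Q) (Set.Ioo r L) :=
    hI'.mono_set fun t ht => ht.1
  have hpowI : IntegrableOn (fun t => -(M * (t - r) ^ (lam - α - 1))) (Set.Ioo r L) := by
    have := ((intervalIntegral.intervalIntegrable_rpow' (a := 0) (b := L - r)
      (by linarith : -1 < lam - α - 1)).comp_sub_right r).const_mul M
    rw [zero_add, sub_add_cancel, intervalIntegrable_iff_integrableOn_Ioo_of_le hL.le] at this
    exact this.neg
  have hpow : ∫ t in Set.Ioo r L, -(M * (t - r) ^ (lam - α - 1)) =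
      -(M * ((L - r) ^ (lam - α) / (lam - α))) := by
    rw [integral_neg, integral_const_mul, ← integral_Ioc_eq_integral_Ioo,
      ← intervalIntegral.integral_of_le hL.le,
      intervalIntegral.integral_comp_sub_right (fun x => x ^ (lam - α - 1)) r, sub_self,
      integral_rpow (Or.inl (by linarith)), sub_add_cancel, Real.zero_rpow (by linarith), sub_zero]
  have hinner : -(M * ((L - r) ^ (lam - α) / (lam - α))) ≤
      (∫ t in Set.Ioo r L, rightIntegrand α P (extWeight Ω ρ) Q t).re := by
    have h2 : ∫ t in Set.Ioo r L, (rightIntegrand α P (extWeight Ω ρ) Q t).re =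
      (∫ t in Set.Ioo r L, rightIntegrand α P (extWeight Ω ρ) Q t).re := integral_re hI1
    rw [← h2, ← hpow]
    refine setIntegral_mono_on hpowI hI1.re measurableSet_Ioo fun t ht => ?_
    have ht' : 0 < t - r := sub_pos.2 ht.1
    have hT : ray P Q t ∈ Ω := ray_mem hopen hconv hP hQ (hr.trans ht.1) ht.2
    have e : (rightIntegrand α P (extWeight Ω ρ) Q t).re =
        (t - r) ^ (-α - 1) * (ρ Q - ρ (ray P Q t)) := by
      rw [rightIntegrand, extWeight_of_mem ρ hQ, extWeight_of_mem ρ hT, ← Complex.ofReal_sub,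
        Complex.real_smul, ← Complex.ofReal_mul, Complex.ofReal_re, one_div,
        ← Real.rpow_neg ht'.le, neg_add']
    rw [e]
    calc -(M * (t - r) ^ (lam - α - 1)) = (t - r) ^ (-α - 1) * -(M * (t - r) ^ lam) := by
          rw [show lam - α - 1 = (-α - 1) + lam by ring, Real.rpow_add ht']; ring
      _ ≤ _ := by
          gcongr
          exact hM t ht.1 hT
  rw [rightD, ← integral_rightIntegrand hr, ← Set.Ioc_union_Ioi_eq_Ioi hL.le,
    setIntegral_union (Set.Ioc_disjoint_Ioi le_rfl) measurableSet_Ioi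
      (hI'.mono_set fun t ht => ht.1) (hI'.mono_set (Set.Ioi_subset_Ioi hL.le)),
    integral_Ioc_eq_integral_Ioo, htail.2, extWeight_of_mem ρ hQ, Complex.real_smul,
    Complex.re_ofReal_mul, Complex.add_re, Complex.real_smul, Complex.re_ofReal_mul,
    Complex.ofReal_re]
  have b1 : d ^ (-α) ≤ (L - r) ^ (-α) :=
    Real.rpow_le_rpow_of_nonpos hlr (by linarith) (by linarith)
  have b2 : (L - r) ^ (lam - α) ≤ d ^ (lam - α) :=
    Real.rpow_le_rpow hlr.le (by linarith) (by linarith)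
  have hla : 0 < lam - α := sub_pos.2 hlam
  calc ρ Q * d ^ (-α) / Real.Gamma (1 - α) -
        α * M * d ^ (lam - α) / (Real.Gamma (1 - α) * (lam - α))
      = α / Real.Gamma (1 - α) * (-(M * (d ^ (lam - α) / (lam - α))) + d ^ (-α) / α * ρ Q) := by
        field_simp; ring
    _ ≤ α / Real.Gamma (1 - α) * (-(M * ((L - r) ^ (lam - α) / (lam - α))) +
          (L - r) ^ (-α) / α * ρ Q) := by gcongr
    _ ≤ _ := by gcongr

/-! ### The lower bound for the weighted form of the fractional derivative -/

theorem kipConst_pos (hn : 1 ≤ n) {α : ℝ} (h1 : α < 1) : 0 < kipConst n α := by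
  have : (1 : ℝ) ≤ n := by exact_mod_cast hn
  exact div_pos (by positivity) (Real.Gamma_pos_of_pos (by linarith))

theorem sInf_image_le {Ω : Set (Space n)} {ρ : Space n → ℝ} (hpos : ∀ Q ∈ Ω, 0 < ρ Q)
    {Q : Space n} (hQ : Q ∈ Ω) : sInf (ρ '' Ω) ≤ ρ Q :=
  csInf_le ⟨0, by rintro _ ⟨x, hx, rfl⟩; exact (hpos x hx).le⟩ ⟨Q, hQ, rfl⟩

/-- The pointwise lower bound in terms of `μ`. In the first case of `μ` the Hölder term is absorbed
by `ρ(Q) / inf ρ ≥ 1`; in the second one the increments of `ρ` have a sign, and the Hölder constant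
may be taken to be zero. -/
theorem IsMu.le_re_rightD {Ω : Set (Space n)} (hopen : IsOpen Ω) (hconv : Convex ℝ Ω)
    (hbdd : Bornology.IsBounded Ω) {P Q : Space n} (hP : P ∈ frontier Ω) (hQ : Q ∈ Ω)
    {α lam M μ : ℝ} (h0 : 0 < α) (h1 : α < 1) (hlam : α < lam) {ρ : Space n → ℝ}
    (hρ : IsLip Ω lam M ρ) (hpos : ∀ Q ∈ Ω, 0 < ρ Q) (hμ : IsMu Ω α P ρ lam M μ)
    (hI : IntegrableOn (fun s => rightDil α P (extWeight Ω ρ) s Q) (Set.Ioo 0 1)) :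
    (2 * μ - Metric.diam Ω ^ (-α) * kipConst n α) * ρ Q ≤
      (rightD α P (extWeight Ω ρ) Q).re := by
  have hr := dist_pos_of_mem hopen hP hQ
  have hG := Real.Gamma_pos_of_pos (sub_pos.2 h1)
  have hla : 0 < lam - α := sub_pos.2 hlam
  have hM0 := hρ.nonneg hopen hP hQ
  have hd : 0 < Metric.diam Ω := hr.trans_le (dist_le_diam hbdd hP hQ)
  rcases hμ with ⟨hm, rfl⟩ | ⟨ha, rfl⟩
  · have hb := le_re_rightD_extWeight hopen hconv hbdd hP hQ h0 h1 hlam hM0 (hpos Q hQ).le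
      (fun t ht hT => by
        have := hρ Q (subset_closure hQ) _ (subset_closure hT)
        rw [dist_ray hr ht.le] at this
        exact (abs_le.1 this).1) hI
    refine le_trans ?_ hb
    set m := sInf (ρ '' Ω)
    have hmQ : m ≤ ρ Q := sInf_image_le hpos hQ
    have hx : 1 ≤ ρ Q / m := (one_le_div hm).2 hmQ
    set X := α * M * Metric.diam Ω ^ (lam - α) / (Real.Gamma (1 - α) * (lam - α)) with hX
    have hX0 : 0 ≤ X := by positivity
    have e : (2 * (muMain Ω α - α * M * Metric.diam Ω ^ (lam - α) /
        (2 * Real.Gamma (1 - α) * (lam - α) * m)) - Metric.diam Ω ^ (-α) * kipConst n α) * ρ Q =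
        ρ Q * Metric.diam Ω ^ (-α) / Real.Gamma (1 - α) - X * (ρ Q / m) := by
      rw [muMain, hX]; field_simp; ring
    rw [e]
    have := mul_le_mul_of_nonneg_left hx hX0
    linarith
  · have hb := le_re_rightD_extWeight hopen hconv hbdd hP hQ h0 h1 hlam le_rfl (hpos Q hQ).le
      (fun t ht hT => by
        have ht0 : 0 < t := hr.trans ht
        have h3 := ha _ hT (dist P Q / t) (by positivity) ((div_le_one ht0).2 ht.le)
        have e : P + (dist P Q / t) • (ray P Q t - P) = Q := by
          change dil P (dist P Q / t) (ray P Q t) = Q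
          rw [ray_eq_dil, dil_dil, div_mul_div_cancel₀ ht0.ne', div_self hr.ne', dil_one]
        rw [e] at h3
        rw [zero_mul]
        linarith) hI
    refine le_trans (le_of_eq ?_) hb
    rw [muMain]; field_simp; ring

/-- The pointwise inequality `𝔇^α |φ|² + C_n^{(α)} r^{-α} |φ|² ≤ 2 Re (conj φ 𝔇^α φ)`. -/
theorem add_le_two_mul_re_kip {α : ℝ} (h0 : 0 < α) (h1 : α < 1) {P Q : Space n}
    (hr : 0 < dist P Q) {φ : Space n → ℂ}
    (hφ : IntegrableOn (fun s => kipDil α P φ s Q) (Set.Ioo 0 1))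
    (hg : IntegrableOn (fun s => kipDil α P (fun Q => ((‖φ Q‖ ^ 2 : ℝ) : ℂ)) s Q) (Set.Ioo 0 1)) :
    (kip α P (fun Q => ((‖φ Q‖ ^ 2 : ℝ) : ℂ)) Q).re +
      kipConst n α * (dist P Q ^ (-α) * ‖φ Q‖ ^ 2) ≤
      2 * (starRingEnd ℂ (φ Q) * kip α P φ Q).re := by
  have hc : 0 ≤ α / Real.Gamma (1 - α) :=
    div_nonneg h0.le (Real.Gamma_pos_of_pos (sub_pos.2 h1)).le
  have key : (∫ s in Set.Ioo (0 : ℝ) 1, kipDil α P (fun Q => ((‖φ Q‖ ^ 2 : ℝ) : ℂ)) s Q).re ≤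
      2 * (starRingEnd ℂ (φ Q) * ∫ s in Set.Ioo (0 : ℝ) 1, kipDil α P φ s Q).re := by
    have i2 : IntegrableOn (fun s => starRingEnd ℂ (φ Q) * kipDil α P φ s Q) (Set.Ioo 0 1) :=
      hφ.const_mul _
    have e1 : (∫ s in Set.Ioo (0 : ℝ) 1, kipDil α P (fun Q => ((‖φ Q‖ ^ 2 : ℝ) : ℂ)) s Q).re =
        ∫ s in Set.Ioo (0 : ℝ) 1, (kipDil α P (fun Q => ((‖φ Q‖ ^ 2 : ℝ) : ℂ)) s Q).re :=
      (integral_re hg).symm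
    have e2 : (starRingEnd ℂ (φ Q) * ∫ s in Set.Ioo (0 : ℝ) 1, kipDil α P φ s Q).re =
        ∫ s in Set.Ioo (0 : ℝ) 1, (starRingEnd ℂ (φ Q) * kipDil α P φ s Q).re := by
      rw [← integral_const_mul]
      exact (integral_re i2).symm
    rw [e1, e2, ← integral_const_mul]
    refine setIntegral_mono_on hg.re (i2.re.const_mul 2) measurableSet_Ioo fun s hs => ?_
    have p0 : 0 < s := hs.1
    have p1 : 0 < 1 - s := sub_pos.2 hs.2
    have hw : 0 ≤ dist P Q ^ (-α) * (s ^ (n - 1) * (1 - s) ^ (-α - 1)) := by positivity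
    change (kipDil α P _ s Q).re ≤ 2 * (starRingEnd ℂ (φ Q) * kipDil α P φ s Q).re
    rw [kipDil, kipDil, mul_smul_comm, Complex.real_smul, Complex.real_smul,
      Complex.re_ofReal_mul, Complex.re_ofReal_mul,
      mul_left_comm (2 : ℝ)]
    refine mul_le_mul_of_nonneg_left ?_ hw
    -- `|z|² - |w|² ≤ 2 Re (z̄ (z - w))`, the difference being `|z - w|²`
    set z := φ Q
    set w := φ (dil P s Q)
    have h3 : (((‖z‖ ^ 2 : ℝ) : ℂ) - ((‖w‖ ^ 2 : ℝ) : ℂ)).re = ‖z‖ ^ 2 - ‖w‖ ^ 2 := by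
      rw [Complex.sub_re, Complex.ofReal_re, Complex.ofReal_re]
    rw [h3, Complex.sq_norm, Complex.sq_norm, Complex.normSq_apply, Complex.normSq_apply]
    simp only [Complex.mul_re, Complex.conj_re, Complex.conj_im, Complex.sub_re, Complex.sub_im]
    nlinarith [sq_nonneg (z.re - w.re), sq_nonneg (z.im - w.im)]
  have e3 : (starRingEnd ℂ (φ Q) * φ Q).re = ‖φ Q‖ ^ 2 := by
    rw [Complex.conj_mul', ← Complex.ofReal_pow, Complex.ofReal_re]
  rw [kip_eq hr, kip_eq hr, mul_add, mul_smul_comm, mul_smul_comm, mul_smul_comm]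
  simp only [Complex.add_re, Complex.real_smul, Complex.re_ofReal_mul, Complex.ofReal_re, e3]
  have := mul_le_mul_of_nonneg_left key hc
  linarith

theorem memLp_kip {Ω : Set (Space n)} (hopen : IsOpen Ω) (hconv : Convex ℝ Ω)
    (hbdd : Bornology.IsBounded Ω) {P : Space n} (hP : P ∈ frontier Ω) {α : ℝ} (h1 : α < 1)
    {f : Space n → ℂ} (hf : Measurable f) {E : ℝ≥0∞} (h : HasEnergy Ω f E) (hE : E < ⊤) :
    MemLp (kip α P f) 2 (volume.restrict Ω) :=
  memLp_two_of_lintegral_sq (aestronglyMeasurable_kip hopen hP hf)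
    ((lintegral_kip_sq_le hopen hconv hbdd hP h1 hf h).trans_lt
      (ENNReal.mul_lt_top (kipBound_lt_top h1) hE))

theorem IsTest.energy_lt_top {Ω : Set (Space n)} {φ : Space n → ℂ} (h : IsTest Ω φ) :
    energy φ < ⊤ := h.integrable_gradSq.lintegral_lt_top

theorem ae_integrableOn_kipDil {Ω : Set (Space n)} (hopen : IsOpen Ω)
    (hbdd : Bornology.IsBounded Ω) {P : Space n} (hP : P ∈ frontier Ω) {α : ℝ} (h1 : α < 1)
    {f : Space n → ℂ} (hf : Measurable f) {E : ℝ≥0∞} (h : HasEnergy Ω f E) (hE : E < ⊤) :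
    ∀ᵐ Q ∂volume.restrict Ω, IntegrableOn (fun s => kipDil α P f s Q) (Set.Ioo 0 1) :=
  integrableOn_of_lintegral_sq_lintegral (measurable_kipDil hf)
    ((lintegral_sq_lintegral_kipDil_le hopen hbdd hP h1 hf h).trans_lt
      (ENNReal.mul_lt_top (ENNReal.pow_lt_top (kipNorm_lt_top h1)) hE))

theorem IsTest.normSq {Ω : Set (Space n)} {φ : Space n → ℂ} (h : IsTest Ω φ) :
    IsTest Ω fun Q => ((‖φ Q‖ ^ 2 : ℝ) : ℂ) := by
  have hs : tsupport (fun Q => ((‖φ Q‖ ^ 2 : ℝ) : ℂ)) ⊆ tsupport φ :=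
    closure_mono fun x hx h0 => hx (by simp [h0])
  exact ⟨Complex.ofRealCLM.contDiff.comp (h.smooth.norm_sq ℝ),
    h.compact.of_isClosed_subset (isClosed_tsupport _) hs, hs.trans h.subset⟩

theorem IsTest.memLp {F : Type*} [NormedAddCommGroup F] [NormedSpace ℝ F] {Ω : Set (Space n)}
    {φ : Space n → F} (h : IsTest Ω φ) (μ : Measure (Space n)) [IsFiniteMeasureOnCompacts μ] :
    MemLp φ 2 μ :=
  h.smooth.continuous.memLp_of_hasCompactSupport h.compact

/-- The lower bound for the weighted form of `𝔇^α` on test functions. The inequality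
`2 Re φ̄(Q) (φ(Q) - φ(T)) ≥ |φ(Q)|² - |φ(T)|²` reduces it to `∫ ρ 𝔇^α |φ|²`, and fractional
integration by parts moves the derivative to the weight. -/
theorem IsTest.le_integral_re_kip {Ω : Set (Space n)} (hopen : IsOpen Ω) (hconv : Convex ℝ Ω)
    (hbdd : Bornology.IsBounded Ω) {P : Space n} (hP : P ∈ frontier Ω)
    {α lam M μ ρ₁ : ℝ} (h0 : 0 < α) (h1 : α < 1) (hlam : α < lam) {ρ : Space n → ℝ}
    (hρ : IsLip Ω lam M ρ) (hpos : ∀ Q ∈ Ω, 0 < ρ Q) (hρ1 : ∀ Q ∈ Ω, ρ Q ≤ ρ₁)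
    (hμ : IsMu Ω α P ρ lam M μ) {φ : Space n → ℂ} (h : IsTest Ω φ) :
    μ * ∫ Q in Ω, ρ Q * ‖φ Q‖ ^ 2 ≤
      ∫ Q in Ω, ρ Q * (starRingEnd ℂ (φ Q) * kip α P φ Q).re := by
  rcases Ω.eq_empty_or_nonempty with rfl | ⟨Q₀, hQ₀⟩
  · simp
  have hd : 0 < Metric.diam Ω :=
    (dist_pos_of_mem hopen hP hQ₀).trans_le (dist_le_diam hbdd hP hQ₀)
  have hn := one_le_of_mem_frontier hP
  have hC := kipConst_pos hn h1
  have hρ₁ : 0 ≤ ρ₁ := (hpos Q₀ hQ₀).le.trans (hρ1 Q₀ hQ₀)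
  have hρabs : ∀ Q ∈ Ω, |ρ Q| ≤ ρ₁ := fun Q hQ => by rw [abs_of_pos (hpos Q hQ)]; exact hρ1 Q hQ
  have hmem : ∀ᵐ Q ∂volume.restrict Ω, Q ∈ Ω := ae_restrict_mem hopen.measurableSet
  have hρm : AEStronglyMeasurable ρ (volume.restrict Ω) :=
    (hρ.continuousOn (h0.trans hlam)).aestronglyMeasurable hopen.measurableSet
  have hρb : ∀ᵐ Q ∂volume.restrict Ω, ‖ρ Q‖ ≤ ρ₁ := by
    filter_upwards [hmem] with Q hQ using hρabs Q hQ
  set g : Space n → ℂ := fun Q => ((‖φ Q‖ ^ 2 : ℝ) : ℂ) with hg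
  have hgT : IsTest Ω g := h.normSq
  set f := extWeight Ω ρ with hf
  have hfm : Measurable f :=
    Complex.measurable_ofReal.comp (hρ.measurable_indicator hopen (h0.trans hlam))
  have hf0 : ∀ Q ∉ Ω, f Q = 0 := fun Q hQ => extWeight_of_notMem ρ hQ
  have hφm : Measurable φ := h.smooth.continuous.measurable
  have hgm : Measurable g := hgT.smooth.continuous.measurable
  have hvol : volume Ω < ⊤ := hbdd.measure_lt_top
  have hfL : MemLp f 2 (volume.restrict Ω) := by
    have : IsFiniteMeasure (volume.restrict Ω) := ⟨by simpa using hvol⟩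
    exact MemLp.of_bound hfm.aestronglyMeasurable ρ₁
      (Eventually.of_forall (norm_extWeight_le hρ₁ hρabs))
  have hkφ := memLp_kip (α := α) hopen hconv hbdd hP h1 hφm h.hasEnergy h.energy_lt_top
  have hkg := memLp_kip (α := α) hopen hconv hbdd hP h1 hgm hgT.hasEnergy hgT.energy_lt_top
  -- absolute convergence of the right-side derivative of the weight, tested against `|φ|²`
  obtain ⟨c, hct, hcb⟩ := exists_lintegral_rightDil_le hopen hP h0 hlam hρ hρ₁ hρabs
    h.compact h.subset
  have hcb' : ∀ Q, ‖g Q‖ₑ * ∫⁻ s in Set.Ioo (0 : ℝ) 1, ‖rightDil α P f s Q‖ₑ ≤ ‖g Q‖ₑ * c := by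
    intro Q
    by_cases hQ : Q ∈ tsupport φ
    · gcongr; exact hcb Q hQ
    · simp [hg, image_eq_zero_of_notMem_tsupport hQ]
  have hgi : Integrable g :=
    hgT.smooth.continuous.integrable_of_hasCompactSupport hgT.compact
  have hR : ∫⁻ Q, ‖g Q‖ₑ * ∫⁻ s in Set.Ioo (0 : ℝ) 1, ‖rightDil α P f s Q‖ₑ < ⊤ := by
    refine (lintegral_mono hcb').trans_lt ?_
    rw [lintegral_mul_const' _ _ hct.ne]
    exact ENNReal.mul_lt_top hgi.2 hct
  have hparts := integral_mul_rightD_eq_of_sq hopen hconv hbdd hP h0 h1 hfm hgm hf0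
    (MemLp.lintegral_sq_lt_top hfL) hgT.hasEnergy hgT.energy_lt_top hR
  have hiR : Integrable fun Q => g Q * rightD α P f Q := by
    have m := (stronglyMeasurable_integral_section
      (measurable_rightDil (α := α) (P := P) hfm)).measurable
    refine ⟨(hgm.mul (m.const_smul (α / Real.Gamma (1 - α)))).aestronglyMeasurable, ?_⟩
    calc ∫⁻ Q, ‖g Q * rightD α P f Q‖ₑ
        ≤ ∫⁻ Q, ‖α / Real.Gamma (1 - α)‖ₑ *
          (‖g Q‖ₑ * ∫⁻ s in Set.Ioo (0 : ℝ) 1, ‖rightDil α P f s Q‖ₑ) := by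
          refine lintegral_mono fun Q => ?_
          rw [enorm_mul, rightD, enorm_smul, mul_left_comm]
          gcongr
          exact enorm_integral_le_lintegral_enorm _
      _ = ‖α / Real.Gamma (1 - α)‖ₑ *
          ∫⁻ Q, ‖g Q‖ₑ * ∫⁻ s in Set.Ioo (0 : ℝ) 1, ‖rightDil α P f s Q‖ₑ :=
          lintegral_const_mul' _ _ enorm_ne_top
      _ < ⊤ := ENNReal.mul_lt_top enorm_lt_top hR
  have hφ2 : IntegrableOn (fun Q => ‖φ Q‖ ^ 2) Ω :=
    (h.memLp (volume.restrict Ω)).integrable_norm_pow (by norm_num)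
  have i1 : IntegrableOn (fun Q => ρ Q * ‖φ Q‖ ^ 2) Ω := hφ2.bdd_mul hρm hρb
  have i2 : IntegrableOn (fun Q => ρ Q * (kip α P g Q).re) Ω := by
    have hfin : IsFiniteMeasure (volume.restrict Ω) := ⟨by simpa using hvol⟩
    exact ((hkg.integrable (by norm_num)).re).bdd_mul hρm hρb
  have i3 : IntegrableOn (fun Q => ρ Q * (starRingEnd ℂ (φ Q) * kip α P φ Q).re) Ω := by
    have : Integrable (fun Q => starRingEnd ℂ (φ Q) * kip α P φ Q) (volume.restrict Ω) :=
      MemLp.integrable_mul (p := 2) (q := 2) ((h.memLp (volume.restrict Ω)).star) hkφ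
    exact this.re.bdd_mul hρm hρb
  set D := Metric.diam Ω ^ (-α) * kipConst n α with hD
  -- the pointwise inequality, integrated; `r ≤ diam Ω` makes `D` a lower bound for the last term
  have step1 : (∫ Q in Ω, ρ Q * (kip α P g Q).re) + D * ∫ Q in Ω, ρ Q * ‖φ Q‖ ^ 2 ≤
      2 * ∫ Q in Ω, ρ Q * (starRingEnd ℂ (φ Q) * kip α P φ Q).re := by
    rw [← integral_const_mul, ← integral_const_mul, ← integral_add i2 (i1.const_mul D)]
    refine integral_mono_ae (i2.add (i1.const_mul D)) (i3.const_mul 2) ?_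
    filter_upwards [hmem, ae_integrableOn_kipDil hopen hbdd hP h1 hφm h.hasEnergy h.energy_lt_top,
      ae_integrableOn_kipDil hopen hbdd hP h1 hgm hgT.hasEnergy hgT.energy_lt_top]
      with Q hQ hi hi'
    have hr := dist_pos_of_mem hopen hP hQ
    have b := add_le_two_mul_re_kip h0 h1 hr hi hi'
    have b2 : Metric.diam Ω ^ (-α) ≤ dist P Q ^ (-α) :=
      Real.rpow_le_rpow_of_nonpos hr (dist_le_diam hbdd hP hQ) (by linarith)
    have b3 : D * ‖φ Q‖ ^ 2 ≤ kipConst n α * (dist P Q ^ (-α) * ‖φ Q‖ ^ 2) := by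
      rw [hD, mul_comm (Metric.diam Ω ^ (-α)), mul_assoc]
      gcongr
    have b4 := mul_le_mul_of_nonneg_left ((add_le_add_right b3 _).trans b) (hpos Q hQ).le
    change ρ Q * (kip α P g Q).re + D * (ρ Q * ‖φ Q‖ ^ 2) ≤ _
    linarith
  have step2 : (∫ Q in Ω, ρ Q * (kip α P g Q).re) = (∫ Q, f Q * kip α P g Q).re := by
    rw [← setIntegral_eq_integral_of_forall_compl_eq_zero (s := Ω)
      (f := fun Q => f Q * kip α P g Q) (fun Q hQ => by rw [hf0 Q hQ, zero_mul])]
    have e : ∫ Q in Ω, f Q * kip α P g Q = ∫ Q in Ω, (ρ Q : ℂ) * kip α P g Q :=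
      setIntegral_congr_fun hopen.measurableSet fun Q hQ => by
        simp only [hf, extWeight_of_mem ρ hQ]
    have i4 : IntegrableOn (fun Q => (ρ Q : ℂ) * kip α P g Q) Ω := by
      have hfin : IsFiniteMeasure (volume.restrict Ω) := ⟨by simpa using hvol⟩
      refine (hkg.integrable (by norm_num)).bdd_mul (c := ρ₁)
        (Complex.continuous_ofReal.comp_aestronglyMeasurable hρm) ?_
      filter_upwards [hρb] with Q hQ
      rwa [Complex.norm_real]
    rw [e]
    refine Eq.trans ?_ (integral_re i4)
    refine integral_congr_ae (Eventually.of_forall fun Q => ?_)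
    exact (Complex.re_ofReal_mul _ _).symm
  -- the lower bound for the derivative of the weight, tested against `|φ|²`
  have step3 : (2 * μ - D) * ∫ Q in Ω, ρ Q * ‖φ Q‖ ^ 2 ≤ (∫ Q, g Q * rightD α P f Q).re := by
    have e : (∫ Q, g Q * rightD α P f Q).re = ∫ Q in Ω, (g Q * rightD α P f Q).re := by
      refine (integral_re hiR).symm.trans
        (setIntegral_eq_integral_of_forall_compl_eq_zero fun Q hQ => ?_).symm
      rw [hgT.eq_zero hQ, zero_mul]
      rfl
    rw [e, ← integral_const_mul]
    refine setIntegral_mono_on (i1.const_mul _) hiR.re.integrableOn hopen.measurableSet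
      fun Q hQ => ?_
    change _ ≤ (((‖φ Q‖ ^ 2 : ℝ) : ℂ) * rightD α P f Q).re
    rw [Complex.re_ofReal_mul]
    by_cases hz : φ Q = 0
    · simp [hz]
    · have hQt : Q ∈ tsupport φ := subset_tsupport _ hz
      have hfin := (hcb Q hQt).trans_lt hct
      have hI : IntegrableOn (fun s => rightDil α P f s Q) (Set.Ioo 0 1) :=
        ⟨((measurable_rightDil (α := α) (P := P) hfm).comp
          (measurable_id.prodMk measurable_const)).aestronglyMeasurable, hfin⟩
      have b := hμ.le_re_rightD hopen hconv hbdd hP hQ h0 h1 hlam hρ hpos hI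
      calc (2 * μ - D) * (ρ Q * ‖φ Q‖ ^ 2) = ‖φ Q‖ ^ 2 * ((2 * μ - D) * ρ Q) := by ring
        _ ≤ _ := by gcongr
  rw [hparts, ← step2] at step3
  linarith

/-! ### The fractional derivative on `H¹₀(Ω)` -/

theorem IsTest.isTest_pderiv {Ω : Set (Space n)} {φ : Space n → ℂ} (h : IsTest Ω φ) (i : Fin n) :
    IsTest Ω (pderiv i φ) :=
  ⟨(h.smooth.fderiv_right (m := ∞) (by simp)).clm_apply contDiff_const,
    h.hasCompactSupport_pderiv i, (tsupport_pderiv_subset φ i).trans h.subset⟩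

theorem IsTest.sub {Ω : Set (Space n)} {φ ψ : Space n → ℂ} (h : IsTest Ω φ) (h' : IsTest Ω ψ) :
    IsTest Ω (φ - ψ) := by
  rw [sub_eq_add_neg]
  have hn : tsupport (-ψ) = tsupport ψ := by simp [tsupport]
  exact ⟨h.smooth.add h'.smooth.neg, h.compact.add h'.compact.neg,
    (tsupport_add _ _).trans (Set.union_subset h.subset (hn.trans_subset h'.subset))⟩

theorem IsTest.pderiv_sub {Ω : Set (Space n)} {φ ψ : Space n → ℂ} (h : IsTest Ω φ)
    (h' : IsTest Ω ψ) (i : Fin n) : pderiv i (φ - ψ) = pderiv i φ - pderiv i ψ := by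
  ext x
  simp only [pderiv, Pi.sub_apply]
  rw [fderiv_sub (h.smooth.differentiable (by simp) x) (h'.smooth.differentiable (by simp) x)]
  rfl

/-- The class in `L₂(Ω)` of a test function. -/
def IsTest.toL2 {Ω : Set (Space n)} {φ : Space n → ℂ} (h : IsTest Ω φ) : L2 Ω :=
  (h.memLp (volume.restrict Ω)).toLp φ

theorem IsTest.coeFn_toL2 {Ω : Set (Space n)} {φ : Space n → ℂ} (h : IsTest Ω φ) :
    h.toL2 =ᵐ[volume.restrict Ω] φ := MemLp.coeFn_toLp _

/-- The notion of convergence in the definition of `H¹₀(Ω)` is that of the Hilbert space. -/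
theorem IsTest.tendsto_toL2 {Ω : Set (Space n)} {φ : ℕ → Space n → ℂ} (h : ∀ k, IsTest Ω (φ k))
    {u : L2 Ω} : Tendsto (fun k => (h k).toL2) atTop (𝓝 u) ↔ TendstoL2 Ω φ u := by
  have := Lp.tendsto_Lp_iff_tendsto_eLpNorm'' (fi := atTop) φ
    (fun k => (h k).memLp (volume.restrict Ω)) u (Lp.memLp u)
  rwa [Lp.toLp_coeFn] at this

theorem enorm_L2_sq {Ω : Set (Space n)} (u : L2 Ω) : ‖u‖ₑ ^ 2 = ∫⁻ Q in Ω, ‖u Q‖ₑ ^ 2 := by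
  rw [Lp.enorm_def, eLpNorm_two_sq]

theorem IsTest.energy_eq {Ω : Set (Space n)} {φ : Space n → ℂ} (h : IsTest Ω φ) :
    energy φ = ∑ i, ‖(h.isTest_pderiv i).toL2‖ₑ ^ 2 := by
  have e : ∀ i, ‖(h.isTest_pderiv i).toL2‖ₑ ^ 2 = ∫⁻ Q, ‖pderiv i φ Q‖ₑ ^ 2 := by
    intro i
    rw [enorm_L2_sq, lintegral_congr_ae (g := fun Q => ‖pderiv i φ Q‖ₑ ^ 2)]
    · refine setLIntegral_eq_of_support_subset ?_
      intro Q hQ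
      by_contra hQ'
      exact hQ (by simp [(h.isTest_pderiv i).eq_zero hQ'])
    · filter_upwards [(h.isTest_pderiv i).coeFn_toL2] with Q hQ
      rw [hQ]
  simp only [e]
  rw [energy, ← lintegral_finsetSum _ fun i _ =>
    (h.continuous_pderiv i).enorm.measurable.pow_const 2]
  refine lintegral_congr fun Q => ?_
  rw [gradSq, ENNReal.ofReal_sum_of_nonneg fun _ _ => by positivity]
  refine Finset.sum_congr rfl fun i _ => ?_
  rw [ENNReal.ofReal_pow (norm_nonneg _), ofReal_norm]

/-- `(u, g)` is the limit in `L₂(Ω)` of pairs `(φ, ∇φ)`, `φ` a test function: `u` lies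
in `H¹₀(Ω)`, and `g` is its gradient. -/
def HasGrad (Ω : Set (Space n)) (u : L2 Ω) (g : Fin n → L2 Ω) : Prop :=
  ∃ (φ : ℕ → Space n → ℂ) (h : ∀ k, IsTest Ω (φ k)),
    Tendsto (fun k => (h k).toL2) atTop (𝓝 u) ∧
    ∀ i, Tendsto (fun k => ((h k).isTest_pderiv i).toL2) atTop (𝓝 (g i))

theorem IsTest.hasGrad {Ω : Set (Space n)} {φ : Space n → ℂ} (h : IsTest Ω φ) :
    HasGrad Ω h.toL2 fun i => (h.isTest_pderiv i).toL2 :=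
  ⟨fun _ => φ, fun _ => h, tendsto_const_nhds, fun _ => tendsto_const_nhds⟩

theorem HasGrad.sub_toL2 {Ω : Set (Space n)} {u : L2 Ω} {g : Fin n → L2 Ω} (h : HasGrad Ω u g)
    {ψ : Space n → ℂ} (hψ : IsTest Ω ψ) :
    HasGrad Ω (u - hψ.toL2) fun i => g i - (hψ.isTest_pderiv i).toL2 := by
  obtain ⟨φ, hφ, hu, hg⟩ := h
  refine ⟨fun k => φ k - ψ, fun k => (hφ k).sub hψ, ?_, fun i => ?_⟩
  · exact (hu.sub_const hψ.toL2).congr fun k => (MemLp.toLp_sub _ _).symm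
  · refine ((hg i).sub_const _).congr fun k => ?_
    rw [IsTest.toL2, IsTest.toL2, IsTest.toL2, ← MemLp.toLp_sub]
    exact MemLp.toLp_congr _ _ (by rw [(hφ k).pderiv_sub hψ])

theorem ext0_measurable {Ω : Set (Space n)} (hopen : IsOpen Ω) (u : L2 Ω) :
    Measurable (ext0 Ω u) :=
  (Lp.stronglyMeasurable u).measurable.indicator hopen.measurableSet

/-- A subsequence of an approximating sequence converges almost everywhere. -/
theorem HasGrad.hasEnergy {Ω : Set (Space n)} (hopen : IsOpen Ω) {u : L2 Ω} {g : Fin n → L2 Ω}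
    (h : HasGrad Ω u g) : HasEnergy Ω (ext0 Ω u) (∑ i, ‖g i‖ₑ ^ 2) := by
  obtain ⟨φ, hφ, hu, hg⟩ := h
  obtain ⟨ns, hns, hae⟩ := (tendstoInMeasure_of_tendsto_eLpNorm (by norm_num)
    (fun k => (hφ k).aesm _) (Lp.aestronglyMeasurable u)
    ((IsTest.tendsto_toL2 hφ).1 hu)).exists_seq_tendsto_ae
  refine ⟨fun k => φ (ns k), fun k => hφ _, ?_, ?_⟩
  · filter_upwards [(ae_restrict_iff' hopen.measurableSet).1 hae] with Q hQ
    by_cases hm : Q ∈ Ω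
    · simpa [ext0, hm] using hQ hm
    · simp [ext0, hm, (hφ _).eq_zero hm]
  · simp only [(hφ _).energy_eq]
    refine tendsto_finsetSum _ fun i _ => ?_
    have := ((ENNReal.continuous_pow 2).tendsto _).comp ((hg i).enorm.comp hns.tendsto_atTop)
    exact this

theorem sum_enorm_sq_lt_top {Ω : Set (Space n)} (g : Fin n → L2 Ω) : ∑ i, ‖g i‖ₑ ^ 2 < ⊤ :=
  ENNReal.sum_lt_top.2 fun _ _ => ENNReal.pow_lt_top enorm_lt_top

/-- `ρ 𝔇^α` is defined on `H¹₀(Ω)` and bounded from `H¹₀(Ω)` to `L₂(Ω)`. -/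
theorem HasGrad.exists_kip {Ω : Set (Space n)} (hopen : IsOpen Ω) (hconv : Convex ℝ Ω)
    (hbdd : Bornology.IsBounded Ω) {P : Space n} (hP : P ∈ frontier Ω) {α : ℝ} (h1 : α < 1)
    {ρ : Space n → ℝ} (hρm : AEStronglyMeasurable ρ (volume.restrict Ω)) {ρ₁ : ℝ}
    (hρ1 : ∀ Q ∈ Ω, |ρ Q| ≤ ρ₁) {u : L2 Ω} {g : Fin n → L2 Ω} (h : HasGrad Ω u g) :
    ∃ w : L2 Ω, (u, w) ∈ kipGraph Ω α P ρ ∧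
      ‖w‖ ^ 2 ≤ ρ₁ ^ 2 * (kipBound n (Metric.diam Ω) α).toReal * ∑ i, ‖g i‖ ^ 2 := by
  have hE := h.hasEnergy hopen
  have hEt := sum_enorm_sq_lt_top g
  have hum := ext0_measurable hopen u
  have hk := memLp_kip (α := α) hopen hconv hbdd hP h1 hum hE hEt
  have hmem : ∀ᵐ Q ∂volume.restrict Ω, Q ∈ Ω := ae_restrict_mem hopen.measurableSet
  have hm : AEStronglyMeasurable (fun Q => ρ Q • kip α P (ext0 Ω u) Q) (volume.restrict Ω) :=
    hρm.smul hk.1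
  have hle : ∀ᵐ Q ∂volume.restrict Ω, ‖ρ Q • kip α P (ext0 Ω u) Q‖ₑ ^ 2 ≤
      ENNReal.ofReal (ρ₁ ^ 2) * ‖kip α P (ext0 Ω u) Q‖ₑ ^ 2 := by
    filter_upwards [hmem] with Q hQ
    have := sq_le_sq.2 ((hρ1 Q hQ).trans (le_abs_self ρ₁))
    rw [enorm_smul_sq]
    exact mul_le_mul_left (ENNReal.ofReal_le_ofReal this) _
  have hbound : ∫⁻ Q in Ω, ‖ρ Q • kip α P (ext0 Ω u) Q‖ₑ ^ 2 ≤
      ENNReal.ofReal (ρ₁ ^ 2) * (kipBound n (Metric.diam Ω) α * ∑ i, ‖g i‖ₑ ^ 2) := by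
    refine (lintegral_mono_ae hle).trans ?_
    rw [lintegral_const_mul' _ _ ENNReal.ofReal_ne_top]
    gcongr
    exact lintegral_kip_sq_le hopen hconv hbdd hP h1 hum hE
  have hK : kipBound n (Metric.diam Ω) α < ⊤ := kipBound_lt_top h1
  have hfin : ENNReal.ofReal (ρ₁ ^ 2) * (kipBound n (Metric.diam Ω) α * ∑ i, ‖g i‖ₑ ^ 2) < ⊤ :=
    ENNReal.mul_lt_top ENNReal.ofReal_lt_top (ENNReal.mul_lt_top hK hEt)
  have hw := memLp_two_of_lintegral_sq hm (hbound.trans_lt hfin)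
  refine ⟨hw.toLp _, ⟨?_, hw.coeFn_toLp⟩, ?_⟩
  · filter_upwards [ae_integrableOn_kipDil (α := α) hopen hbdd hP h1 hum hE hEt, hmem] with Q hi hQ
    exact (intervalIntegrable_kipIntegrand (dist_pos_of_mem hopen hP hQ)).2 hi
  · have e : ‖hw.toLp _‖ₑ ^ 2 ≤
        ENNReal.ofReal (ρ₁ ^ 2) * (kipBound n (Metric.diam Ω) α * ∑ i, ‖g i‖ₑ ^ 2) := by
      rw [Lp.enorm_toLp, eLpNorm_two_sq]
      exact hbound
    have e2 := ENNReal.toReal_mono hfin.ne e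
    rw [ENNReal.toReal_pow, ENNReal.toReal_mul, ENNReal.toReal_mul,
      ENNReal.toReal_sum fun i _ => (ENNReal.pow_lt_top enorm_lt_top).ne,
      ENNReal.toReal_ofReal (sq_nonneg _), toReal_enorm] at e2
    simp only [ENNReal.toReal_pow, toReal_enorm] at e2
    linarith

theorem kipGraph_unique {Ω : Set (Space n)} {α : ℝ} {P : Space n} {ρ : Space n → ℝ}
    {u w w' : L2 Ω} (h : (u, w) ∈ kipGraph Ω α P ρ) (h' : (u, w') ∈ kipGraph Ω α P ρ) :
    w = w' := by
  have := Submodule.sub_mem _ h h'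
  rw [Prod.mk_sub_mk, sub_self] at this
  exact sub_eq_zero.1 (kipGraph_eq_zero this)

theorem IsTest.ext0_toL2 {Ω : Set (Space n)} {φ : Space n → ℂ} (h : IsTest Ω φ) :
    ext0 Ω h.toL2 =ᵐ[volume] φ := by
  have e : Ω.indicator φ = φ := Set.indicator_eq_self.2 fun x hx => by
    by_contra hx'
    exact hx (h.eq_zero hx')
  simpa only [e] using ext0_congr h.coeFn_toL2

/-- The lower bound for test functions in terms of the inner product. -/
theorem IsTest.le_re_inner_kip {Ω : Set (Space n)} (hopen : IsOpen Ω) (hconv : Convex ℝ Ω)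
    (hbdd : Bornology.IsBounded Ω) {P : Space n} (hP : P ∈ frontier Ω)
    {α lam M μ ρ₁ : ℝ} (h0 : 0 < α) (h1 : α < 1) (hlam : α < lam) {ρ : Space n → ℝ}
    (hρ : IsLip Ω lam M ρ) (hpos : ∀ Q ∈ Ω, 0 < ρ Q) (hρ1 : ∀ Q ∈ Ω, ρ Q ≤ ρ₁)
    (hμ : IsMu Ω α P ρ lam M μ) (hμ0 : 0 ≤ μ) {φ : Space n → ℂ} (h : IsTest Ω φ) {w : L2 Ω}
    (hw : (h.toL2, w) ∈ kipGraph Ω α P ρ) :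
    μ * sInf (ρ '' Ω) * ‖h.toL2‖ ^ 2 ≤ (⟪h.toL2, w⟫_ℂ).re := by
  have hw' := (IsKip.congr hw h.ext0_toL2 (ae_eq_refl _)).eq
  have hρabs : ∀ Q ∈ Ω, |ρ Q| ≤ ρ₁ := fun Q hQ => by rw [abs_of_pos (hpos Q hQ)]; exact hρ1 Q hQ
  have hmem : ∀ᵐ Q ∂volume.restrict Ω, Q ∈ Ω := ae_restrict_mem hopen.measurableSet
  have hρm : AEStronglyMeasurable ρ (volume.restrict Ω) :=
    (hρ.continuousOn (h0.trans hlam)).aestronglyMeasurable hopen.measurableSet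
  have hρb : ∀ᵐ Q ∂volume.restrict Ω, ‖ρ Q‖ ≤ ρ₁ := by
    filter_upwards [hmem] with Q hQ using hρabs Q hQ
  have e1 : (⟪h.toL2, w⟫_ℂ).re =
      ∫ Q in Ω, ρ Q * (starRingEnd ℂ (φ Q) * kip α P φ Q).re := by
    rw [L2.inner_def]
    refine (integral_re (L2.integrable_inner (𝕜 := ℂ) _ _)).symm.trans (integral_congr_ae ?_)
    filter_upwards [hw', h.coeFn_toL2] with Q e e'
    simp only [e, e', RCLike.inner_apply]
    rw [smul_mul_assoc, Complex.real_smul, mul_comm (kip α P φ Q)]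
    exact Complex.re_ofReal_mul _ _
  have hφ2 : IntegrableOn (fun Q => ‖φ Q‖ ^ 2) Ω :=
    (h.memLp (volume.restrict Ω)).integrable_norm_pow (by norm_num)
  have e2 : ‖h.toL2‖ ^ 2 = ∫ Q in Ω, ‖φ Q‖ ^ 2 := by
    rw [← inner_self_eq_norm_sq (𝕜 := ℂ), L2.inner_def]
    refine (integral_re (L2.integrable_inner (𝕜 := ℂ) _ _)).symm.trans (integral_congr_ae ?_)
    filter_upwards [h.coeFn_toL2] with Q e'
    rw [inner_self_eq_norm_sq, e']
  rw [e1, e2]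
  refine le_trans ?_ (h.le_integral_re_kip hopen hconv hbdd hP h0 h1 hlam hρ hpos hρ1 hμ)
  rw [mul_assoc]
  refine mul_le_mul_of_nonneg_left ?_ hμ0
  rw [← integral_const_mul]
  refine setIntegral_mono_on (hφ2.const_mul _) (hφ2.bdd_mul hρm hρb) hopen.measurableSet
    fun Q hQ => ?_
  exact mul_le_mul_of_nonneg_right (sInf_image_le hpos hQ) (by positivity)

/-- The lower bound for the form of `ρ 𝔇^α` passes from test functions to `H¹₀(Ω)`, on which
`ρ 𝔇^α` is continuous. -/
theorem HasGrad.le_re_inner_kip {Ω : Set (Space n)} (hopen : IsOpen Ω) (hconv : Convex ℝ Ω)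
    (hbdd : Bornology.IsBounded Ω) {P : Space n} (hP : P ∈ frontier Ω)
    {α lam M μ ρ₁ : ℝ} (h0 : 0 < α) (h1 : α < 1) (hlam : α < lam) {ρ : Space n → ℝ}
    (hρ : IsLip Ω lam M ρ) (hpos : ∀ Q ∈ Ω, 0 < ρ Q) (hρ1 : ∀ Q ∈ Ω, ρ Q ≤ ρ₁)
    (hμ : IsMu Ω α P ρ lam M μ) (hμ0 : 0 ≤ μ) {u w : L2 Ω} {g : Fin n → L2 Ω}
    (h : HasGrad Ω u g) (hw : (u, w) ∈ kipGraph Ω α P ρ) :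
    μ * sInf (ρ '' Ω) * ‖u‖ ^ 2 ≤ (⟪u, w⟫_ℂ).re := by
  have hρabs : ∀ Q ∈ Ω, |ρ Q| ≤ ρ₁ := fun Q hQ => by rw [abs_of_pos (hpos Q hQ)]; exact hρ1 Q hQ
  have hρm : AEStronglyMeasurable ρ (volume.restrict Ω) :=
    (hρ.continuousOn (h0.trans hlam)).aestronglyMeasurable hopen.measurableSet
  have h' := h
  obtain ⟨φ, hφ, hu, hg⟩ := h'
  have hT : ∀ k, ∃ wk : L2 Ω, ((hφ k).toL2, wk) ∈ kipGraph Ω α P ρ ∧ _ := fun k =>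
    (hφ k).hasGrad.exists_kip hopen hconv hbdd hP h1 hρm hρabs
  choose wk hwk _ using hT
  set K := ρ₁ ^ 2 * (kipBound n (Metric.diam Ω) α).toReal
  have hb : ∀ k, ‖w - wk k‖ ^ 2 ≤ K * ∑ i, ‖g i - ((hφ k).isTest_pderiv i).toL2‖ ^ 2 := by
    intro k
    obtain ⟨v, hv, hvb⟩ := (h.sub_toL2 (hφ k)).exists_kip (α := α) hopen hconv hbdd hP h1 hρm hρabs
    rwa [← kipGraph_unique (Submodule.sub_mem _ hw (hwk k)) hv] at hvb
  have t0 : Tendsto (fun k => K * ∑ i, ‖g i - ((hφ k).isTest_pderiv i).toL2‖ ^ 2) atTop (𝓝 0) := by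
    have : Tendsto (fun k => K * ∑ i, ‖g i - ((hφ k).isTest_pderiv i).toL2‖ ^ 2) atTop
        (𝓝 (K * ∑ i, ‖g i - g i‖ ^ 2)) :=
      (tendsto_finsetSum _ fun i _ => (((hg i).const_sub (g i)).norm.pow 2)).const_mul K
    simpa using this
  have t1 : Tendsto wk atTop (𝓝 w) := by
    rw [tendsto_iff_norm_sub_tendsto_zero]
    have := (squeeze_zero (fun k => by positivity) hb t0).sqrt
    simpa [Real.sqrt_sq, norm_sub_rev] using this
  refine le_of_tendsto_of_tendsto ((hu.norm.pow 2).const_mul _)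
    ((Complex.continuous_re.tendsto _).comp (hu.inner t1)) (Eventually.of_forall fun k => ?_)
  exact (hφ k).le_re_inner_kip hopen hconv hbdd hP h0 h1 hlam hρ hpos hρ1 hμ hμ0 (hwk k)

/-! ### Weak derivatives of products -/

/-- A sequence of bump functions at the origin, supported in balls of radius `δ / (k + 1)`. -/
def bumpSeq {δ : ℝ} (hδ : 0 < δ) (k : ℕ) : ContDiffBump (0 : Space n) where
  rIn := δ / (k + 1) / 2
  rOut := δ / (k + 1)
  rIn_pos := by positivity
  rIn_lt_rOut := half_lt_self (by positivity)

theorem bumpSeq_rOut_le {δ : ℝ} (hδ : 0 < δ) (k : ℕ) : (bumpSeq (n := n) hδ k).rOut ≤ δ :=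
  div_le_self hδ.le (by linarith [(Nat.cast_nonneg k : (0 : ℝ) ≤ k)])

theorem tendsto_bumpSeq_rOut {δ : ℝ} (hδ : 0 < δ) :
    Tendsto (fun k => (bumpSeq (n := n) hδ k).rOut) atTop (𝓝 0) :=
  tendsto_const_div_atTop_nhds_zero_nat δ |>.comp (tendsto_add_atTop_nat 1) |>.congr
    fun k => by simp [bumpSeq]

/-- The mollification of `ψ` at scale `δ / (k + 1)`. -/
def mollify {δ : ℝ} (hδ : 0 < δ) (k : ℕ) (ψ : Space n → ℝ) : Space n → ℝ :=
  MeasureTheory.convolution ((bumpSeq hδ k).normed volume) ψ (ContinuousLinearMap.lsmul ℝ ℝ) volume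

theorem mollify_eq_zero {δ : ℝ} (hδ : 0 < δ) (k : ℕ) {ψ : Space n → ℝ} {x : Space n}
    (hx : x ∉ Metric.cthickening δ (tsupport ψ)) : mollify hδ k ψ x = 0 := by
  by_contra hne
  obtain ⟨a, ha, b, hb, rfl⟩ := support_convolution_subset _ hne
  refine hx (Metric.mem_cthickening_of_dist_le _ b δ _ (subset_tsupport _ hb) ?_)
  rw [(bumpSeq hδ k).support_normed_eq, mem_ball_zero_iff] at ha
  rw [dist_eq_norm, add_sub_cancel_right]
  exact ha.le.trans (bumpSeq_rOut_le hδ k)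

theorem contDiff_mollify {δ : ℝ} (hδ : 0 < δ) (k : ℕ) {ψ : Space n → ℝ} (hψ : Continuous ψ) :
    ContDiff ℝ ∞ (mollify hδ k ψ) :=
  (bumpSeq hδ k).hasCompactSupport_normed.contDiff_convolution_left _
    (bumpSeq hδ k).contDiff_normed hψ.locallyIntegrable

theorem pderiv_mollify {δ : ℝ} (hδ : 0 < δ) (k : ℕ) {ψ : Space n → ℝ} (hψ : ContDiff ℝ 1 ψ)
    (hc : HasCompactSupport ψ) (j : Fin n) :
    pderiv j (mollify hδ k ψ) = mollify hδ k (pderiv j ψ) := by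
  ext x
  have hb : LocallyIntegrable ((bumpSeq (n := n) hδ k).normed volume) volume :=
    ((bumpSeq hδ k).continuous_normed).locallyIntegrable
  have h := (hc.hasFDerivAt_convolution_right (ContinuousLinearMap.lsmul ℝ ℝ) hb hψ x).fderiv
  change fderiv ℝ (mollify hδ k ψ) x _ = _
  rw [mollify, h, convolution_precompR_apply _ hb (hc.fderiv ℝ) (hψ.continuous_fderiv one_ne_zero)]
  rfl

/-- Mollifications may be integrated against locally integrable functions: they are uniformly
bounded, with supports in a fixed compact subset of `Ω`. -/
theorem tendsto_integral_mollify {Ω : Set (Space n)} {δ : ℝ} (hδ : 0 < δ) {ψ : Space n → ℝ}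
    (hψ : Continuous ψ) (hc : HasCompactSupport ψ)
    (hsub : Metric.cthickening δ (tsupport ψ) ⊆ Ω) {f : Space n → ℂ}
    (hf : LocallyIntegrableOn f Ω) :
    Tendsto (fun k => ∫ x in Ω, mollify hδ k ψ x • f x) atTop (𝓝 (∫ x in Ω, ψ x • f x)) := by
  set K := Metric.cthickening δ (tsupport ψ) with hK
  have hKc : IsCompact K := hc.isCompact.cthickening
  obtain ⟨C, hC⟩ := hψ.bounded_above_of_compact_support hc
  have hC0 : 0 ≤ C := (norm_nonneg _).trans (hC 0)
  have hfK : Integrable (K.indicator fun x => 3 * C * ‖f x‖) (volume.restrict Ω) :=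
    ((integrable_indicator_iff hKc.measurableSet).2
      ((hf.integrableOn_compact_subset hsub hKc).norm.const_mul (3 * C))).integrableOn
  refine tendsto_integral_of_dominated_convergence _ (fun k => ?_) hfK (fun k => ?_) ?_
  · exact (contDiff_mollify hδ k hψ).continuous.aestronglyMeasurable.smul hf.aestronglyMeasurable
  · refine Eventually.of_forall fun x => ?_
    by_cases hx : x ∈ K
    · rw [Set.indicator_of_mem hx, norm_smul]
      gcongr
      have hd : dist (mollify hδ k ψ x) (ψ x) ≤ 2 * C :=
        ContDiffBump.dist_normed_convolution_le hψ.aestronglyMeasurable fun y _ => by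
          rw [dist_eq_norm]
          linarith [norm_sub_le (ψ y) (ψ x), hC x, hC y]
      rw [dist_eq_norm] at hd
      linarith [norm_le_norm_add_norm_sub (ψ x) (mollify hδ k ψ x), hC x,
        norm_sub_rev (ψ x) (mollify hδ k ψ x)]
    · rw [Set.indicator_of_notMem hx, mollify_eq_zero hδ k hx, zero_smul, norm_zero]
  · exact Eventually.of_forall fun x => (ContDiffBump.convolution_tendsto_right_of_continuous
      (tendsto_bumpSeq_rOut hδ) hψ x).smul_const (f x)

/-- A weak derivative may be tested with compactly supported functions of class `C¹`. -/
theorem IsWeakDeriv.eq_of_contDiff_one {Ω : Set (Space n)} (hopen : IsOpen Ω) {j : Fin n}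
    {f g : Space n → ℂ} (h : IsWeakDeriv Ω j f g) {ψ : Space n → ℝ} (hψ : ContDiff ℝ 1 ψ)
    (hc : HasCompactSupport ψ) (hsub : tsupport ψ ⊆ Ω) :
    ∫ x in Ω, pderiv j ψ x • f x = - ∫ x in Ω, ψ x • g x := by
  obtain ⟨δ, hδ, hδΩ⟩ := hc.isCompact.exists_cthickening_subset_open hopen hsub
  have hd : Continuous (pderiv j ψ) :=
    (hψ.continuous_fderiv one_ne_zero).clm_apply continuous_const
  have hdc : HasCompactSupport (pderiv j ψ) :=
    hc.of_isClosed_subset (isClosed_tsupport _) (tsupport_pderiv_subset ψ j)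
  have hT : ∀ k, IsTest Ω (mollify hδ k ψ) := fun k => by
    have hs : tsupport (mollify hδ k ψ) ⊆ Metric.cthickening δ (tsupport ψ) :=
      closure_minimal (fun x hx => by
        by_contra hx'
        exact hx (mollify_eq_zero hδ k hx')) Metric.isClosed_cthickening
    exact ⟨contDiff_mollify hδ k hψ.continuous,
      hc.isCompact.cthickening.of_isClosed_subset (isClosed_tsupport _) hs, hs.trans hδΩ⟩
  have t1 := tendsto_integral_mollify hδ hd hdc
    ((Metric.cthickening_subset_of_subset δ (tsupport_pderiv_subset ψ j)).trans hδΩ) h.left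
  have t2 := (tendsto_integral_mollify hδ hψ.continuous hc hδΩ h.right).neg
  refine tendsto_nhds_unique t1 (t2.congr fun k => ?_)
  rw [← h.eq _ (hT k), pderiv_mollify hδ k hψ hc]

theorem contDiff_mul_of_isTest {Ω : Set (Space n)} (hopen : IsOpen Ω) {a φ : Space n → ℝ}
    (ha : ContDiffOn ℝ 1 a Ω) (hφ : IsTest Ω φ) : ContDiff ℝ 1 (fun x => φ x * a x) := by
  rw [contDiff_iff_contDiffAt]
  intro x
  by_cases hx : x ∈ tsupport φ
  · exact (hφ.smooth.contDiffAt.of_le (by simp)).mul (ha.contDiffAt (hopen.mem_nhds (hφ.subset hx)))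
  · refine (contDiffAt_const (c := (0 : ℝ))).congr_of_eventuallyEq ?_
    filter_upwards [(isClosed_tsupport φ).isOpen_compl.mem_nhds hx] with y hy
    rw [image_eq_zero_of_notMem_tsupport hy, zero_mul]

/-- The product rule for weak derivatives. -/
theorem IsWeakDeriv.contDiffOn_smul {Ω : Set (Space n)} (hopen : IsOpen Ω) {j : Fin n}
    {f g : Space n → ℂ} (h : IsWeakDeriv Ω j f g) {a : Space n → ℝ} (ha : ContDiffOn ℝ 1 a Ω) :
    IsWeakDeriv Ω j (fun x => a x • f x) (fun x => pderiv j a x • f x + a x • g x) := by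
  have hda : ContinuousOn (pderiv j a) Ω :=
    (ha.continuousOn_fderiv_of_isOpen hopen le_rfl).clm_apply continuousOn_const
  have l1 : LocallyIntegrableOn (fun x => a x • f x) Ω :=
    h.left.continuousOn_smul hopen.isLocallyClosed ha.continuousOn
  have l2 : LocallyIntegrableOn (fun x => pderiv j a x • f x) Ω :=
    h.left.continuousOn_smul hopen.isLocallyClosed hda
  have l3 : LocallyIntegrableOn (fun x => a x • g x) Ω :=
    h.right.continuousOn_smul hopen.isLocallyClosed ha.continuousOn
  refine ⟨l1, l2.add l3, fun φ hφ => ?_⟩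
  have hψ := contDiff_mul_of_isTest hopen ha hφ
  have hs : tsupport (fun x => φ x * a x) ⊆ tsupport φ :=
    closure_mono fun x hx h0 => hx (by simp [h0])
  have key := h.eq_of_contDiff_one hopen hψ
    (hφ.compact.of_isClosed_subset (isClosed_tsupport _) hs) (hs.trans hφ.subset)
  have e1 : ∫ x in Ω, pderiv j (fun x => φ x * a x) x • f x =
      (∫ x in Ω, φ x • (pderiv j a x • f x)) + ∫ x in Ω, pderiv j φ x • (a x • f x) := by
    rw [← integral_add (hφ.integrableOn l2) (hφ.integrableOn_pderiv l1 j)]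
    refine setIntegral_congr_fun hopen.measurableSet fun x hx => ?_
    have hd := fderiv_fun_mul (hφ.smooth.differentiable (by simp) x)
      ((ha.contDiffAt (hopen.mem_nhds hx)).differentiableAt one_ne_zero)
    simp only [pderiv, hd, add_apply, smul_apply,
      smul_eq_mul, add_smul, smul_smul]
    rw [mul_comm (a x)]
  have e2 : ∫ x in Ω, φ x • (pderiv j a x • f x + a x • g x) =
      (∫ x in Ω, φ x • (pderiv j a x • f x)) + ∫ x in Ω, (φ x * a x) • g x := by
    simp only [smul_add, mul_smul]
    exact integral_add (hφ.integrableOn l2) (hφ.integrableOn l3)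
  rw [e1] at key
  rw [e2]
  linear_combination key

/-- A weak derivative may be tested with complex-valued functions, by their real and imaginary
parts. -/
theorem IsWeakDeriv.eq_of_isTest {Ω : Set (Space n)} {j : Fin n}
    {f g : Space n → ℂ} (h : IsWeakDeriv Ω j f g) {ψ : Space n → ℂ} (hψ : IsTest Ω ψ) :
    ∫ x in Ω, pderiv j ψ x * f x = - ∫ x in Ω, ψ x * g x := by
  have hL : ∀ L : ℂ →L[ℝ] ℝ, IsTest Ω (fun x => L (ψ x)) ∧
      pderiv j (fun x => L (ψ x)) = fun x => L (pderiv j ψ x) := by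
    intro L
    have hs : tsupport (fun x => L (ψ x)) ⊆ tsupport ψ :=
      closure_mono fun x hx h0 => hx (by simp [h0])
    refine ⟨⟨L.contDiff.comp hψ.smooth, hψ.compact.of_isClosed_subset (isClosed_tsupport _) hs,
      hs.trans hψ.subset⟩, ?_⟩
    ext x
    have := L.hasFDerivAt.comp x (hψ.smooth.differentiable (by simp) x).hasFDerivAt
    exact congrArg (fun A => A (EuclideanSpace.single j 1)) this.fderiv
  obtain ⟨t1, d1⟩ := hL Complex.reCLM
  obtain ⟨t2, d2⟩ := hL Complex.imCLM
  have split : ∀ z w : ℂ, z * w = z.re • w + Complex.I * (z.im • w) := fun z w => by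
    conv_lhs => rw [← Complex.re_add_im z]
    simp only [Complex.real_smul]; ring
  have k1 := h.eq _ t1
  have k2 := h.eq _ t2
  have i1 := t1.integrableOn_pderiv h.left j
  have i2 := t2.integrableOn_pderiv h.left j
  have i3 := t1.integrableOn h.right
  have i4 := t2.integrableOn h.right
  rw [d1] at k1 i1
  rw [d2] at k2 i2
  simp only [Complex.reCLM_apply, Complex.imCLM_apply] at k1 k2 i1 i2 i3 i4
  simp only [split (pderiv j ψ _), split (ψ _)]
  rw [integral_add i1 (i2.const_mul _), integral_add i3 (i4.const_mul _), integral_const_mul,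
    integral_const_mul, k1, k2]
  ring

/-! ### The elliptic part -/

theorem IsTest.isWeakDeriv {Ω : Set (Space n)} {φ : Space n → ℂ} (h : IsTest Ω φ) (i : Fin n) :
    IsWeakDeriv Ω i φ (pderiv i φ) := by
  refine ⟨h.smooth.continuous.locallyIntegrable.locallyIntegrableOn _,
    (h.continuous_pderiv i).locallyIntegrable.locallyIntegrableOn _, fun χ hχ => ?_⟩
  have hχd : Continuous (pderiv i χ) :=
    (hχ.smooth.continuous_fderiv (by simp)).clm_apply continuous_const
  rw [setIntegral_eq_integral_of_forall_compl_eq_zero fun x hx => by rw [h.eq_zero hx, smul_zero],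
    setIntegral_eq_integral_of_forall_compl_eq_zero fun x hx => by rw [hχ.eq_zero hx, zero_smul]]
  have := integral_smul_fderiv_eq_neg_fderiv_smul_of_integrable (𝕜 := ℝ) (μ := volume)
    (f := χ) (g := φ) (v := EuclideanSpace.single i 1)
    ((hχd.smul h.smooth.continuous).integrable_of_hasCompactSupport h.compact.smul_left)
    ((hχ.smooth.continuous.smul (h.continuous_pderiv i)).integrable_of_hasCompactSupport
      hχ.compact.smul_right)
    ((hχ.smooth.continuous.smul h.smooth.continuous).integrable_of_hasCompactSupport
      hχ.compact.smul_right)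
    (fun x _ => hχ.smooth.differentiable (by simp) x)
    (fun x _ => h.smooth.differentiable (by simp) x)
  exact (neg_eq_iff_eq_neg.2 this).symm

theorem IsTest.isWeakDeriv_toL2 {Ω : Set (Space n)} {φ : Space n → ℂ} (h : IsTest Ω φ)
    (i : Fin n) : IsWeakDeriv Ω i h.toL2 (h.isTest_pderiv i).toL2 :=
  (h.isWeakDeriv i).congr h.coeFn_toL2.symm (h.isTest_pderiv i).coeFn_toL2.symm

theorem IsTest.toL2_mem {Ω : Set (Space n)} {φ : Space n → ℂ} (h : IsTest Ω φ) :
    h.toL2 ∈ H2 Ω ⊓ H10 Ω :=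
  ⟨⟨_, fun i j => ((h.isTest_pderiv i).isTest_pderiv j).toL2, h.isWeakDeriv_toL2,
    fun i j => (h.isTest_pderiv i).isWeakDeriv_toL2 j⟩,
    ⟨_, fun _ => φ, h.isWeakDeriv_toL2, fun _ => h,
      (IsTest.tendsto_toL2 fun _ => h).1 tendsto_const_nhds,
      fun i => (IsTest.tendsto_toL2 fun _ => h.isTest_pderiv i).1 tendsto_const_nhds⟩⟩

/-- Uniqueness of weak derivatives in `L₂(Ω)`. -/
theorem IsWeakDeriv.unique {Ω : Set (Space n)} (hopen : IsOpen Ω) {i : Fin n} {u g g' : L2 Ω}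
    (h : IsWeakDeriv Ω i u g) (h' : IsWeakDeriv Ω i u g') : g = g' := by
  have h1 := (h.add (h'.smul (-1))).eq_zero hopen (Eventually.of_forall fun x => by simp)
  refine Lp.ext ?_
  filter_upwards [h1] with x hx
  simpa [← sub_eq_add_neg, sub_eq_zero] using hx

theorem exists_hasGrad {Ω : Set (Space n)} {u : L2 Ω} (hu : u ∈ H10 Ω) :
    ∃ g, HasGrad Ω u g ∧ ∀ i, IsWeakDeriv Ω i u (g i) := by
  obtain ⟨g, φ, h1, h2, h3, h4⟩ := hu
  exact ⟨g, ⟨φ, h2, (IsTest.tendsto_toL2 h2).2 h3,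
    fun i => (IsTest.tendsto_toL2 fun k => (h2 k).isTest_pderiv i).2 (h4 i)⟩, h1⟩

/-- The derivatives within the compact set `closure Ω` are bounded, and agree on `Ω` with the
ordinary ones. -/
theorem exists_abs_pderiv_le {Ω : Set (Space n)} (hopen : IsOpen Ω) (hconv : Convex ℝ Ω)
    (hbdd : Bornology.IsBounded Ω) {a : Space n → ℝ} (ha : ContDiffOn ℝ 1 a (closure Ω))
    (j : Fin n) : ∃ C, ∀ Q ∈ Ω, ‖pderiv j a Q‖ ≤ C := by
  rcases Ω.eq_empty_or_nonempty with rfl | hne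
  · exact ⟨0, by simp⟩
  have hu : UniqueDiffOn ℝ (closure Ω) := uniqueDiffOn_convex hconv.closure
    (hne.mono (interior_maximal subset_closure hopen))
  have hc := ((ha.continuousOn_fderivWithin hu le_rfl).clm_apply
    (continuousOn_const (c := (EuclideanSpace.single j 1 : Space n))))
  obtain ⟨C, hC⟩ := hbdd.isCompact_closure.exists_bound_of_continuousOn hc
  refine ⟨C, fun Q hQ => ?_⟩
  have := hC Q (subset_closure hQ)
  rwa [fderivWithin_of_mem_nhds (mem_of_superset (hopen.mem_nhds hQ) subset_closure)] at this

theorem memLp_smul_L2 {Ω : Set (Space n)} (hopen : IsOpen Ω) {a : Space n → ℝ}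
    (ha : ContinuousOn a Ω) {C : ℝ} (hC : ∀ Q ∈ Ω, ‖a Q‖ ≤ C) (g : L2 Ω) :
    MemLp (fun Q => a Q • g Q) 2 (volume.restrict Ω) := by
  refine MemLp.of_le_mul (c := C) (Lp.memLp g)
    ((ha.aestronglyMeasurable hopen.measurableSet).smul (Lp.aestronglyMeasurable g)) ?_
  filter_upwards [ae_restrict_mem hopen.measurableSet] with Q hQ
  rw [norm_smul]
  exact mul_le_mul_of_nonneg_right (hC Q hQ) (norm_nonneg _)

/-- The divergence form operator is defined on `H²(Ω)`: the coefficients are continuously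
differentiable and bounded with their derivatives, so that the product rule applies. -/
theorem exists_mem_divGraph {Ω : Set (Space n)} (hopen : IsOpen Ω) (hconv : Convex ℝ Ω)
    (hbdd : Bornology.IsBounded Ω) {a : Fin n → Fin n → Space n → ℝ}
    (ha : ∀ i j, ContDiffOn ℝ 1 (a i j) (closure Ω)) {u : L2 Ω} (hu : u ∈ H2 Ω) :
    ∃ w, (u, w) ∈ divGraph Ω a := by
  obtain ⟨g, h, hg, hh⟩ := hu
  have haΩ : ∀ i j, ContDiffOn ℝ 1 (a i j) Ω := fun i j => (ha i j).mono subset_closure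
  have hb : ∀ i j, ∃ C, ∀ Q ∈ Ω, ‖a i j Q‖ ≤ C := fun i j =>
    (hbdd.isCompact_closure.exists_bound_of_continuousOn (ha i j).continuousOn).imp
      fun C hC Q hQ => hC Q (subset_closure hQ)
  choose C hC using hb
  have hb' := fun i j => exists_abs_pderiv_le hopen hconv hbdd (ha i j) j
  choose D hD using hb'
  have hm : ∀ i j, MemLp (fun Q => pderiv j (a i j) Q • g i Q + a i j Q • h i j Q) 2
      (volume.restrict Ω) := fun i j =>
    (memLp_smul_L2 hopen (((haΩ i j).continuousOn_fderiv_of_isOpen hopen le_rfl).clm_apply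
      continuousOn_const) (hD i j) (g i)).add
      (memLp_smul_L2 hopen (haΩ i j).continuousOn (hC i j) (h i j))
  exact ⟨_, g, fun i j => (hm i j).toLp _, hg, fun i j =>
    ((hh i j).contDiffOn_smul hopen (haΩ i j)).congr (ae_eq_refl _) (hm i j).coeFn_toLp.symm, rfl⟩

/-- The sesquilinear form `∫ ∑ a^{ij} D_i u conj (D_j v)` as a function of the gradients
`g` of `u` and `g'` of `v`. -/
def ellForm (Ω : Set (Space n)) (a : Fin n → Fin n → Space n → ℝ) (g g' : Fin n → L2 Ω) : ℂ :=
  ∑ i, ∑ j, ∫ Q in Ω, starRingEnd ℂ (g' j Q) * (a i j Q • g i Q)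

theorem IsTest.conj {Ω : Set (Space n)} {φ : Space n → ℂ} (h : IsTest Ω φ) :
    IsTest Ω fun x => starRingEnd ℂ (φ x) := by
  have hs : tsupport (fun x => starRingEnd ℂ (φ x)) ⊆ tsupport φ :=
    closure_mono fun x hx h0 => hx (by simp [h0])
  exact ⟨Complex.conjCLE.contDiff.comp h.smooth,
    h.compact.of_isClosed_subset (isClosed_tsupport _) hs, hs.trans h.subset⟩

theorem IsTest.pderiv_conj {Ω : Set (Space n)} {φ : Space n → ℂ} (h : IsTest Ω φ) (j : Fin n) :
    pderiv j (fun x => starRingEnd ℂ (φ x)) = fun x => starRingEnd ℂ (pderiv j φ x) := by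
  ext x
  have := Complex.conjCLE.hasFDerivAt.comp x (h.smooth.differentiable (by simp) x).hasFDerivAt
  exact congrArg (fun A => A (EuclideanSpace.single j 1)) this.fderiv

/-- Integration by parts: elements of `H¹₀(Ω)` have no boundary values. -/
theorem HasGrad.inner_eq {Ω : Set (Space n)} {v f h : L2 Ω} {g : Fin n → L2 Ω}
    (hv : HasGrad Ω v g) {j : Fin n} (hw : IsWeakDeriv Ω j f h) :
    ⟪v, h⟫_ℂ = -⟪g j, f⟫_ℂ := by
  obtain ⟨φ, hφ, h1, h2⟩ := hv
  refine tendsto_nhds_unique (h1.inner tendsto_const_nhds)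
    (((h2 j).inner tendsto_const_nhds).neg.congr fun k => ?_)
  have e := hw.eq_of_isTest (hφ k).conj
  rw [(hφ k).pderiv_conj] at e
  rw [L2.inner_def, L2.inner_def, neg_eq_iff_eq_neg]
  refine Eq.trans ?_ (e.trans (congrArg Neg.neg ?_))
  · refine integral_congr_ae ?_
    filter_upwards [((hφ k).isTest_pderiv j).coeFn_toL2] with x hx
    rw [hx, RCLike.inner_apply, mul_comm]
  · refine integral_congr_ae ?_
    filter_upwards [(hφ k).coeFn_toL2] with x hx
    rw [hx, RCLike.inner_apply, mul_comm]

theorem HasGrad.inner_div_eq {Ω : Set (Space n)} (hopen : IsOpen Ω)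
    {a : Fin n → Fin n → Space n → ℝ} (ha : ∀ i j, ContinuousOn (a i j) Ω) {A : ℝ}
    (hA : ∀ i j, ∀ Q ∈ Ω, ‖a i j Q‖ ≤ A) {u v w : L2 Ω} {g g' : Fin n → L2 Ω}
    (hu : ∀ i, IsWeakDeriv Ω i u (g i)) (hv : HasGrad Ω v g') (hw : (u, w) ∈ divGraph Ω a) :
    ⟪v, w⟫_ℂ = ellForm Ω a g g' := by
  obtain ⟨γ, h, hγ, hh, hw⟩ := hw
  obtain rfl : γ = g := funext fun i => (hγ i).unique hopen (hu i)
  simp only at hw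
  rw [hw, inner_neg_right, inner_sum, ellForm, ← Finset.sum_neg_distrib]
  refine Finset.sum_congr rfl fun i _ => ?_
  rw [inner_sum, ← Finset.sum_neg_distrib]
  refine Finset.sum_congr rfl fun j _ => ?_
  have hm := memLp_smul_L2 hopen (ha i j) (hA i j) (γ i)
  rw [hv.inner_eq ((hh i j).congr hm.coeFn_toLp.symm (ae_eq_refl _)), neg_neg, L2.inner_def]
  refine integral_congr_ae ?_
  filter_upwards [hm.coeFn_toLp] with x hx
  rw [hx, RCLike.inner_apply, mul_comm]

theorem norm_L2_sq {Ω : Set (Space n)} (u : L2 Ω) : ‖u‖ ^ 2 = ∫ Q in Ω, ‖u Q‖ ^ 2 := by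
  rw [← inner_self_eq_norm_sq (𝕜 := ℂ), L2.inner_def]
  refine (integral_re (L2.integrable_inner (𝕜 := ℂ) _ _)).symm.trans
    (integral_congr_ae (Eventually.of_forall fun Q => ?_))
  exact inner_self_eq_norm_sq _

theorem integrable_norm_sq_L2 {Ω : Set (Space n)} (u : L2 Ω) :
    Integrable (fun Q => ‖u Q‖ ^ 2) (volume.restrict Ω) :=
  (Lp.memLp u).integrable_norm_pow (by norm_num)

theorem sum_norm_L2_sq {Ω : Set (Space n)} (g : Fin n → L2 Ω) :
    ∑ i, ‖g i‖ ^ 2 = ∫ Q in Ω, ∑ i, ‖g i Q‖ ^ 2 := by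
  rw [integral_finsetSum _ fun i _ => integrable_norm_sq_L2 (g i)]
  simp only [norm_L2_sq]

theorem integrable_conj_mul_smul {Ω : Set (Space n)} (hopen : IsOpen Ω) {a : Space n → ℝ}
    (ha : ContinuousOn a Ω) {A : ℝ} (hA : ∀ Q ∈ Ω, ‖a Q‖ ≤ A) (u v : L2 Ω) :
    Integrable (fun Q => starRingEnd ℂ (v Q) * (a Q • u Q)) (volume.restrict Ω) :=
  MemLp.integrable_mul (p := 2) (q := 2) (Lp.memLp v).star (memLp_smul_L2 hopen ha hA u)

theorem ellForm_eq {Ω : Set (Space n)} (hopen : IsOpen Ω)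
    {a : Fin n → Fin n → Space n → ℝ} (ha : ∀ i j, ContinuousOn (a i j) Ω) {A : ℝ}
    (hA : ∀ i j, ∀ Q ∈ Ω, ‖a i j Q‖ ≤ A) (g g' : Fin n → L2 Ω) :
    Integrable (fun Q => ∑ i, ∑ j, starRingEnd ℂ (g' j Q) * (a i j Q • g i Q))
      (volume.restrict Ω) ∧
    ellForm Ω a g g' = ∫ Q in Ω, ∑ i, ∑ j, starRingEnd ℂ (g' j Q) * (a i j Q • g i Q) := by
  have hi : ∀ i j, Integrable (fun Q => starRingEnd ℂ (g' j Q) * (a i j Q • g i Q))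
      (volume.restrict Ω) := fun i j =>
    integrable_conj_mul_smul hopen (ha i j) (hA i j) (g i) (g' j)
  refine ⟨integrable_finsetSum _ fun i _ => integrable_finsetSum _ fun j _ => hi i j, ?_⟩
  rw [integral_finsetSum _ fun i _ => integrable_finsetSum _ fun j _ => hi i j, ellForm]
  refine Finset.sum_congr rfl fun i _ => ?_
  rw [integral_finsetSum _ fun j _ => hi i j]

/-- The formally adjoint divergence form operator belongs to the transposed matrix. -/
theorem conj_ellForm (Ω : Set (Space n)) (a : Fin n → Fin n → Space n → ℝ) (g g' : Fin n → L2 Ω) :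
    starRingEnd ℂ (ellForm Ω a g g') = ellForm Ω (fun i j => a j i) g' g := by
  simp only [ellForm, map_sum, ← integral_conj, map_mul, Complex.conj_conj]
  rw [Finset.sum_comm]
  refine Finset.sum_congr rfl fun j _ => Finset.sum_congr rfl fun i _ => ?_
  refine integral_congr_ae (Eventually.of_forall fun Q => ?_)
  simp only [Complex.real_smul, map_mul, Complex.conj_ofReal]
  ring

/-- As the matrix is real, the real part of the form splits into those of the real and of the
imaginary part of the gradient; the matrix need not be symmetric. -/
theorem le_re_ellForm {Ω : Set (Space n)} (hopen : IsOpen Ω)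
    {a : Fin n → Fin n → Space n → ℝ} (ha : ∀ i j, ContinuousOn (a i j) Ω) {A : ℝ}
    (hA : ∀ i j, ∀ Q ∈ Ω, ‖a i j Q‖ ≤ A) {a₀ : ℝ}
    (hell : ∀ Q ∈ Ω, ∀ ξ : Space n, a₀ * ‖ξ‖ ^ 2 ≤ ∑ i, ∑ j, a i j Q * ξ i * ξ j)
    (g : Fin n → L2 Ω) : a₀ * ∑ i, ‖g i‖ ^ 2 ≤ (ellForm Ω a g g).re := by
  obtain ⟨hi, e⟩ := ellForm_eq hopen ha hA g g
  rw [e, sum_norm_L2_sq, ← integral_const_mul]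
  refine le_trans ?_ (integral_re hi).le
  refine setIntegral_mono_on
    ((integrable_finsetSum _ fun i _ => integrable_norm_sq_L2 (g i)).const_mul _) hi.re
    hopen.measurableSet fun Q hQ => ?_
  have h1 := hell Q hQ (WithLp.toLp 2 fun i => (g i Q).re)
  have h2 := hell Q hQ (WithLp.toLp 2 fun i => (g i Q).im)
  rw [EuclideanSpace.norm_sq_eq] at h1 h2
  have e3 : RCLike.re (∑ i, ∑ j, starRingEnd ℂ (g j Q) * (a i j Q • g i Q)) =
      (∑ i, ∑ j, a i j Q * (g i Q).re * (g j Q).re) +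
        ∑ i, ∑ j, a i j Q * (g i Q).im * (g j Q).im := by
    simp only [map_sum, ← Finset.sum_add_distrib]
    refine Finset.sum_congr rfl fun i _ => Finset.sum_congr rfl fun j _ => ?_
    simp
    ring
  have e4 : ∑ i, ‖g i Q‖ ^ 2 = (∑ i, (g i Q).re ^ 2) + ∑ i, (g i Q).im ^ 2 := by
    rw [← Finset.sum_add_distrib]
    refine Finset.sum_congr rfl fun i _ => ?_
    rw [Complex.sq_norm, Complex.normSq_apply]; ring
  simp only [Real.norm_eq_abs, sq_abs] at h1 h2
  change a₀ * ∑ i, ‖g i Q‖ ^ 2 ≤ _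
  rw [e3, e4, mul_add]
  exact add_le_add h1 h2

/-- Cauchy–Schwarz over the pairs `(i, j)`, with the Frobenius norm of the matrix. -/
theorem norm_ellForm_le {Ω : Set (Space n)} (hopen : IsOpen Ω)
    {a : Fin n → Fin n → Space n → ℝ} (ha : ∀ i j, ContinuousOn (a i j) Ω) {A : ℝ}
    (hA : ∀ i j, ∀ Q ∈ Ω, ‖a i j Q‖ ≤ A) {a₁ : ℝ}
    (h1 : ∀ Q ∈ Ω, Real.sqrt (∑ i, ∑ j, a i j Q ^ 2) ≤ a₁) (g : Fin n → L2 Ω) :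
    ‖ellForm Ω a g g‖ ≤ a₁ * ∑ i, ‖g i‖ ^ 2 := by
  obtain ⟨hi, e⟩ := ellForm_eq hopen ha hA g g
  rw [e, sum_norm_L2_sq, ← integral_const_mul]
  refine (norm_integral_le_integral_norm _).trans (setIntegral_mono_on hi.norm
    ((integrable_finsetSum _ fun i _ => integrable_norm_sq_L2 (g i)).const_mul _)
    hopen.measurableSet fun Q hQ => ?_)
  have b1 : ‖∑ i, ∑ j, starRingEnd ℂ (g j Q) * (a i j Q • g i Q)‖ ≤
      ∑ p : Fin n × Fin n, |a p.1 p.2 Q| * (‖g p.1 Q‖ * ‖g p.2 Q‖) := by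
    rw [Fintype.sum_prod_type]
    refine (norm_sum_le _ _).trans (Finset.sum_le_sum fun i _ => (norm_sum_le _ _).trans
      (le_of_eq (Finset.sum_congr rfl fun j _ => ?_)))
    simp only [norm_mul, norm_smul, RCLike.norm_conj, Real.norm_eq_abs]
    ring
  have b2 := Real.sum_mul_le_sqrt_mul_sqrt Finset.univ
    (fun p : Fin n × Fin n => |a p.1 p.2 Q|) (fun p => ‖g p.1 Q‖ * ‖g p.2 Q‖)
  have e1 : ∑ p : Fin n × Fin n, |a p.1 p.2 Q| ^ 2 = ∑ i, ∑ j, a i j Q ^ 2 := by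
    rw [Fintype.sum_prod_type]; simp
  have e2 : ∑ p : Fin n × Fin n, (‖g p.1 Q‖ * ‖g p.2 Q‖) ^ 2 = (∑ i, ‖g i Q‖ ^ 2) ^ 2 := by
    rw [Fintype.sum_prod_type, sq (∑ i, ‖g i Q‖ ^ 2), Finset.sum_mul_sum]
    simp [mul_pow]
  rw [e1, e2, Real.sqrt_sq (Finset.sum_nonneg fun _ _ => by positivity)] at b2
  refine b1.trans (b2.trans ?_)
  exact mul_le_mul_of_nonneg_right (h1 Q hQ) (Finset.sum_nonneg fun _ _ => by positivity)

theorem abs_le_of_sqrt_sum_le {Ω : Set (Space n)} {a : Fin n → Fin n → Space n → ℝ} {a₁ : ℝ}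
    (h1 : ∀ Q ∈ Ω, Real.sqrt (∑ i, ∑ j, a i j Q ^ 2) ≤ a₁) (i j : Fin n) :
    ∀ Q ∈ Ω, ‖a i j Q‖ ≤ a₁ := by
  intro Q hQ
  refine le_trans (Real.abs_le_sqrt ?_) (h1 Q hQ)
  exact (Finset.single_le_sum (f := fun j => a i j Q ^ 2) (fun _ _ => sq_nonneg _)
    (Finset.mem_univ j)).trans (Finset.single_le_sum (f := fun i => ∑ j, a i j Q ^ 2)
    (fun _ _ => Finset.sum_nonneg fun _ _ => sq_nonneg _) (Finset.mem_univ i))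

/-! ### The right-side derivative on `H¹₀(Ω)` and duality -/

theorem HasEnergy.conj {Ω : Set (Space n)} {f : Space n → ℂ} {E : ℝ≥0∞} (h : HasEnergy Ω f E) :
    HasEnergy Ω (fun Q => starRingEnd ℂ (f Q)) E := by
  obtain ⟨φ, h1, h2, h3⟩ := h
  refine ⟨fun k Q => starRingEnd ℂ (φ k Q), fun k => (h1 k).conj, ?_, h3.congr fun k => ?_⟩
  · filter_upwards [h2] with Q hQ
    exact (Complex.continuous_conj.tendsto _).comp hQ
  · refine lintegral_congr fun Q => ?_
    simp only [gradSq, (h1 k).pderiv_conj, RCLike.norm_conj]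

theorem kip_conj (α : ℝ) (P : Space n) (f : Space n → ℂ) (Q : Space n) :
    kip α P (fun Q => starRingEnd ℂ (f Q)) Q = starRingEnd ℂ (kip α P f Q) := by
  have h : ∀ t, kipIntegrand α P (fun Q => starRingEnd ℂ (f Q)) Q t =
      starRingEnd ℂ (kipIntegrand α P f Q t) := fun t => by
    simp [kipIntegrand]
  simp only [kip, h, intervalIntegral, integral_conj]
  simp

theorem lintegral_ext0_sq_lt_top {Ω : Set (Space n)} (hopen : IsOpen Ω) (u : L2 Ω) :
    ∫⁻ Q, ‖ext0 Ω u Q‖ₑ ^ 2 < ⊤ := by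
  have e : ∫⁻ Q, ‖ext0 Ω u Q‖ₑ ^ 2 = ∫⁻ Q in Ω, ‖u Q‖ₑ ^ 2 := by
    rw [← lintegral_indicator hopen.measurableSet]
    refine lintegral_congr fun Q => ?_
    by_cases hQ : Q ∈ Ω <;> simp [ext0, hQ]
  rw [e]
  exact MemLp.lintegral_sq_lt_top (Lp.memLp u)

/-- `𝔇^α_{d-} (ρ ·)` is defined on `H¹₀(Ω)`, where it is the formal adjoint of `ρ 𝔇^α`. -/
theorem HasGrad.exists_right {Ω : Set (Space n)} (hopen : IsOpen Ω) (hconv : Convex ℝ Ω)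
    (hbdd : Bornology.IsBounded Ω) {P : Space n} (hP : P ∈ frontier Ω)
    {α lam M ρ₁ : ℝ} (h0 : 0 < α) (h1 : α < 1) (hlam : α < lam) (hlam1 : lam ≤ 1) (hM : 0 ≤ M)
    {ρ : Space n → ℝ} (hρ : IsLip Ω lam M ρ) (hρ1 : ∀ Q ∈ Ω, |ρ Q| ≤ ρ₁) {u : L2 Ω}
    {g : Fin n → L2 Ω} (h : HasGrad Ω u g) :
    ∃ w : L2 Ω, (u, w) ∈ rightGraph Ω α P ρ ∧
      ∀ (v z : L2 Ω) (g' : Fin n → L2 Ω), HasGrad Ω v g' → (v, z) ∈ kipGraph Ω α P ρ →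
        ⟪z, u⟫_ℂ = ⟪v, w⟫_ℂ := by
  have hum := ext0_measurable hopen u
  have hu0 : ∀ Q ∉ Ω, ext0 Ω u Q = 0 := fun Q hQ => by simp [ext0, hQ]
  set f : Space n → ℂ := fun Q => ρ Q • ext0 Ω u Q with hf
  have hf0 : ∀ Q ∉ Ω, f Q = 0 := fun Q hQ => by simp [hf, hu0 Q hQ]
  have hfm : Measurable f := by
    have e : f = fun Q => Ω.indicator ρ Q • ext0 Ω u Q := by
      ext Q
      by_cases hQ : Q ∈ Ω
      · simp [hf, hQ]
      · simp [hf, hu0 Q hQ]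
    rw [e]
    exact (hρ.measurable_indicator hopen (h0.trans hlam)).smul hum
  have hE := sum_enorm_sq_lt_top g
  have hfin := lintegral_sq_lintegral_rightDil_lt_top hopen hconv hbdd hP h0 h1 hlam hlam1 hM hρ
    hρ1 hum hu0 hfm (h.hasEnergy hopen) hE (lintegral_ext0_sq_lt_top hopen u)
  have hR := isRightDeriv_rightD hopen hbdd hP h0 hfm hf0 hfin
  refine ⟨hR.target.toLp _, hR.congr (ae_eq_refl _) hR.target.coeFn_toLp.symm, ?_⟩
  intro v z g' hv hz
  have hvm := ext0_measurable hopen v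
  set V : Space n → ℂ := fun Q => starRingEnd ℂ (ext0 Ω v Q) with hV
  have hVm : Measurable V := Complex.continuous_conj.measurable.comp hvm
  have hV0 : ∀ Q ∉ Ω, V Q = 0 := fun Q hQ => by simp [hV, ext0, hQ]
  have hV2 : ∫⁻ Q in Ω, ‖V Q‖ₑ ^ 2 < ⊤ := by
    refine (setLIntegral_le_lintegral Ω _).trans_lt ?_
    simpa only [hV, RCLike.enorm_conj] using lintegral_ext0_sq_lt_top hopen v
  have hρ₁ : ∀ Q, ‖f Q‖ₑ ^ 2 ≤ ENNReal.ofReal (ρ₁ ^ 2) * ‖ext0 Ω u Q‖ₑ ^ 2 := by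
    intro Q
    by_cases hQ : Q ∈ Ω
    · have := sq_le_sq.2 ((hρ1 Q hQ).trans (le_abs_self ρ₁))
      rw [hf, enorm_smul_sq]
      exact mul_le_mul_left (ENNReal.ofReal_le_ofReal this) _
    · simp [hf0 Q hQ]
  have hf2 : ∫⁻ Q in Ω, ‖f Q‖ₑ ^ 2 < ⊤ := by
    refine (setLIntegral_le_lintegral Ω _).trans_lt ((lintegral_mono hρ₁).trans_lt ?_)
    rw [lintegral_const_mul' _ _ ENNReal.ofReal_ne_top]
    exact ENNReal.mul_lt_top ENNReal.ofReal_lt_top (lintegral_ext0_sq_lt_top hopen u)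
  -- integration by parts is bilinear, so it is applied to the complex conjugate of `v`
  have key := integral_mul_rightD_eq_of_sq hopen hconv hbdd hP h0 h1 hfm hVm hf0 hf2
    (hv.hasEnergy hopen).conj (sum_enorm_sq_lt_top g')
    (lintegral_mul_lt_top_of_sq hVm hV0 hV2
      (measurable_lintegral_section (measurable_rightDil hfm)) hfin)
  rw [← setIntegral_eq_integral_of_forall_compl_eq_zero (s := Ω)
      (f := fun Q => V Q * rightD α P f Q) (fun Q hQ => by rw [hV0 Q hQ, zero_mul]),
    ← setIntegral_eq_integral_of_forall_compl_eq_zero (s := Ω)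
      (f := fun Q => f Q * kip α P V Q) (fun Q hQ => by rw [hf0 Q hQ, zero_mul])] at key
  rw [L2.inner_def, L2.inner_def]
  refine Eq.trans ?_ (key.symm.trans ?_)
  · refine integral_congr_ae ?_
    filter_upwards [hz.eq, ae_restrict_mem hopen.measurableSet] with Q e hQ
    have e' : (z : Space n → ℂ) Q = ρ Q • kip α P (ext0 Ω v) Q := e
    rw [e', RCLike.inner_apply, hV, kip_conj]
    simp only [hf, ext0, Set.indicator_of_mem hQ, Complex.real_smul, map_mul, Complex.conj_ofReal]
    ring
  · refine integral_congr_ae ?_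
    filter_upwards [hR.target.coeFn_toLp, ae_restrict_mem hopen.measurableSet] with Q e hQ
    rw [e, RCLike.inner_apply, mul_comm]
    simp [hV, ext0, hQ]

theorem rightGraph_unique {Ω : Set (Space n)} {α : ℝ} {P : Space n} {ρ : Space n → ℝ}
    {u w w' : L2 Ω} (h : (u, w) ∈ rightGraph Ω α P ρ) (h' : (u, w') ∈ rightGraph Ω α P ρ) :
    w = w' := by
  have := Submodule.sub_mem _ h h'
  rw [Prod.mk_sub_mk, sub_self] at this
  exact sub_eq_zero.1 (rightGraph_eq_zero this)

/-! ### The operators on `H²(Ω) ∩ H¹₀(Ω)` -/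

/-- The Poincaré inequality: a consequence of Hardy's, since `|Q - P| ≤ diam Ω`. -/
theorem HasGrad.norm_sq_le {Ω : Set (Space n)} (hopen : IsOpen Ω) (hconv : Convex ℝ Ω)
    (hbdd : Bornology.IsBounded Ω) {P : Space n} (hP : P ∈ frontier Ω) {u : L2 Ω}
    {g : Fin n → L2 Ω} (h : HasGrad Ω u g) :
    ‖u‖ ^ 2 ≤ 4 * Metric.diam Ω ^ 2 * ∑ i, ‖g i‖ ^ 2 := by
  set d := Metric.diam Ω
  have hH := (h.hasEnergy hopen).hardy hopen hconv (notMem_of_mem_frontier hopen hP)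
  have e : ‖u‖ₑ ^ 2 ≤ ENNReal.ofReal (d ^ 2) * (4 * ∑ i, ‖g i‖ₑ ^ 2) := by
    rw [enorm_L2_sq]
    calc ∫⁻ Q in Ω, ‖u Q‖ₑ ^ 2
        ≤ ∫⁻ Q in Ω, ENNReal.ofReal (d ^ 2) * ‖(dist P Q)⁻¹ • ext0 Ω u Q‖ₑ ^ 2 := by
          refine setLIntegral_mono' hopen.measurableSet fun Q hQ => ?_
          have hr := dist_pos_of_mem hopen hP hQ
          rw [enorm_smul_sq, ← mul_assoc, ← ENNReal.ofReal_mul (sq_nonneg _), ← mul_pow]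
          have h1 : 1 ≤ (d * (dist P Q)⁻¹) ^ 2 := one_le_pow₀
            (by rw [← div_eq_mul_inv, one_le_div hr]; exact dist_le_diam hbdd hP hQ)
          rw [ext0, Set.indicator_of_mem hQ]
          refine le_mul_of_one_le_left' ?_
          rwa [ENNReal.one_le_ofReal]
      _ = ENNReal.ofReal (d ^ 2) * ∫⁻ Q in Ω, ‖(dist P Q)⁻¹ • ext0 Ω u Q‖ₑ ^ 2 :=
          lintegral_const_mul' _ _ ENNReal.ofReal_ne_top
      _ ≤ _ := by
          gcongr
          exact (setLIntegral_le_lintegral Ω _).trans hH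
  have hfin : ENNReal.ofReal (d ^ 2) * (4 * ∑ i, ‖g i‖ₑ ^ 2) < ⊤ :=
    ENNReal.mul_lt_top ENNReal.ofReal_lt_top
      (ENNReal.mul_lt_top (by simp) (sum_enorm_sq_lt_top g))
  have e2 := ENNReal.toReal_mono hfin.ne e
  rw [ENNReal.toReal_pow, ENNReal.toReal_mul, ENNReal.toReal_mul,
    ENNReal.toReal_sum fun i _ => (ENNReal.pow_lt_top enorm_lt_top).ne,
    ENNReal.toReal_ofReal (sq_nonneg _), toReal_enorm] at e2
  simp only [ENNReal.toReal_pow, toReal_enorm, ENNReal.toReal_ofNat] at e2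
  linarith

/-- The common domain is dense, because it contains the test functions. -/
theorem dense_H2_inf_H10 {Ω : Set (Space n)} (hopen : IsOpen Ω) :
    Dense ((H2 Ω ⊓ H10 Ω : Submodule ℂ (L2 Ω)) : Set (L2 Ω)) := by
  rw [Submodule.dense_iff_topologicalClosure_eq_top, Submodule.topologicalClosure_eq_top_iff,
    Submodule.eq_bot_iff]
  intro u hu
  have hloc : LocallyIntegrableOn u Ω := locallyIntegrableOn_of_locallyIntegrable_restrict
    ((Lp.memLp u).locallyIntegrable (by norm_num))
  have h0 := hopen.ae_eq_zero_of_integral_contDiff_smul_eq_zero hloc fun χ h1 h2 h3 => by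
    have hs : tsupport (fun x => (χ x : ℂ)) ⊆ tsupport χ :=
      closure_mono fun x hx h0 => hx (by simp [h0])
    have hT : IsTest Ω fun x => (χ x : ℂ) := ⟨Complex.ofRealCLM.contDiff.comp h1,
      h2.of_isClosed_subset (isClosed_tsupport _) hs, hs.trans h3⟩
    have e := (Submodule.mem_orthogonal _ u).1 hu _ hT.toL2_mem
    rw [L2.inner_def] at e
    rw [← setIntegral_eq_integral_of_forall_compl_eq_zero (s := Ω)
      (f := fun x => χ x • (u : Space n → ℂ) x) (fun x hx => by
        rw [image_eq_zero_of_notMem_tsupport (fun hx' => hx (h3 hx')), zero_smul]), ← e]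
    refine integral_congr_ae ?_
    filter_upwards [hT.coeFn_toL2] with x hx
    rw [hx, RCLike.inner_apply, Complex.conj_ofReal, Complex.real_smul, mul_comm]
  exact Lp.eq_zero_iff_ae_eq_zero.2 ((ae_restrict_iff' hopen.measurableSet).2 h0)

theorem Coefficients.continuousOn {Ω : Set (Space n)} {α a₀ lam M μ : ℝ} {P : Space n}
    {a : Fin n → Fin n → Space n → ℝ} {ρ : Space n → ℝ}
    (h : Coefficients Ω α P a ρ a₀ lam M μ) (i j : Fin n) : ContinuousOn (a i j) Ω :=
  (h.smooth i j).continuousOn.mono subset_closure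

theorem Coefficients.aestronglyMeasurable {Ω : Set (Space n)} (hopen : IsOpen Ω)
    {α a₀ lam M μ : ℝ} (h0 : 0 < α) {P : Space n} {a : Fin n → Fin n → Space n → ℝ}
    {ρ : Space n → ℝ} (h : Coefficients Ω α P a ρ a₀ lam M μ) :
    AEStronglyMeasurable ρ (volume.restrict Ω) :=
  (h.lip.continuousOn (h0.trans h.lt)).aestronglyMeasurable hopen.measurableSet

theorem Coefficients.abs_le {Ω : Set (Space n)} {α a₀ lam M μ ρ₁ : ℝ} {P : Space n}
    {a : Fin n → Fin n → Space n → ℝ} {ρ : Space n → ℝ}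
    (h : Coefficients Ω α P a ρ a₀ lam M μ) (hρ1 : ∀ Q ∈ Ω, ρ Q ≤ ρ₁) :
    ∀ Q ∈ Ω, |ρ Q| ≤ ρ₁ := fun Q hQ => by
  rw [abs_of_pos (h.pos Q hQ)]; exact hρ1 Q hQ

theorem nonempty_of_mem_frontier {Ω : Set (Space n)} {P : Space n} (hP : P ∈ frontier Ω) :
    Ω.Nonempty := by
  rw [Set.nonempty_iff_ne_empty]
  rintro rfl
  simp at hP

theorem diam_pos_of_mem_frontier {Ω : Set (Space n)} (hopen : IsOpen Ω)
    (hbdd : Bornology.IsBounded Ω) {P : Space n} (hP : P ∈ frontier Ω) : 0 < Metric.diam Ω := by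
  obtain ⟨Q, hQ⟩ := nonempty_of_mem_frontier hP
  exact (dist_pos_of_mem hopen hP hQ).trans_le (dist_le_diam hbdd hP hQ)

theorem sInf_image_nonneg {Ω : Set (Space n)} {ρ : Space n → ℝ} (hpos : ∀ Q ∈ Ω, 0 < ρ Q) :
    0 ≤ sInf (ρ '' Ω) :=
  Real.sInf_nonneg (by rintro _ ⟨x, hx, rfl⟩; exact (hpos x hx).le)

theorem domain_opL {Ω : Set (Space n)} (hopen : IsOpen Ω) (hconv : Convex ℝ Ω)
    (hbdd : Bornology.IsBounded Ω) {P : Space n} (hP : P ∈ frontier Ω) {α a₀ lam M μ ρ₁ : ℝ}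
    (h0 : 0 < α) (h1 : α < 1) {a : Fin n → Fin n → Space n → ℝ} {ρ : Space n → ℝ}
    (hc : Coefficients Ω α P a ρ a₀ lam M μ) (hρ1 : ∀ Q ∈ Ω, ρ Q ≤ ρ₁) :
    (opL Ω α P a ρ).domain = H2 Ω ⊓ H10 Ω := by
  rw [opL, Submodule.toLinearPMap_domain]
  refine le_antisymm ?_ fun u hu => ?_
  · rintro _ ⟨p, hp, rfl⟩
    exact hp.1
  · obtain ⟨v, hv⟩ := exists_mem_divGraph hopen hconv hbdd hc.smooth hu.1
    obtain ⟨g, hg, -⟩ := exists_hasGrad hu.2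
    obtain ⟨w, hw, -⟩ := hg.exists_kip hopen hconv hbdd hP h1 (hc.aestronglyMeasurable hopen h0)
      (hc.abs_le hρ1)
    exact ⟨(u, v + w), ⟨hu, v, w, hv, hw, rfl⟩, rfl⟩

theorem domain_opLPlus {Ω : Set (Space n)} (hopen : IsOpen Ω) (hconv : Convex ℝ Ω)
    (hbdd : Bornology.IsBounded Ω) {P : Space n} (hP : P ∈ frontier Ω) {α a₀ lam M μ ρ₁ : ℝ}
    (h0 : 0 < α) (h1 : α < 1) {a : Fin n → Fin n → Space n → ℝ} {ρ : Space n → ℝ}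
    (hc : Coefficients Ω α P a ρ a₀ lam M μ) (hρ1 : ∀ Q ∈ Ω, ρ Q ≤ ρ₁) :
    (opLPlus Ω α P a ρ).domain = H2 Ω ⊓ H10 Ω := by
  obtain ⟨Q, hQ⟩ := nonempty_of_mem_frontier hP
  rw [opLPlus, Submodule.toLinearPMap_domain]
  refine le_antisymm ?_ fun u hu => ?_
  · rintro _ ⟨p, hp, rfl⟩
    exact hp.1
  · obtain ⟨v, hv⟩ := exists_mem_divGraph hopen hconv hbdd (a := fun i j => a j i)
      (fun i j => hc.smooth j i) hu.1
    obtain ⟨g, hg, -⟩ := exists_hasGrad hu.2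
    obtain ⟨w, hw, -⟩ := hg.exists_right hopen hconv hbdd hP h0 h1 hc.lt hc.le
      (hc.lip.nonneg hopen hP hQ) hc.lip (hc.abs_le hρ1)
    exact ⟨(u, v + w), ⟨hu, v, w, hv, hw, rfl⟩, rfl⟩

theorem isFormalAdjoint_opL_opLPlus {Ω : Set (Space n)} (hopen : IsOpen Ω) (hconv : Convex ℝ Ω)
    (hbdd : Bornology.IsBounded Ω) {P : Space n} (hP : P ∈ frontier Ω) {α a₀ lam M μ ρ₁ a₁ : ℝ}
    (h0 : 0 < α) (h1 : α < 1) {a : Fin n → Fin n → Space n → ℝ} {ρ : Space n → ℝ}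
    (hc : Coefficients Ω α P a ρ a₀ lam M μ) (hρ1 : ∀ Q ∈ Ω, ρ Q ≤ ρ₁)
    (ha₁ : ∀ Q ∈ Ω, Real.sqrt (∑ i, ∑ j, a i j Q ^ 2) ≤ a₁) :
    (opL Ω α P a ρ).IsFormalAdjoint (opLPlus Ω α P a ρ) := by
  intro x y
  have hx := LinearPMap.mem_graph _ x
  have hy := LinearPMap.mem_graph _ y
  rw [opL_graph hopen] at hx
  rw [opLPlus_graph hopen] at hy
  obtain ⟨hxD, v, w, hv, hw, hvw⟩ := hx
  obtain ⟨hyD, v', w', hv', hw', hvw'⟩ := hy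
  simp only at hxD hyD hvw hvw' hv hw hv' hw'
  obtain ⟨g, hg, hgw⟩ := exists_hasGrad hxD.2
  obtain ⟨g', hg', hgw'⟩ := exists_hasGrad hyD.2
  obtain ⟨Q, hQ⟩ := nonempty_of_mem_frontier hP
  obtain ⟨w'', hw'', hdual⟩ := hg'.exists_right hopen hconv hbdd hP h0 h1 hc.lt hc.le
    (hc.lip.nonneg hopen hP hQ) hc.lip (hc.abs_le hρ1)
  rw [rightGraph_unique hw'' hw'] at hdual
  have hA := abs_le_of_sqrt_sum_le ha₁
  have e1 := HasGrad.inner_div_eq hopen hc.continuousOn hA hgw hg' hv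
  have e2 := HasGrad.inner_div_eq hopen (fun i j => hc.continuousOn j i) (fun i j => hA j i)
    hgw' hg hv'
  rw [hvw, hvw', inner_add_left, inner_add_right, hdual _ _ _ hg hw, e2, ← conj_ellForm, ← e1,
    inner_conj_symm]

/-- The estimates behind the theorem, for `u` in the domain of `L`: the elliptic part dominates
the Dirichlet energy `E`, the real part of the fractional part is at least `μ inf ρ ‖u‖²`, and its
absolute value is at most a multiple of `‖u‖ √E`. -/
theorem opL_estimates {Ω : Set (Space n)} (hopen : IsOpen Ω) (hconv : Convex ℝ Ω)
    (hbdd : Bornology.IsBounded Ω) {P : Space n} (hP : P ∈ frontier Ω) {α a₀ lam M μ ρ₁ a₁ η : ℝ}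
    (h0 : 0 < α) (h1 : α < 1) (ha₀ : 0 < a₀) (hη : 0 < η)
    {a : Fin n → Fin n → Space n → ℝ} {ρ : Space n → ℝ}
    (hc : Coefficients Ω α P a ρ a₀ lam M μ) (hρ1 : ∀ Q ∈ Ω, ρ Q ≤ ρ₁)
    (ha₁ : ∀ Q ∈ Ω, Real.sqrt (∑ i, ∑ j, a i j Q ^ 2) ≤ a₁) (x : (opL Ω α P a ρ).domain) :
    a₀ / (4 * Metric.diam Ω ^ 2) * ‖(x : L2 Ω)‖ ^ 2 ≤ (⟪(x : L2 Ω), opL Ω α P a ρ x⟫_ℂ).re ∧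
    |(⟪(x : L2 Ω), opL Ω α P a ρ x⟫_ℂ).im| ≤ (a₁ + η) / a₀ *
      ((⟪(x : L2 Ω), opL Ω α P a ρ x⟫_ℂ).re - (μ * sInf (ρ '' Ω) -
        a₀ * ρ₁ ^ 2 * (kipBound n (Metric.diam Ω) α).toReal / (4 * η ^ 2)) *
          ‖(x : L2 Ω)‖ ^ 2) := by
  have hx := LinearPMap.mem_graph _ x
  rw [opL_graph hopen] at hx
  obtain ⟨hxD, v, w, hv, hw, hvw⟩ := hx
  simp only at hxD hvw hv hw
  obtain ⟨g, hg, hgw⟩ := exists_hasGrad hxD.2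
  set u : L2 Ω := (x : L2 Ω)
  have hA := abs_le_of_sqrt_sum_le ha₁
  obtain ⟨w', hw', hwb⟩ := hg.exists_kip hopen hconv hbdd hP h1 (hc.aestronglyMeasurable hopen h0)
    (hc.abs_le hρ1)
  rw [← kipGraph_unique hw hw'] at hwb
  have b1 := le_re_ellForm hopen hc.continuousOn hA hc.elliptic g
  have b2 := norm_ellForm_le hopen hc.continuousOn hA ha₁ g
  rw [← HasGrad.inner_div_eq hopen hc.continuousOn hA hgw hg hv] at b1 b2
  have b3 := hg.le_re_inner_kip hopen hconv hbdd hP h0 h1 hc.lt hc.lip hc.pos hρ1 hc.isMu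
    hc.mu_pos.le hw
  have b4 := hg.norm_sq_le hopen hconv hbdd hP
  have hd := diam_pos_of_mem_frontier hopen hbdd hP
  have hm : 0 ≤ μ * sInf (ρ '' Ω) * ‖u‖ ^ 2 :=
    mul_nonneg (mul_nonneg hc.mu_pos.le (sInf_image_nonneg hc.pos)) (by positivity)
  have ha₁0 : 0 ≤ a₁ := by
    obtain ⟨Q, hQ⟩ := nonempty_of_mem_frontier hP
    exact (Real.sqrt_nonneg _).trans (ha₁ Q hQ)
  rw [hvw, inner_add_right, Complex.add_re, Complex.add_im]
  set E := ∑ i, ‖g i‖ ^ 2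
  have hE : 0 ≤ E := Finset.sum_nonneg fun _ _ => by positivity
  set d := Metric.diam Ω
  set K := (kipBound n d α).toReal
  have hK : 0 ≤ K := ENNReal.toReal_nonneg
  set m := μ * sInf (ρ '' Ω)
  constructor
  · have : a₀ / (4 * d ^ 2) * ‖u‖ ^ 2 ≤ a₀ * E := by
      rw [div_mul_eq_mul_div, div_le_iff₀ (by positivity)]
      calc a₀ * ‖u‖ ^ 2 ≤ a₀ * (4 * d ^ 2 * E) := by gcongr
        _ = _ := by ring
    linarith
  · have c1 : |(⟪u, v⟫_ℂ).im| ≤ a₁ * E := (Complex.abs_im_le_norm _).trans b2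
    have c2 : |(⟪u, w⟫_ℂ).im| ≤ ‖u‖ * ‖w‖ :=
      (Complex.abs_im_le_norm _).trans (norm_inner_le_norm _ _)
    -- `4 η ‖u‖ ‖w‖ ≤ 4 η² E + ρ₁² K ‖u‖²`, as `‖w‖² ≤ ρ₁² K E`
    have c3 : 4 * η * (‖u‖ * ‖w‖) ≤ 4 * η ^ 2 * E + ρ₁ ^ 2 * K * ‖u‖ ^ 2 := by
      refine (pow_le_pow_iff_left₀ (by positivity) (by positivity) two_ne_zero).1 ?_
      have : (4 * η * (‖u‖ * ‖w‖)) ^ 2 ≤ 16 * η ^ 2 * ‖u‖ ^ 2 * (ρ₁ ^ 2 * K * E) := by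
        calc (4 * η * (‖u‖ * ‖w‖)) ^ 2 = 16 * η ^ 2 * ‖u‖ ^ 2 * ‖w‖ ^ 2 := by ring
          _ ≤ _ := by gcongr
      nlinarith [sq_nonneg (4 * η ^ 2 * E - ρ₁ ^ 2 * K * ‖u‖ ^ 2)]
    have c4 : ‖u‖ * ‖w‖ ≤ η * E + ρ₁ ^ 2 * K / (4 * η) * ‖u‖ ^ 2 := by
      have : η * E + ρ₁ ^ 2 * K / (4 * η) * ‖u‖ ^ 2 =
          (4 * η ^ 2 * E + ρ₁ ^ 2 * K * ‖u‖ ^ 2) / (4 * η) := by field_simp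
      rw [this, le_div_iff₀ (by positivity)]
      linarith
    have c5 : ρ₁ ^ 2 * K / (4 * η) * ‖u‖ ^ 2 ≤
        (a₁ + η) * (ρ₁ ^ 2 * K / (4 * η ^ 2)) * ‖u‖ ^ 2 := by
      refine mul_le_mul_of_nonneg_right ?_ (by positivity)
      calc ρ₁ ^ 2 * K / (4 * η) = η * (ρ₁ ^ 2 * K / (4 * η ^ 2)) := by field_simp
        _ ≤ _ := mul_le_mul_of_nonneg_right (by linarith) (by positivity)
    calc |(⟪u, v⟫_ℂ).im + (⟪u, w⟫_ℂ).im| ≤ |(⟪u, v⟫_ℂ).im| + |(⟪u, w⟫_ℂ).im| := abs_add_le _ _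
      _ ≤ (a₁ + η) * E + (a₁ + η) * (ρ₁ ^ 2 * K / (4 * η ^ 2)) * ‖u‖ ^ 2 := by linarith
      _ = (a₁ + η) / a₀ * (a₀ * E + a₀ * ρ₁ ^ 2 * K / (4 * η ^ 2) * ‖u‖ ^ 2) := by
        field_simp
      _ ≤ _ := by
        refine mul_le_mul_of_nonneg_left ?_ (by positivity)
        linarith

/-! ### Closures and sectors -/

section Hilbert

variable {H : Type*} [NormedAddCommGroup H] [InnerProductSpace ℂ H]

/-- A closed condition on the graph of `T` passes to the graph of the closure. -/
theorem closure_induction {T : H →ₗ.[ℂ] H} (hT : T.IsClosable) {S : Set (H × H)}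
    (hS : IsClosed S) (h : ∀ x : T.domain, ((x : H), T x) ∈ S) (x : T.closure.domain) :
    ((x : H), T.closure x) ∈ S := by
  have hx := LinearPMap.mem_graph _ x
  rw [← hT.graph_closure_eq_closure_graph] at hx
  refine closure_minimal ?_ hS hx
  intro p hp
  obtain ⟨y, hy1, hy2⟩ := (LinearPMap.mem_graph_iff T).1 hp
  have := h y
  rwa [hy1, hy2] at this

theorem le_re_inner_closure {T : H →ₗ.[ℂ] H} (hT : T.IsClosable) {δ : ℝ}
    (h : ∀ x : T.domain, δ * ‖(x : H)‖ ^ 2 ≤ (⟪(x : H), T x⟫_ℂ).re) (x : T.closure.domain) :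
    δ * ‖(x : H)‖ ^ 2 ≤ (⟪(x : H), T.closure x⟫_ℂ).re := by
  have hS : IsClosed {p : H × H | δ * ‖p.1‖ ^ 2 ≤ (⟪p.1, p.2⟫_ℂ).re} :=
    isClosed_le (by fun_prop) (Complex.continuous_re.comp (by fun_prop))
  exact closure_induction hT hS h x

theorem abs_im_inner_closure_le {T : H →ₗ.[ℂ] H} (hT : T.IsClosable) {t γ : ℝ}
    (h : ∀ x : T.domain,
      |(⟪(x : H), T x⟫_ℂ).im| ≤ t * ((⟪(x : H), T x⟫_ℂ).re - γ * ‖(x : H)‖ ^ 2))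
    (x : T.closure.domain) :
    |(⟪(x : H), T.closure x⟫_ℂ).im| ≤
      t * ((⟪(x : H), T.closure x⟫_ℂ).re - γ * ‖(x : H)‖ ^ 2) := by
  have hi : Continuous fun p : H × H => ⟪p.1, p.2⟫_ℂ := by fun_prop
  have hS : IsClosed {p : H × H |
      |(⟪p.1, p.2⟫_ℂ).im| ≤ t * ((⟪p.1, p.2⟫_ℂ).re - γ * ‖p.1‖ ^ 2)} :=
    isClosed_le (Complex.continuous_im.comp hi).abs
      (continuous_const.mul ((Complex.continuous_re.comp hi).sub (by fun_prop)))
  exact closure_induction hT hS h x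

theorem abs_arg_le_arctan {z : ℂ} {t : ℝ} (ht : 0 < t) (h : |z.im| ≤ t * z.re) :
    |z.arg| ≤ Real.arctan t := by
  have hre : 0 ≤ z.re := nonneg_of_mul_nonneg_right ((abs_nonneg _).trans h) ht
  rcases hre.eq_or_lt with h0 | hpos
  · have : z = 0 := Complex.ext h0.symm (by
      rw [← h0, mul_zero] at h
      exact abs_nonpos_iff.1 h)
    simp [this, Real.arctan_nonneg.2 ht.le]
  · have hlt := abs_lt.1 (Complex.abs_arg_lt_pi_div_two_iff.2 (Or.inl hpos))
    have e : z.arg = Real.arctan (z.im / z.re) := by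
      rw [← Complex.tan_arg, Real.arctan_tan hlt.1 hlt.2]
    have b := abs_le.1 h
    rw [e, abs_le, ← Real.arctan_neg]
    constructor
    · refine Real.arctan_mono ?_
      rw [le_div_iff₀ hpos]; linarith
    · refine Real.arctan_mono ?_
      rw [div_le_iff₀ hpos]; linarith

theorem numericalRange_subset_sector {T : H →ₗ.[ℂ] H} {t γ : ℝ} (ht : 0 < t)
    (h : ∀ x : T.domain,
      |(⟪(x : H), T x⟫_ℂ).im| ≤ t * ((⟪(x : H), T x⟫_ℂ).re - γ * ‖(x : H)‖ ^ 2)) :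
    numericalRange T ⊆ sector γ (Real.arctan t) := by
  rintro ζ ⟨x, hx, rfl⟩
  refine abs_arg_le_arctan ht ?_
  have := h x
  rw [hx] at this
  simpa using this

/-- A formal adjoint of a densely defined operator is closable. -/
theorem isClosable_of_isFormalAdjoint [CompleteSpace H] {T S : H →ₗ.[ℂ] H}
    (hT : Dense (T.domain : Set H)) (h : T.IsFormalAdjoint S) : S.IsClosable :=
  (LinearPMap.adjoint_isClosed hT).isClosable.leIsClosable (h.le_adjoint hT)

end Hilbert

end Kipriyanov

end

theorem theorem4p2 {n : ℕ} (Ω : Set (Kipriyanov.Space n)) (hopen : IsOpen Ω)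
    (hconv : Convex ℝ Ω) (hbdd : Bornology.IsBounded Ω)
    (α : ℝ) (hα0 : 0 < α) (hα1 : α < 1)
    (a₀ a₁ ρ₁ η : ℝ) (ha₀ : 0 < a₀) (hη : 0 < η) :
    ∃ C : ℝ, ∀ P ∈ frontier Ω,
      ∀ (a : Fin n → Fin n → Kipriyanov.Space n → ℝ) (ρ : Kipriyanov.Space n → ℝ)
        (lam M μ : ℝ),
        Kipriyanov.Coefficients Ω α P a ρ a₀ lam M μ →
        (∀ Q ∈ Ω, Real.sqrt (∑ i, ∑ j, a i j Q ^ 2) ≤ a₁) →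
        (∀ Q ∈ Ω, ρ Q ≤ ρ₁) →
        ((Kipriyanov.opL Ω α P a ρ).domain = Kipriyanov.H2 Ω ⊓ Kipriyanov.H10 Ω ∧
          (Kipriyanov.opLPlus Ω α P a ρ).domain = Kipriyanov.H2 Ω ⊓ Kipriyanov.H10 Ω) ∧
        ((Kipriyanov.opL Ω α P a ρ).IsClosable ∧ (Kipriyanov.opLPlus Ω α P a ρ).IsClosable) ∧
        (Kipriyanov.StrictlyAccretive (Kipriyanov.opL Ω α P a ρ).closure ∧
          Kipriyanov.StrictlyAccretive (Kipriyanov.opLPlus Ω α P a ρ).closure) ∧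
        (Kipriyanov.numericalRange (Kipriyanov.opL Ω α P a ρ).closure ⊆
            Kipriyanov.sector (μ * sInf (ρ '' Ω) - C) (Real.arctan ((a₁ + η) / a₀)) ∧
          Kipriyanov.numericalRange (Kipriyanov.opLPlus Ω α P a ρ).closure ⊆
            Kipriyanov.sector (μ * sInf (ρ '' Ω) - C) (Real.arctan ((a₁ + η) / a₀))) := by
  open Kipriyanov in
  refine ⟨a₀ * ρ₁ ^ 2 * (kipBound n (Metric.diam Ω) α).toReal / (4 * η ^ 2), ?_⟩
  intro P hP a ρ lam M μ hc ha₁ hρ1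
  have hd1 := domain_opL hopen hconv hbdd hP hα0 hα1 hc hρ1
  have hd2 := domain_opLPlus hopen hconv hbdd hP hα0 hα1 hc hρ1
  have hadj := isFormalAdjoint_opL_opLPlus hopen hconv hbdd hP hα0 hα1 hc hρ1 ha₁
  have hD := dense_H2_inf_H10 hopen
  have hc2 : (opLPlus Ω α P a ρ).IsClosable := isClosable_of_isFormalAdjoint (hd1 ▸ hD) hadj
  have hc1 : (opL Ω α P a ρ).IsClosable := isClosable_of_isFormalAdjoint (hd2 ▸ hD) hadj.symm
  have est := opL_estimates hopen hconv hbdd hP hα0 hα1 ha₀ hη hc hρ1 ha₁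
  -- the values of the form of `L⁺` are the complex conjugates of those of the form of `L`
  have hval : ∀ y : (opLPlus Ω α P a ρ).domain, ∃ x : (opL Ω α P a ρ).domain,
      (x : L2 Ω) = y ∧ ⟪(y : L2 Ω), opLPlus Ω α P a ρ y⟫_ℂ =
        starRingEnd ℂ ⟪(x : L2 Ω), opL Ω α P a ρ x⟫_ℂ := fun y => by
    refine ⟨⟨y, hd1.symm ▸ hd2 ▸ y.2⟩, rfl, ?_⟩
    rw [inner_conj_symm]
    exact (hadj ⟨y, _⟩ y).symm
  have est2 : ∀ y : (opLPlus Ω α P a ρ).domain, _ ∧ _ := fun y => by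
    obtain ⟨x, hx, e⟩ := hval y
    have h := est x
    rw [hx] at h
    have hre := congrArg Complex.re e
    have him := congrArg Complex.im e
    rw [Complex.conj_re, hx] at hre
    rw [Complex.conj_im, hx] at him
    rw [← hre, ← abs_neg, ← him] at h
    exact h
  have hδ : 0 < a₀ / (4 * Metric.diam Ω ^ 2) := by
    have := diam_pos_of_mem_frontier hopen hbdd hP
    positivity
  have ht : 0 < (a₁ + η) / a₀ := by
    obtain ⟨Q, hQ⟩ := nonempty_of_mem_frontier hP
    have := (Real.sqrt_nonneg _).trans (ha₁ Q hQ)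
    positivity
  exact ⟨⟨hd1, hd2⟩, ⟨hc1, hc2⟩,
    ⟨⟨_, hδ, le_re_inner_closure hc1 fun x => (est x).1⟩,
      ⟨_, hδ, le_re_inner_closure hc2 fun x => (est2 x).1⟩⟩,
    numericalRange_subset_sector ht (abs_im_inner_closure_le hc1 fun x => (est x).2),
    numericalRange_subset_sector ht (abs_im_inner_closure_le hc2 fun x => (est2 x).2)⟩
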